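/- **Setting.** Let $n,k\ge 0$, let $N\subseteq T^*\mathbb{R}^n$ be open, with canonical coordinates $(p,q)$, and let $[t_a,t_b]$ be an interval, $t_a<t_b$. Let $H_1,\dots,H_k$ be smooth functions on $N$ (the constraints) that are in involution (first class): there are smooth structure functions $f_{\alpha\beta}^\gamma$ on $N$ with $$\{H_\alpha,H_\beta\}=f_{\alpha\beta}^\gamma H_\gamma,\qquad \{F,K\}=\frac{\partial F}{\partial p_i}\frac{\partial K}{\partial q^i}-\frac{\partial F}{\partial q^i}\frac{\partial K}{\partial p_i}.$$ The Lagrange multipliers are $\mathbb{R}^k$-valued one-forms $e=e(t)\,dt$ on $[t_a,t_b]$ with continuous coefficients; they form the Banach space $\mathcal E=C([t_a,t_b],\mathbb{R}^k)$. For $S[p,q,e]=\int_{t_a}^{t_b}(p_i\,dq^i-e^\alpha H_\alpha(p,q))$, the Euler-Lagrange equations for paths in $N$ are the evolution equations $dq^i=e^\alpha\,\partial H_\alpha/\partial p_i$, $dp_i=-e^\alpha\,\partial H_\alpha/\partial q^i$ together with the constraints $H_\alpha(p,q)=0$ at all times. Let $(P,Q)$ be another set of Darboux coordinates on $N$ and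 let $f(q,Q)$ be a smooth generating function for the change of coordinates, $p_i\,dq^i=P_i\,dQ^i+df$. Put $$S^f[p,q,e]=-f\bigl(q(t_b),Q(p(t_b),q(t_b))\bigr)+\int_{t_a}^{t_b}(p_i\,dq^i-e^\alpha H_\alpha(p,q)).$$ Let $\mathcal D\subseteq\mathbb{R}^n\times\mathbb{R}^n\times\mathcal E$ be an open set (for instance everything) such that for every $(q_a,Q_b,e)\in\mathcal D$ the evolution equations for $e$ (without the constraints) have exactly one solution $x=(p,q)$ in $N$ on $[t_a,t_b]$ with $q(t_a)=q_a$ and $Q(p(t_b),q(t_b))=Q_b$, and such that $p(t_a)$ depends differentiably on $(q_a,Q_b,e)$. The Hamilton-Jacobi action $S^f_{HJ}(q_a,Q_b)[e]$ is the value of $S^f$ at this solution. The evolution relation $L$ is the set of pairs $(x(t_a),x(t_b))$ of endpoint values of solutions of all the Euler-Lagrange equations (evolution equations and constraints) whose data $(q(t_a),Q(x(t_b)),e)$ lie in $\mathcal D$. A $C^1$ function $\psi(q,Q;T)$, defined for $(q,Q,T)$ in an open set, with $T$ in a (possibly Banach) parameter manifold, is a *generalized generating function* for $L$ if $L$, in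 the coordinates $(p,q)$ at the initial and $(P,Q)$ at the final endpoint, is the set of all $(p,q,P,Q)$ for which there is a $T$ with $$P_i=\frac{\partial\psi}{\partial Q^i},\qquad p_i=-\frac{\partial\psi}{\partial q^i},\qquad \frac{\partial\psi}{\partial T}=0 \quad\text{at }(q,Q,T).$$ An infinitesimal gauge transformation at $(q_a,Q_b,e)$ is a variation $\delta e^\gamma=d\lambda^\gamma+f_{\alpha\beta}^\gamma\, e^\alpha\lambda^\beta$ with functions $\lambda^\alpha$ on $[t_a,t_b]$ vanishing at both endpoints, the $f_{\alpha\beta}^\gamma$ being evaluated along the solution for $(q_a,Q_b,e)$. The gauge class $[e]$ (for given $q_a,Q_b$) is the class of $e$ for the equivalence relation generated by joining two multipliers by a path inside $\mathcal D$, differentiable in its parameter, all of whose velocities are infinitesimal gauge transformations. **Theorem.** 1. $S^f_{HJ}(q_a,Q_b)[e]$ is a generalized generating function for $L$ with parameter $e$, and for $(q_a,Q_b,e)\in\mathcal D$ one has $\partial S^f_{HJ}/\partial e=0$ if and only if the solution for $(q_a,Q_b,e)$ satisfies the constraints at all times. 2. $S^f_{HJ}(q_a,Q_b)[e]$ depends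 on $e$ only through its gauge class, so that $\hat S^f_{HJ}(q_a,Q_b;[e]):=S^f_{HJ}(q_a,Q_b)[e]$ is well defined; and $\hat S^f_{HJ}$ (differentiated through $e\mapsto[e]$) is a generalized generating function for $L$. 3. (Strictly involutive case.) Suppose that $\{H_\alpha,H_\beta\}=0$ for all $\alpha,\beta$ and that with $(q_a,Q_b,e)$ the set $\mathcal D$ contains all $(q_a,Q_b,e')$ with $\int_{t_a}^{t_b}e'=\int_{t_a}^{t_b}e$. Then $S^f_{HJ}(q_a,Q_b)[e]=\hat S^f_{HJ}(q_a,Q_b;T)$ with $T=\int_{t_a}^{t_b}e\in\mathbb{R}^k$ for a function $\hat S^f_{HJ}(q_a,Q_b;T)$ on the image of $\mathcal D$, which is a generalized generating function for $L$ with parameter $T$; and $\partial\hat S^f_{HJ}/\partial T=0$ at $(q_a,Q_b,\int_{t_a}^{t_b} e)$ if and only if the solution for $(q_a,Q_b,e)$ satisfies the constraints. 4. (Lie algebra case.) Suppose that $\{H_\alpha,H_\beta\}=c_{\alpha\beta}^\gamma H_\gamma$ with constants $c_{\alpha\beta}^\gamma$, and let $G$ be a simply connected Lie group whose Lie algebra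 has a basis $(u_\alpha)$ with $[u_\alpha,u_\beta]=c_{\alpha\beta}^\gamma u_\gamma$. For $e\in\mathcal E$ there is exactly one path ordered exponential $g=P\exp\int_{t_a}^{t_b}e=h(t_b)\in G$, where $h(t_a)=1$ and $h^{-1}dh=e^\alpha u_\alpha$. If with $(q_a,Q_b,e)$ the set $\mathcal D$ contains all $(q_a,Q_b,e')$ with $P\exp\int e'=P\exp\int e$, then $S^f_{HJ}(q_a,Q_b)[e]=\hat S^f_{HJ}(q_a,Q_b;g)$ with $g=P\exp\int_{t_a}^{t_b}e$ for a function $\hat S^f_{HJ}(q_a,Q_b;g)$ on the image of $\mathcal D$, which is a generalized generating function for $L$ with parameter $g\in G$; and $\partial\hat S^f_{HJ}/\partial g=0$ at $(q_a,Q_b,P\exp\int e)$ if and only if the solution for $(q_a,Q_b,e)$ satisfies the constraints. -/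

import Mathlib

open scoped Manifold ContDiff

-- So that a normed space is charted on itself by the identity chart without a detour.
attribute [-instance] TopCat.of.chartedSpace

noncomputable section

/-- Points `(p, q)` of the cotangent bundle `T*ℝⁿ`, in the order momentum, position. -/
abbrev Phase (n : ℕ) : Type := (Fin n → ℝ) × (Fin n → ℝ)

/-- `∂F/∂pᵢ` at the point `y = (p, q)`. -/
def dMom {n : ℕ} (F : Phase n → ℝ) (y : Phase n) (i : Fin n) : ℝ :=
  fderiv ℝ F y (Pi.single i 1, 0)

/-- `∂F/∂qⁱ` at the point `y = (p, q)`. -/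
def dPos {n : ℕ} (F : Phase n → ℝ) (y : Phase n) (i : Fin n) : ℝ :=
  fderiv ℝ F y (0, Pi.single i 1)

/-- The Poisson bracket `{F, K} = ∂F/∂pᵢ ∂K/∂qⁱ - ∂F/∂qⁱ ∂K/∂pᵢ`. -/
def poissonBracket {n : ℕ} (F K : Phase n → ℝ) (y : Phase n) : ℝ :=
  ∑ i, (dMom F y i * dPos K y i - dPos F y i * dMom K y i)

/-- First-class constraints `H_α` on an open subset `N` of `T*ℝⁿ`: smooth functions in involution,
`{H_α, H_β} = f_{αβ}^γ H_γ`, with smooth structure functions `f α β γ = f_{αβ}^γ`. -/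
structure FirstClassSystem (n k : ℕ) where
  N : Set (Phase n)
  isOpen_N : IsOpen N
  H : Fin k → Phase n → ℝ
  smooth_H : ∀ α, ContDiffOn ℝ ∞ (H α) N
  f : Fin k → Fin k → Fin k → Phase n → ℝ
  smooth_f : ∀ α β γ, ContDiffOn ℝ ∞ (f α β γ) N
  involutive : ∀ α β, ∀ y ∈ N, poissonBracket (H α) (H β) y = ∑ γ, f α β γ y * H γ y

/-- Another set of Darboux coordinates `(P, Q)` on `N ⊆ T*ℝⁿ`, with a generating function
`f(q, Q)` of the change of polarization: `pᵢ dqⁱ = Pᵢ dQⁱ + df` as one-forms on `N`. (The equation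
makes `(P, Q)` symplectic, hence a local diffeomorphism; injectivity makes it a chart.) -/
structure DarbouxChange {n : ℕ} (N : Set (Phase n)) where
  P : Phase n → (Fin n → ℝ)
  Q : Phase n → (Fin n → ℝ)
  smooth_P : ContDiffOn ℝ ∞ P N
  smooth_Q : ContDiffOn ℝ ∞ Q N
  injOn : Set.InjOn (fun y => (P y, Q y)) N
  f : (Fin n → ℝ) × (Fin n → ℝ) → ℝ
  smooth_f : ∀ y ∈ N, ContDiffAt ℝ ∞ f (y.2, Q y)
  generates : ∀ y ∈ N, ∀ v : Phase n,
    y.1 ⬝ᵥ v.2 = P y ⬝ᵥ fderiv ℝ Q y v + fderiv ℝ (fun y' : Phase n => f (y'.2, Q y')) y v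

/-- Lagrange multipliers: one-forms `e^α = e^α(t) dt` on `[a, b]` with continuous coefficients;
a Banach space for the supremum norm. -/
abbrev Multiplier (k : ℕ) (a b : ℝ) : Type := C(Set.Icc a b, Fin k → ℝ)

/-- The coefficients `e^α(t)`, extended to all `t` by the endpoint values. -/
def coeff {k : ℕ} {a b : ℝ} (hab : a < b) (e : Multiplier k a b) : ℝ → Fin k → ℝ :=
  Set.IccExtend hab.le e

/-- The data `((q_a, Q_b), e)`. -/
abbrev HJData (n k : ℕ) (a b : ℝ) : Type :=
  ((Fin n → ℝ) × (Fin n → ℝ)) × Multiplier k a b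

namespace FirstClassSystem

variable {n k : ℕ} (S : FirstClassSystem n k) {a b : ℝ} (hab : a < b)

/-- The evolution equations `dqⁱ = e^α ∂H_α/∂pᵢ`, `dpᵢ = -e^α ∂H_α/∂qⁱ` for a path
`x = (p, q)` in `N`, on the interval `[a, b]`. -/
def IsEvolution (e : Multiplier k a b) (x : ℝ → Phase n) : Prop :=
  ∀ t ∈ Set.Icc a b, x t ∈ S.N ∧
    HasDerivWithinAt x
      ((fun i => -∑ α, coeff hab e t α * dPos (S.H α) (x t) i),
        (fun i => ∑ α, coeff hab e t α * dMom (S.H α) (x t) i))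
      (Set.Icc a b) t

/-- The constraints `H_α(p, q) = 0`, at all times in `[a, b]`. -/
def SatisfiesConstraints (a b : ℝ) (x : ℝ → Phase n) : Prop :=
  ∀ t ∈ Set.Icc a b, ∀ α, S.H α (x t) = 0

/-- The classical action
`S^f[p, q, e] = -f(q(b), Q(p(b), q(b))) + ∫_a^b (pᵢ dqⁱ - e^α H_α(p, q))`. -/
def action (C : DarbouxChange S.N) (e : Multiplier k a b) (x : ℝ → Phase n) : ℝ :=
  -C.f ((x b).2, C.Q (x b)) +
    ∫ t in a..b, ((x t).1 ⬝ᵥ (derivWithin x (Set.Icc a b) t).2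
      - ∑ α, coeff hab e t α * S.H α (x t))

/-- `D` is an open set of data `((q_a, Q_b), e)`, and for all of them `x ((q_a, Q_b), e)` is the
unique solution `(p, q)` of the evolution equations for `e` with `q(a) = q_a` and
`Q(p(b), q(b)) = Q_b`; its initial momentum depends differentiably on the data.
The constraints are not imposed. -/
structure IsSolutionFamily (C : DarbouxChange S.N) (D : Set (HJData n k a b))
    (x : HJData n k a b → ℝ → Phase n) : Prop where
  isOpen_domain : IsOpen D
  evolution : ∀ z ∈ D, S.IsEvolution hab z.2 (x z)
  initial : ∀ z ∈ D, (x z a).2 = z.1.1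
  final : ∀ z ∈ D, C.Q (x z b) = z.1.2
  unique : ∀ z ∈ D, ∀ y : ℝ → Phase n, S.IsEvolution hab z.2 y → (y a).2 = z.1.1 →
    C.Q (y b) = z.1.2 → Set.EqOn y (x z) (Set.Icc a b)
  differentiable : DifferentiableOn ℝ (fun z => (x z a).1) D

/-- The Hamilton-Jacobi action `S^f_HJ(q_a, Q_b)[e]`: the action evaluated on the solution. -/
def hjAction (C : DarbouxChange S.N) (x : HJData n k a b → ℝ → Phase n)
    (z : HJData n k a b) : ℝ :=
  S.action hab C z.2 (x z)

/-- The evolution relation: the pairs of endpoint values `(x(a), x(b))` of the solutions of all the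
Euler-Lagrange equations (evolution and constraints) with data in `D`. For `D = univ` the condition
on the data is void. -/
def evolutionRelation (C : DarbouxChange S.N) (D : Set (HJData n k a b)) :
    Set (Phase n × Phase n) :=
  {w | ∃ (e : Multiplier k a b) (x : ℝ → Phase n), S.IsEvolution hab e x ∧
    S.SatisfiesConstraints a b x ∧ x a = w.1 ∧ x b = w.2 ∧ ((w.1.2, C.Q w.2), e) ∈ D}

/-- One gauge step between data with the same `(q_a, Q_b)`: the multipliers are joined by a path
`ε s`, `s ∈ [0, 1]`, inside `D` whose velocity at each `s` is an infinitesimal gauge transformation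
`δe^δ = dγ^δ + f_{αβ}^δ e^α γ^β`, with `γ = γ s` vanishing at both endpoints of `[a, b]` and the
structure functions evaluated along the solution for the data `(q_a, Q_b, ε s)`. -/
def GaugeStep {D : Set (HJData n k a b)} (x : HJData n k a b → ℝ → Phase n) (z z' : D) : Prop :=
  z.1.1 = z'.1.1 ∧
  ∃ (ε ε' : ℝ → Multiplier k a b) (γ γ' : ℝ → ℝ → Fin k → ℝ),
    ε 0 = z.1.2 ∧ ε 1 = z'.1.2 ∧
    ∀ s ∈ Set.Icc (0 : ℝ) 1,
      (z.1.1, ε s) ∈ D ∧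
      HasDerivWithinAt ε (ε' s) (Set.Icc 0 1) s ∧
      γ s a = 0 ∧ γ s b = 0 ∧
      ∀ t ∈ Set.Icc a b,
        HasDerivWithinAt (γ s) (γ' s t) (Set.Icc a b) t ∧
        ∀ δ, coeff hab (ε' s) t δ = γ' s t δ +
          ∑ α, ∑ β, S.f α β δ (x (z.1.1, ε s) t) * coeff hab (ε s) t α * γ s t β

/-- The data `(q_a, Q_b; [e])`: data in `D` up to the equivalence relation generated by gauge
steps. -/
def GaugeClass (D : Set (HJData n k a b)) (x : HJData n k a b → ℝ → Phase n) : Type :=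
  Quot (S.GaugeStep hab (D := D) x)

/-- The data `(q_a, Q_b; [e])` of `(q_a, Q_b; e)`. -/
def gaugeClass {D : Set (HJData n k a b)} (x : HJData n k a b → ℝ → Phase n) (z : D) :
    S.GaugeClass hab D x :=
  Quot.mk _ z

end FirstClassSystem

/-- A relation between points of `T*ℝⁿ`, in the coordinates `(p, q)` for the first point and
`(P, Q)` for the second one. -/
def inCoordinates {n : ℕ} {N : Set (Phase n)} (C : DarbouxChange N)
    (L : Set (Phase n × Phase n)) : Set (Phase n × Phase n) :=
  (fun w : Phase n × Phase n => (w.1, (C.P w.2, C.Q w.2))) '' L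

/-- `ψ(q, Q; T)`, a `C¹` function on an open set `V`, with parameters `T` in a manifold `B`, is a
generalized generating function for the relation `L`: the points `((p, q), (P, Q))` of `L` are those
for which there is a `T` with `((q, Q), T) ∈ V` and
`P = ∂ψ/∂Q`, `p = -∂ψ/∂q`, `∂ψ/∂T = 0`. -/
def IsGeneralizedGeneratingFunction {n : ℕ} {E : Type*} [NormedAddCommGroup E] [NormedSpace ℝ E]
    {B : Type*} [TopologicalSpace B] [ChartedSpace E B]
    (V : Set (((Fin n → ℝ) × (Fin n → ℝ)) × B))
    (ψ : ((Fin n → ℝ) × (Fin n → ℝ)) × B → ℝ) (L : Set (Phase n × Phase n)) : Prop :=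
  IsOpen V ∧
  ContMDiffOn (𝓘(ℝ, (Fin n → ℝ) × (Fin n → ℝ)).prod 𝓘(ℝ, E)) 𝓘(ℝ) 1 ψ V ∧
  L = {w | ∃ T : B, ((w.1.2, w.2.2), T) ∈ V ∧
    (∀ i, w.2.1 i = fderiv ℝ (fun Q => ψ ((w.1.2, Q), T)) w.2.2 (Pi.single i 1)) ∧
    (∀ i, w.1.1 i = -fderiv ℝ (fun q => ψ ((q, w.2.2), T)) w.1.2 (Pi.single i 1)) ∧
    mfderiv 𝓘(ℝ, E) 𝓘(ℝ) (fun T' : B => ψ ((w.1.2, w.2.2), T')) T = 0}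

/-- `T^α = ∫_a^b e^α`. -/
def totalIntegral {k : ℕ} {a b : ℝ} (hab : a < b) (e : Multiplier k a b) : Fin k → ℝ :=
  ∫ t in a..b, coeff hab e t

/-- `g = P exp ∫_a^b e`: there is a path `h` in `G` with `h(a) = 1`, `h(b) = g` and
`e = h⁻¹ dh`, i.e. `dh` is the left translate to `h(t)` of `e(t) = e^α(t) u_α` in the Lie
algebra. -/
def IsPathOrderedExp {k : ℕ} {a b : ℝ} (hab : a < b) {E : Type*} [NormedAddCommGroup E]
    [NormedSpace ℝ E] {G : Type*} [TopologicalSpace G] [ChartedSpace E G] [Group G]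
    (u : Module.Basis (Fin k) ℝ (GroupLieAlgebra 𝓘(ℝ, E) G)) (e : Multiplier k a b) (g : G) :
    Prop :=
  ∃ h : ℝ → G, h a = 1 ∧ h b = g ∧ ∀ t ∈ Set.Icc a b,
    HasMFDerivWithinAt 𝓘(ℝ) 𝓘(ℝ, E) h (Set.Icc a b) t
      ((1 : ℝ →L[ℝ] ℝ).smulRight
        (mulInvariantVectorField (I := 𝓘(ℝ, E)) (∑ α, coeff hab e t α • u α) (h t)))

end

noncomputable section

open Set Filter Topology MeasureTheory
open scoped NNReal

/-! Everything rests on the first variation of the action at a solution of the evolution equations: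
`P δQ` at the final end, minus `p δq` at the initial end, minus `∫ δe^α H_α`. Only the initial
momentum is assumed to depend differentiably on the data. Gronwall's inequality turns this into a
Lipschitz estimate for the whole trajectory (`eventually_norm_sub_le`), and no more is needed: by
the Euler-Lagrange equations the remainder of the action in the interior is quadratic in the
displacement (`IsTube.abs_action_sub_le`), and by `p dq = P dQ + df` the remainder at the final end
is of little-o type (`DarbouxChange.hasFDerivAt_boundary`). The result is `hasFDerivAt_hjAction`.
The pairing `∫ δe^α H_α` is nondegenerate on continuous functions, so the critical multipliers are
those whose solution satisfies the constraints.

Gauge invariance holds because, for a gauge variation with parameter `λ`, the integrand `δe^γ H_γ`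
is the time derivative of `λ^γ H_γ`, and `λ` vanishes at the ends
(`IsEvolution.multiplierPairing_eq_sub`).

A smaller parameter space `B` is handled by `exists_reducedAction`. Two things are required: the
action takes the same value on multipliers with the same parameter, and through every multiplier
there is a local `C¹` section of the parameter along which criticality still forces the constraints.
In the strictly involutive case the constraints are conserved; segments of multipliers with fixed
integral prove invariance, and adding constant multipliers gives sections.

In the Lie algebra case a multiplier is the logarithmic derivative of a path in `G`, its
development. Two multipliers with the same path ordered exponential have developments that differ by
a loop. A loop inside a chart is contracted by scaling; by the zero curvature equation
(`variation_eq`) the resulting variations of the multiplier are gauge transformations with parameter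
vanishing at the ends, so the action is constant (`hjAction_eq_of_small_loop`). A general loop is
contracted through continuous loops, which have no logarithmic derivative. Hence one works with the
closure, in the group of continuous paths, of the subgroup of loops that preserve the value of the
action: it contains all small loops, so by simple connectedness all loops (`mem_of_small_loops`),
and the last approximation error is again a small loop (`eq_of_forall_small_loop`). Sections come
from multiplying a development by a short ramp in the chart; criticality along them gives the
constraints at the final time, and these propagate backwards by a linear differential equation. -/

/-! ### The Hamiltonian vector field -/

/-- The vector field `(-∂F/∂q, ∂F/∂p)` of a differential `L = dF`. -/
def symplecticGradient {n : ℕ} (L : Phase n →L[ℝ] ℝ) : Phase n :=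
  (fun i => -L (0, Pi.single i 1), fun i => L (Pi.single i 1, 0))

theorem symplecticGradient_sub {n : ℕ} (L L' : Phase n →L[ℝ] ℝ) :
    symplecticGradient (L - L') = symplecticGradient L - symplecticGradient L' := by
  ext i
  · simp [symplecticGradient]; ring
  · simp [symplecticGradient]

theorem norm_symplecticGradient_le {n : ℕ} (L : Phase n →L[ℝ] ℝ) :
    ‖symplecticGradient L‖ ≤ ‖L‖ := by
  refine norm_prod_le_iff.2 ⟨(pi_norm_le_iff_of_nonneg (norm_nonneg _)).2 fun i => ?_,
    (pi_norm_le_iff_of_nonneg (norm_nonneg _)).2 fun i => ?_⟩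
  · have := L.le_opNorm (0, Pi.single i 1)
    simpa [symplecticGradient, Prod.norm_def, Pi.norm_single] using this
  · have := L.le_opNorm (Pi.single i 1, 0)
    simpa [symplecticGradient, Prod.norm_def, Pi.norm_single] using this

theorem continuous_symplecticGradient {n : ℕ} :
    Continuous (symplecticGradient : (Phase n →L[ℝ] ℝ) → Phase n) := by
  unfold symplecticGradient
  fun_prop

/-- The differential is the contraction of the canonical symplectic form with the Hamiltonian vector
field. In the first variation this replaces differentials of the constraints by velocities. -/
theorem apply_eq_dotProduct_symplecticGradient {n : ℕ} (L : Phase n →L[ℝ] ℝ) (v : Phase n) :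
    L v = v.1 ⬝ᵥ (symplecticGradient L).2 - (symplecticGradient L).1 ⬝ᵥ v.2 := by
  have h1 : v.1 = ∑ i, v.1 i • (Pi.single i 1 : Fin n → ℝ) := by
    ext j; simp [Finset.sum_apply, Pi.single_apply]
  have h2 : v.2 = ∑ i, v.2 i • (Pi.single i 1 : Fin n → ℝ) := by
    ext j; simp [Finset.sum_apply, Pi.single_apply]
  have h3 : L (v.1, 0) = ∑ i, v.1 i * L (Pi.single i 1, 0) := by
    have := congrArg (L.comp (ContinuousLinearMap.inl ℝ (Fin n → ℝ) (Fin n → ℝ))) h1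
    simpa [map_sum] using this
  have h4 : L (0, v.2) = ∑ i, v.2 i * L (0, Pi.single i 1) := by
    have := congrArg (L.comp (ContinuousLinearMap.inr ℝ (Fin n → ℝ) (Fin n → ℝ))) h2
    simpa [map_sum] using this
  have h5 : L v = L (v.1, 0) + L (0, v.2) := by rw [← map_add]; simp
  rw [h5, h3, h4]
  simp [symplecticGradient, dotProduct, mul_comm]

theorem coeff_of_mem {k : ℕ} {a b : ℝ} (hab : a < b) (e : Multiplier k a b) {t : ℝ}
    (ht : t ∈ Icc a b) : coeff hab e t = e ⟨t, ht⟩ := IccExtend_of_mem _ _ ht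

theorem continuous_coeff {k : ℕ} {a b : ℝ} (hab : a < b) (e : Multiplier k a b) :
    Continuous (coeff hab e) := e.continuous.Icc_extend'

theorem norm_coeff_le {k : ℕ} {a b : ℝ} (hab : a < b) (e : Multiplier k a b) (t : ℝ) :
    ‖coeff hab e t‖ ≤ ‖e‖ := e.norm_coe_le_norm _

theorem abs_coeff_le {k : ℕ} {a b : ℝ} (hab : a < b) (e : Multiplier k a b) (t : ℝ) (α : Fin k) :
    |coeff hab e t α| ≤ ‖e‖ := (norm_le_pi_norm (coeff hab e t) α).trans (norm_coeff_le hab e t)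

theorem coeff_add {k : ℕ} {a b : ℝ} (hab : a < b) (e e' : Multiplier k a b) (t : ℝ) :
    coeff hab (e + e') t = coeff hab e t + coeff hab e' t := rfl

theorem coeff_sub {k : ℕ} {a b : ℝ} (hab : a < b) (e e' : Multiplier k a b) (t : ℝ) :
    coeff hab (e - e') t = coeff hab e t - coeff hab e' t := rfl

theorem coeff_smul {k : ℕ} {a b : ℝ} (hab : a < b) (c : ℝ) (e : Multiplier k a b) (t : ℝ) :
    coeff hab (c • e) t = c • coeff hab e t := rfl

theorem abs_dotProduct_le {n : ℕ} (v w : Fin n → ℝ) : |v ⬝ᵥ w| ≤ n * (‖v‖ * ‖w‖) := by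
  refine (Finset.abs_sum_le_sum_abs _ _).trans ?_
  refine (Finset.sum_le_card_nsmul _ _ (‖v‖ * ‖w‖) fun i _ => ?_).trans (by simp)
  rw [abs_mul]
  exact mul_le_mul (norm_le_pi_norm v i) (norm_le_pi_norm w i) (abs_nonneg _) (norm_nonneg _)

theorem norm_sum_le_card_mul {k : ℕ} {W : Type*} [SeminormedAddCommGroup W] (g : Fin k → W) (c : ℝ)
    (h : ∀ i, ‖g i‖ ≤ c) : ‖∑ i, g i‖ ≤ k * c := by
  refine (norm_sum_le _ _).trans ((Finset.sum_le_card_nsmul _ _ c fun i _ => h i).trans (by simp))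

theorem HasDerivWithinAt.dotProduct {n : ℕ} {s : Set ℝ} {t : ℝ} {v w : ℝ → Fin n → ℝ}
    {v' w' : Fin n → ℝ} (hv : HasDerivWithinAt v v' s t) (hw : HasDerivWithinAt w w' s t) :
    HasDerivWithinAt (fun τ => v τ ⬝ᵥ w τ) (v' ⬝ᵥ w t + v t ⬝ᵥ w') s t := by
  rw [hasDerivWithinAt_pi] at hv hw
  have := HasDerivWithinAt.fun_sum (u := Finset.univ) fun i _ => (hv i).fun_mul (hw i)
  rw [Finset.sum_add_distrib] at this
  exact this

theorem integral_eq_sub_of_hasDerivWithinAt_Icc {a b : ℝ} (hab : a ≤ b) {g g' : ℝ → ℝ}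
    (hg : ∀ t ∈ Icc a b, HasDerivWithinAt g (g' t) (Icc a b) t) (hg' : ContinuousOn g' (Icc a b)) :
    ∫ t in a..b, g' t = g b - g a := by
  refine intervalIntegral.integral_eq_sub_of_hasDeriv_right_of_le hab
    (fun t ht => (hg t ht).continuousWithinAt) (fun t ht => ?_)
    (hg'.intervalIntegrable_of_Icc hab)
  exact ((hg t (Ioo_subset_Icc_self ht)).hasDerivAt (Icc_mem_nhds ht.1 ht.2)).hasDerivWithinAt

namespace FirstClassSystem

variable {n k : ℕ} (S : FirstClassSystem n k) {a b : ℝ} (hab : a < b)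

/-- The right-hand side of the evolution equations at time `t` along the path `x`. -/
def velocity (e : Multiplier k a b) (x : ℝ → Phase n) (t : ℝ) : Phase n :=
  ∑ α, coeff hab e t α • symplecticGradient (fderiv ℝ (S.H α) (x t))

theorem velocity_eq (e : Multiplier k a b) (x : ℝ → Phase n) (t : ℝ) :
    S.velocity hab e x t = ((fun i => -∑ α, coeff hab e t α * dPos (S.H α) (x t) i),
        (fun i => ∑ α, coeff hab e t α * dMom (S.H α) (x t) i)) := by
  ext i <;> simp [velocity, symplecticGradient, dPos, dMom, Prod.fst_sum, Prod.snd_sum]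

theorem differentiableAt_H (α : Fin k) {y : Phase n} (hy : y ∈ S.N) :
    DifferentiableAt ℝ (S.H α) y :=
  ((S.smooth_H α).contDiffAt (S.isOpen_N.mem_nhds hy)).differentiableAt (by simp)

theorem continuousOn_fderiv_H (α : Fin k) : ContinuousOn (fderiv ℝ (S.H α)) S.N :=
  (S.smooth_H α).continuousOn_fderiv_of_isOpen S.isOpen_N (by simp)

variable {S hab}

theorem IsEvolution.hasDerivWithinAt {e : Multiplier k a b} {x : ℝ → Phase n}
    (hx : S.IsEvolution hab e x) {t : ℝ} (ht : t ∈ Icc a b) :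
    HasDerivWithinAt x (S.velocity hab e x t) (Icc a b) t := by
  rw [velocity_eq]; exact (hx t ht).2

theorem IsEvolution.mem {e : Multiplier k a b} {x : ℝ → Phase n}
    (hx : S.IsEvolution hab e x) {t : ℝ} (ht : t ∈ Icc a b) : x t ∈ S.N := (hx t ht).1

theorem IsEvolution.continuousOn {e : Multiplier k a b} {x : ℝ → Phase n}
    (hx : S.IsEvolution hab e x) : ContinuousOn x (Icc a b) :=
  fun _ ht => (hx.hasDerivWithinAt ht).continuousWithinAt

theorem IsEvolution.continuousOn_H {e : Multiplier k a b} {x : ℝ → Phase n}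
    (hx : S.IsEvolution hab e x) (α : Fin k) : ContinuousOn (fun t => S.H α (x t)) (Icc a b) :=
  (S.smooth_H α).continuousOn.comp hx.continuousOn fun _ ht => hx.mem ht

theorem continuousOn_coeff_apply (e : Multiplier k a b) (α : Fin k) (s : Set ℝ) :
    ContinuousOn (fun t => coeff hab e t α) s :=
  ((continuous_apply α).comp (continuous_coeff hab e)).continuousOn

theorem IsEvolution.continuousOn_velocity {e : Multiplier k a b} {x : ℝ → Phase n}
    (hx : S.IsEvolution hab e x) : ContinuousOn (S.velocity hab e x) (Icc a b) :=
  continuousOn_finsetSum _ fun α _ => (continuousOn_coeff_apply e α _).smul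
    (continuous_symplecticGradient.comp_continuousOn
      ((S.continuousOn_fderiv_H α).comp hx.continuousOn fun _ ht => hx.mem ht))

/-- The derivative of the constraints along a solution of the evolution equations. -/
theorem IsEvolution.hasDerivWithinAt_H {e : Multiplier k a b} {x : ℝ → Phase n}
    (hx : S.IsEvolution hab e x) (δ : Fin k) {t : ℝ} (ht : t ∈ Icc a b) :
    HasDerivWithinAt (fun τ => S.H δ (x τ))
      (∑ α, coeff hab e t α * poissonBracket (S.H α) (S.H δ) (x t)) (Icc a b) t := by
  have h := (S.differentiableAt_H δ (hx.mem ht)).hasFDerivAt.comp_hasDerivWithinAt t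
    (hx.hasDerivWithinAt ht)
  refine h.congr_deriv ?_
  rw [velocity, map_sum]
  refine Finset.sum_congr rfl fun α _ => ?_
  rw [map_smul, smul_eq_mul, apply_eq_dotProduct_symplecticGradient]
  congr 1
  simp only [dotProduct, symplecticGradient, poissonBracket, dMom, dPos, ← Finset.sum_sub_distrib]
  refine Finset.sum_congr rfl fun i _ => ?_
  ring

/-! ### Tubes around solutions -/

variable (S) in
/-- A tube of radius `r` around the path `x`, with bounds `M` for the constraints, their
differentials, and the Lipschitz constants of their differentials. -/
structure IsTube (a b : ℝ) (x : ℝ → Phase n) (r M : ℝ) : Prop where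
  pos : 0 < r
  nonneg : 0 ≤ M
  subset : ∀ t ∈ Icc a b, Metric.closedBall (x t) r ⊆ S.N
  fderiv_le : ∀ t ∈ Icc a b, ∀ u ∈ Metric.closedBall (x t) r, ∀ α, ‖fderiv ℝ (S.H α) u‖ ≤ M
  fderiv_sub_le : ∀ t ∈ Icc a b, ∀ u ∈ Metric.closedBall (x t) r,
    ∀ v ∈ Metric.closedBall (x t) r, ∀ α,
      ‖fderiv ℝ (S.H α) u - fderiv ℝ (S.H α) v‖ ≤ M * ‖u - v‖

/-- The trajectory is compact, so a closed thickening of it is a compact subset of `N`, on which the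
first two derivatives of the constraints are bounded. The Lipschitz bound is obtained in single
balls, because the thickening need not be convex. -/
theorem exists_isTube {x : ℝ → Phase n} (hx : ContinuousOn x (Icc a b))
    (hN : ∀ t ∈ Icc a b, x t ∈ S.N) : ∃ r M, S.IsTube a b x r M := by
  have hK : IsCompact (x '' Icc a b) := isCompact_Icc.image_of_continuousOn hx
  obtain ⟨r, hr, hsub⟩ := hK.exists_cthickening_subset_open S.isOpen_N
    (by rintro _ ⟨t, ht, rfl⟩; exact hN t ht)
  have hKr : IsCompact (Metric.cthickening r (x '' Icc a b)) := hK.cthickening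
  have hball : ∀ t ∈ Icc a b, Metric.closedBall (x t) r ⊆ Metric.cthickening r (x '' Icc a b) :=
    fun t ht => Metric.closedBall_subset_cthickening (mem_image_of_mem x ht) r
  have hd2 (α : Fin k) : ContDiffOn ℝ ∞ (fderiv ℝ (S.H α)) S.N :=
    (S.smooth_H α).fderiv_of_isOpen S.isOpen_N (by simp)
  have hd3 (α : Fin k) : ContinuousOn (fderiv ℝ (fderiv ℝ (S.H α))) S.N :=
    (hd2 α).continuousOn_fderiv_of_isOpen S.isOpen_N (by simp)
  obtain ⟨M₁, hM₁⟩ := hKr.exists_bound_of_continuousOn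
    (f := fun y (α : Fin k) => fderiv ℝ (S.H α) y)
    (continuousOn_pi.2 fun α => (S.continuousOn_fderiv_H α).mono hsub)
  obtain ⟨M₂, hM₂⟩ := hKr.exists_bound_of_continuousOn
    (f := fun y (α : Fin k) => fderiv ℝ (fderiv ℝ (S.H α)) y)
    (continuousOn_pi.2 fun α => (hd3 α).mono hsub)
  refine ⟨r, max (max M₁ M₂) 0, hr, le_max_right _ _, fun t ht => (hball t ht).trans hsub,
    fun t ht u hu α => ?_, fun t ht u hu v hv α => ?_⟩
  · exact ((norm_le_pi_norm _ α).trans (hM₁ u (hball t ht hu))).trans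
      ((le_max_left _ _).trans (le_max_left _ _))
  · refine (convex_closedBall (x t) r).norm_image_sub_le_of_norm_fderiv_le (𝕜 := ℝ)
      (fun w hw => ?_) (fun w hw => ?_) hv hu
    · exact ((hd2 α).contDiffAt (S.isOpen_N.mem_nhds (hsub (hball t ht hw)))).differentiableAt
        (by simp)
    · exact ((norm_le_pi_norm _ α).trans (hM₂ w (hball t ht hw))).trans
        ((le_max_right _ _).trans (le_max_left _ _))

variable {x y : ℝ → Phase n} {r M : ℝ} {e e' : Multiplier k a b}

/-- The difference is split so that the Lipschitz constant involves only the norm of the reference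
multiplier `e`, and the bound is uniform in `e'`. -/
theorem IsTube.norm_velocity_sub_le (hT : S.IsTube a b x r M) {t : ℝ} (ht : t ∈ Icc a b)
    (hy : ‖y t - x t‖ ≤ r) :
    ‖S.velocity hab e' y t - S.velocity hab e x t‖ ≤
      k * (‖e‖ * M) * ‖y t - x t‖ + k * (M * ‖e' - e‖) := by
  have hyt : y t ∈ Metric.closedBall (x t) r := mem_closedBall_iff_norm.2 hy
  have hxt : x t ∈ Metric.closedBall (x t) r := Metric.mem_closedBall_self hT.pos.le
  rw [velocity, velocity, ← Finset.sum_sub_distrib]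
  refine (norm_sum_le_card_mul _ (‖e‖ * (M * ‖y t - x t‖) + ‖e' - e‖ * M) fun α => ?_).trans
    (le_of_eq (by ring))
  have : coeff hab e' t α • symplecticGradient (fderiv ℝ (S.H α) (y t)) -
      coeff hab e t α • symplecticGradient (fderiv ℝ (S.H α) (x t)) =
      coeff hab e t α • symplecticGradient (fderiv ℝ (S.H α) (y t) - fderiv ℝ (S.H α) (x t)) +
      coeff hab (e' - e) t α • symplecticGradient (fderiv ℝ (S.H α) (y t)) := by
    rw [symplecticGradient_sub, coeff_sub, Pi.sub_apply]
    module
  rw [this]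
  refine (norm_add_le _ _).trans (add_le_add ?_ ?_) <;> rw [norm_smul, Real.norm_eq_abs]
  · exact mul_le_mul (abs_coeff_le _ _ _ _) ((norm_symplecticGradient_le _).trans
      (hT.fderiv_sub_le t ht _ hyt _ hxt α)) (norm_nonneg _) (norm_nonneg _)
  · exact mul_le_mul (abs_coeff_le _ _ _ _) ((norm_symplecticGradient_le _).trans
      (hT.fderiv_le t ht _ hyt α)) (norm_nonneg _) (norm_nonneg _)

theorem gronwallBound_le_exp {δ K ε s : ℝ} (hK : 1 ≤ K) (hε : 0 ≤ ε) (hs : 0 ≤ s) :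
    gronwallBound δ K ε s ≤ (δ + ε) * Real.exp (K * s) := by
  rw [gronwallBound_of_K_ne_0 (by linarith)]
  have h1 : 1 ≤ Real.exp (K * s) := Real.one_le_exp (by positivity)
  have h2 : ε / K ≤ ε := div_le_self hε hK
  nlinarith

/-- Solutions of the evolution equations with nearby data stay near. -/
theorem IsTube.norm_sub_le (hT : S.IsTube a b x r M) (hx : S.IsEvolution hab e x)
    (hy : S.IsEvolution hab e' y)
    (hr : (‖y a - x a‖ + k * (M * ‖e' - e‖)) * Real.exp ((k * (‖e‖ * M) + 1) * (b - a)) < r) :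
    ∀ t ∈ Icc a b, ‖y t - x t‖ ≤
      (‖y a - x a‖ + k * (M * ‖e' - e‖)) * Real.exp ((k * (‖e‖ * M) + 1) * (b - a)) := by
  -- The summand 1 keeps the Gronwall constant away from zero, where the explicit formula for the
  -- bound changes.
  set K := (k * (‖e‖ * M) + 1 : ℝ) with hK
  have hM := hT.nonneg
  have hK1 : 1 ≤ K := by rw [hK]; have : 0 ≤ k * (‖e‖ * M) := by positivity
                         linarith
  set δ := ‖y a - x a‖
  set ε := k * (M * ‖e' - e‖)
  have hε : 0 ≤ ε := by positivity
  have hδ : 0 ≤ δ := norm_nonneg _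
  have hc : ContinuousOn (fun t => y t - x t) (Icc a b) := hy.continuousOn.sub hx.continuousOn
  have key : ∀ c ∈ Icc a b, (∀ t ∈ Ico a c, ‖y t - x t‖ ≤ r) →
      ∀ t ∈ Icc a c, ‖y t - x t‖ ≤ (δ + ε) * Real.exp (K * (b - a)) := by
    intro c hc' hcr t ht
    have hsub : Ico a c ⊆ Icc a b := fun s hs => ⟨hs.1, hs.2.le.trans hc'.2⟩
    refine (norm_le_gronwallBound_of_norm_deriv_right_le (δ := δ) (K := K) (ε := ε)
      (f := fun t => y t - x t)
      (f' := fun t => S.velocity hab e' y t - S.velocity hab e x t)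
      (hc.mono (Icc_subset_Icc_right hc'.2)) (fun s hs => ?_) le_rfl (fun s hs => ?_) t ht).trans ?_
    · refine ((hy.hasDerivWithinAt (hsub hs)).fun_sub
        (hx.hasDerivWithinAt (hsub hs))).mono_of_mem_nhdsWithin ?_
      exact Icc_mem_nhdsGE_of_mem ⟨hs.1, hs.2.trans_le hc'.2⟩
    · refine (hT.norm_velocity_sub_le (hsub hs) (hcr s hs)).trans ?_
      have : 0 ≤ ‖y s - x s‖ := norm_nonneg _
      nlinarith
    · refine (gronwallBound_le_exp hK1 hε (by linarith [ht.1])).trans ?_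
      have : K * (t - a) ≤ K * (b - a) := by
        apply mul_le_mul_of_nonneg_left _ (by linarith); linarith [ht.2, hc'.2]
      gcongr
  -- Continuation argument: at the first time where the distance reaches `r`, the bound valid up to
  -- that time already gives a distance below `r`.
  have hlt : ∀ t ∈ Icc a b, ‖y t - x t‖ < r := by
    by_contra! hcon
    set B := {t ∈ Icc a b | r ≤ ‖y t - x t‖}
    have hBne : B.Nonempty := hcon
    have hBcl : IsClosed B :=
      isClosed_Icc.isClosed_le continuousOn_const (continuous_norm.comp_continuousOn hc)
    have hBb : BddBelow B := ⟨a, fun t ht => ht.1.1⟩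
    have hm := hBcl.csInf_mem hBne hBb
    have := key (sInf B) hm.1 (fun t ht => by
      by_contra! hlt
      exact absurd (csInf_le hBb (show t ∈ B from ⟨⟨ht.1, ht.2.le.trans hm.1.2⟩, hlt.le⟩))
        (not_le.2 ht.2)) (sInf B) ⟨hm.1.1, le_rfl⟩
    linarith [hm.2]
  exact key b ⟨hab.le, le_rfl⟩ fun t ht => (hlt t ⟨ht.1, ht.2.le⟩).le

/-- Mean value inequality on the segment between the two points. The differential is taken at the
displaced point `y t`, since its combination with `e'` is expressed exactly by the velocity of `y`.
-/
theorem IsTube.abs_taylor_le (hT : S.IsTube a b x r M) {t : ℝ} (ht : t ∈ Icc a b)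
    (hy : ‖y t - x t‖ ≤ r) (α : Fin k) :
    |fderiv ℝ (S.H α) (y t) (y t - x t) - (S.H α (y t) - S.H α (x t))| ≤ M * ‖y t - x t‖ ^ 2 := by
  have hxt : x t ∈ Metric.closedBall (x t) r := Metric.mem_closedBall_self hT.pos.le
  have hyt : y t ∈ Metric.closedBall (x t) ‖y t - x t‖ := mem_closedBall_iff_norm.2 le_rfl
  have hle : Metric.closedBall (x t) ‖y t - x t‖ ⊆ Metric.closedBall (x t) r :=
    Metric.closedBall_subset_closedBall hy
  have := (convex_segment (𝕜 := ℝ) (x t) (y t)).norm_image_sub_le_of_norm_hasFDerivWithin_le'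
    (f := S.H α) (f' := fderiv ℝ (S.H α)) (φ := fderiv ℝ (S.H α) (y t)) (C := M * ‖y t - x t‖)
    (fun w hw => ?_) (fun w hw => ?_) (left_mem_segment ℝ _ _) (right_mem_segment ℝ _ _)
  · rw [abs_sub_comm]
    refine this.trans (le_of_eq (by ring))
  · have hw' := (convex_closedBall (x t) r).segment_subset hxt (hle hyt) hw
    exact (S.differentiableAt_H α (hT.subset t ht hw')).hasFDerivAt.hasFDerivWithinAt
  · have hw' := (convex_closedBall (x t) r).segment_subset hxt (hle hyt) hw
    refine (hT.fderiv_sub_le t ht w hw' _ (hle hyt) α).trans ?_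
    have hwy : ‖w - y t‖ ≤ ‖y t - x t‖ := by
      rw [norm_sub_rev (y t)]
      rw [segment_symm] at hw
      have := (convex_closedBall (y t) ‖x t - y t‖).segment_subset
        (Metric.mem_closedBall_self (norm_nonneg _)) (mem_closedBall_iff_norm.2 le_rfl) hw
      exact mem_closedBall_iff_norm.1 this
    exact mul_le_mul_of_nonneg_left hwy hT.nonneg

end FirstClassSystem

/-! ### The `L²` pairing of multipliers -/

/-- The dot product as a continuous bilinear map. -/
def dotProductCLM (n : ℕ) : (Fin n → ℝ) →L[ℝ] (Fin n → ℝ) →L[ℝ] ℝ :=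
  ∑ i, (ContinuousLinearMap.proj (R := ℝ) i).smulRight (ContinuousLinearMap.proj (R := ℝ) i)

@[simp] theorem dotProductCLM_apply {n : ℕ} (v w : Fin n → ℝ) : dotProductCLM n v w = v ⬝ᵥ w := by
  simp [dotProductCLM, dotProduct]

theorem intervalIntegrable_coeff_dotProduct {k : ℕ} {a b : ℝ} (hab : a < b)
    (e g : Multiplier k a b) :
    IntervalIntegrable (fun t => coeff hab e t ⬝ᵥ coeff hab g t) volume a b :=
  (Continuous.dotProduct (continuous_coeff hab e) (continuous_coeff hab g)).intervalIntegrable _ _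

/-- The `L²` pairing of continuous multipliers. -/
def multiplierPairing {k : ℕ} {a b : ℝ} (hab : a < b) :
    Multiplier k a b →L[ℝ] Multiplier k a b →L[ℝ] ℝ :=
  LinearMap.mkContinuous₂
    (LinearMap.mk₂ ℝ (fun g e => ∫ t in a..b, coeff hab e t ⬝ᵥ coeff hab g t)
      (fun g g' e => by
        simp only [coeff_add, dotProduct_add]
        exact intervalIntegral.integral_add (intervalIntegrable_coeff_dotProduct hab e g)
          (intervalIntegrable_coeff_dotProduct hab e g'))
      (fun c g e => by simp [coeff_smul])
      (fun g e e' => by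
        simp only [coeff_add, add_dotProduct]
        exact intervalIntegral.integral_add (intervalIntegrable_coeff_dotProduct hab e g)
          (intervalIntegrable_coeff_dotProduct hab e' g))
      (fun c g e => by simp [coeff_smul]))
    (k * (b - a)) (fun g e => by
      refine (intervalIntegral.norm_integral_le_of_norm_le_const (C := k * (‖e‖ * ‖g‖))
        fun t _ => ?_).trans (le_of_eq ?_)
      · refine (abs_dotProduct_le _ _).trans ?_
        gcongr <;> exact norm_coeff_le _ _ _
      · rw [abs_of_pos (sub_pos.2 hab)]; ring)

theorem multiplierPairing_apply {k : ℕ} {a b : ℝ} (hab : a < b) (g e : Multiplier k a b) :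
    multiplierPairing hab g e = ∫ t in a..b, coeff hab e t ⬝ᵥ coeff hab g t := rfl

/-- Pairing `g` with itself gives a continuous nonnegative integrand with zero integral. -/
theorem multiplierPairing_eq_zero_iff {k : ℕ} {a b : ℝ} (hab : a < b) (g : Multiplier k a b) :
    multiplierPairing hab g = 0 ↔ g = 0 := by
  refine ⟨fun h => ?_, fun h => by simp [h]⟩
  have h0 : ∫ t in a..b, coeff hab g t ⬝ᵥ coeff hab g t = 0 := by
    rw [← multiplierPairing_apply, h]; rfl
  have hnn : ∀ t, 0 ≤ coeff hab g t ⬝ᵥ coeff hab g t := fun t =>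
    Finset.sum_nonneg fun i _ => mul_self_nonneg _
  have hc : Continuous fun t => coeff hab g t ⬝ᵥ coeff hab g t :=
    Continuous.dotProduct (continuous_coeff hab g) (continuous_coeff hab g)
  ext ⟨t, ht⟩ i
  by_contra hne
  have hpos : 0 < coeff hab g t ⬝ᵥ coeff hab g t := by
    refine lt_of_le_of_ne (hnn t) fun h' => hne ?_
    have := dotProduct_self_eq_zero.1 h'.symm
    rw [coeff_of_mem hab g ht] at this
    exact congrFun this i
  have := intervalIntegral.integral_pos hab hc.continuousOn (fun t _ => hnn t) ⟨t, ht, hpos⟩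
  linarith

/-! ### First variation of the action -/

namespace FirstClassSystem

variable {n k : ℕ} (S : FirstClassSystem n k) {a b : ℝ} {hab : a < b}

open Classical in
/-- The constraints along the path `x`, as a continuous function of time. -/
def constraintCurve (x : ℝ → Phase n) : Multiplier k a b :=
  -- The default value 0 is never met along a solution of the evolution equations.
  if h : Continuous fun t : Icc a b => fun α => S.H α (x t) then ⟨_, h⟩ else 0

variable {S}

theorem IsEvolution.constraintCurve_apply {e : Multiplier k a b} {x : ℝ → Phase n}
    (hx : S.IsEvolution hab e x) (t : Icc a b) (α : Fin k) :
    S.constraintCurve (a := a) (b := b) x t α = S.H α (x t) := by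
  have : Continuous fun t : Icc a b => fun α => S.H α (x t) :=
    continuous_pi fun α => (hx.continuousOn_H α).domRestrict
  rw [constraintCurve, dif_pos this]; rfl

theorem IsEvolution.coeff_constraintCurve {e : Multiplier k a b} {x : ℝ → Phase n}
    (hx : S.IsEvolution hab e x) {t : ℝ} (ht : t ∈ Icc a b) :
    coeff hab (S.constraintCurve x) t = fun α => S.H α (x t) := by
  rw [coeff_of_mem hab _ ht]; ext α; exact hx.constraintCurve_apply _ _

theorem IsEvolution.constraintCurve_eq_zero_iff {e : Multiplier k a b} {x : ℝ → Phase n}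
    (hx : S.IsEvolution hab e x) :
    S.constraintCurve (a := a) (b := b) x = 0 ↔ S.SatisfiesConstraints a b x := by
  refine ⟨fun h t ht α => ?_, fun h => ?_⟩
  · rw [← hx.constraintCurve_apply ⟨t, ht⟩ α, h]; rfl
  · ext t α; rw [hx.constraintCurve_apply]; exact h t t.2 α

theorem IsEvolution.multiplierPairing_constraintCurve {e : Multiplier k a b} {x : ℝ → Phase n}
    (hx : S.IsEvolution hab e x) (e' : Multiplier k a b) :
    multiplierPairing hab (S.constraintCurve x) e' =
      ∫ t in a..b, ∑ α, coeff hab e' t α * S.H α (x t) := by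
  rw [multiplierPairing_apply]
  refine intervalIntegral.integral_congr fun t ht => ?_
  rw [uIcc_of_le hab.le] at ht
  simp only [hx.coeff_constraintCurve ht]
  rfl

/-- The integrand of the action along a path. -/
theorem IsEvolution.action_eq (C : DarbouxChange S.N) {e : Multiplier k a b} {x : ℝ → Phase n}
    (hx : S.IsEvolution hab e x) :
    S.action hab C e x = -C.f ((x b).2, C.Q (x b)) +
      ∫ t in a..b, ((x t).1 ⬝ᵥ (S.velocity hab e x t).2 - ∑ α, coeff hab e t α * S.H α (x t)) := by
  rw [action]
  congr 1
  refine intervalIntegral.integral_congr fun t ht => ?_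
  rw [uIcc_of_le hab.le] at ht
  simp only [(hx.hasDerivWithinAt ht).derivWithin (uniqueDiffOn_Icc hab t ht)]

theorem IsEvolution.continuousOn_integrand {e : Multiplier k a b} {x : ℝ → Phase n}
    (hx : S.IsEvolution hab e x) (e' : Multiplier k a b) : ContinuousOn (fun t =>
      (x t).1 ⬝ᵥ (S.velocity hab e x t).2 - ∑ α, coeff hab e' t α * S.H α (x t)) (Icc a b) := by
  refine ContinuousOn.sub ?_ (continuousOn_finsetSum _ fun α _ =>
    (continuousOn_coeff_apply e' α _).mul (hx.continuousOn_H α))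
  exact continuousOn_finsetSum _ fun i _ =>
    (((continuous_apply i).comp continuous_fst).comp_continuousOn hx.continuousOn).mul
    (((continuous_apply i).comp continuous_snd).comp_continuousOn hx.continuousOn_velocity)

/-- The boundary part of the first variation of the action at the final end. -/
def _root_.DarbouxChange.boundary {N : Set (Phase n)} (C : DarbouxChange N) (y₀ y : Phase n) : ℝ :=
  y₀.1 ⬝ᵥ y.2 - C.f (y.2, C.Q y) - C.P y₀ ⬝ᵥ C.Q y

/-- This is `p dq = P dQ + df` with the momenta `p` and `P` frozen at `y`. It makes the final
boundary term negligible without differentiability of the final point in the data. -/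
theorem _root_.DarbouxChange.hasFDerivAt_boundary {N : Set (Phase n)} (C : DarbouxChange N)
    (hN : IsOpen N) {y : Phase n} (hy : y ∈ N) : HasFDerivAt (C.boundary y) (0 : Phase n →L[ℝ] ℝ) y := by
  have hQ : DifferentiableAt ℝ C.Q y :=
    (C.smooth_Q.contDiffAt (hN.mem_nhds hy)).differentiableAt (by simp)
  have hf : DifferentiableAt ℝ (fun y' : Phase n => C.f (y'.2, C.Q y')) y :=
    ((C.smooth_f y hy).differentiableAt (by simp)).comp (f := fun y' : Phase n => (y'.2, C.Q y')) y
      ((differentiableAt_snd (𝕜 := ℝ) (E := Fin n → ℝ) (F := Fin n → ℝ)).prodMk hQ)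
  have h1 : HasFDerivAt (fun y' : Phase n => y.1 ⬝ᵥ y'.2)
      ((dotProductCLM n y.1).comp (ContinuousLinearMap.snd ℝ (Fin n → ℝ) (Fin n → ℝ))) y := by
    simpa only [dotProductCLM_apply, Function.comp_def] using
      (dotProductCLM n y.1).hasFDerivAt.comp y (hasFDerivAt_snd (𝕜 := ℝ) (p := y))
  have h2 : HasFDerivAt (fun y' : Phase n => C.P y ⬝ᵥ C.Q y')
      ((dotProductCLM n (C.P y)).comp (fderiv ℝ C.Q y)) y := by
    simpa [Function.comp_def] using
      ((dotProductCLM n (C.P y)).hasFDerivAt (x := C.Q y)).comp y hQ.hasFDerivAt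
  refine ((h1.sub hf.hasFDerivAt).sub h2).congr_fderiv (ContinuousLinearMap.ext fun v => ?_)
  have := C.generates y hy v
  simp only [sub_apply, ContinuousLinearMap.comp_apply, dotProductCLM_apply,
    zero_apply, ContinuousLinearMap.coe_snd']
  linarith

variable {x y : ℝ → Phase n} {r M : ℝ} {e e' : Multiplier k a b}

/-- The first variation of the action around a solution of the evolution equations, up to terms of
second order. -/
theorem IsTube.abs_action_sub_le (hT : S.IsTube a b x r M) (C : DarbouxChange S.N)
    (hx : S.IsEvolution hab e x) (hy : S.IsEvolution hab e' y) {ρ : ℝ} (hρ : ρ ≤ r)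
    (hd : ∀ t ∈ Icc a b, ‖y t - x t‖ ≤ ρ) :
    |S.action hab C e' y - S.action hab C e x -
      (C.P (x b) ⬝ᵥ (C.Q (y b) - C.Q (x b)) - (x a).1 ⬝ᵥ ((y a).2 - (x a).2)
        - multiplierPairing hab (S.constraintCurve x) (e' - e)) -
      (C.boundary (x b) (y b) - C.boundary (x b) (x b))| ≤
    (k * (‖e'‖ * (M * ρ ^ 2)) + n * ((k * (‖e‖ * M) * ρ + k * (M * ‖e' - e‖)) * ρ)) * (b - a) := by
  -- The exact integrand of the remainder: Taylor remainders of the constraints, and the product of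
  -- the velocity difference with the displacement. Both are of second order.
  set R : ℝ → ℝ := fun t =>
    ∑ α, coeff hab e' t α * (fderiv ℝ (S.H α) (y t) (y t - x t) - (S.H α (y t) - S.H α (x t))) +
      (S.velocity hab e' y t - S.velocity hab e x t).1 ⬝ᵥ (y t - x t).2 with hR
  have hM := hT.nonneg
  have hρ0 : 0 ≤ ρ := (norm_nonneg _).trans (hd a ⟨le_rfl, hab.le⟩)
  have hRle : ∀ t ∈ Icc a b, |R t| ≤
      k * (‖e'‖ * (M * ρ ^ 2)) + n * ((k * (‖e‖ * M) * ρ + k * (M * ‖e' - e‖)) * ρ) := by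
    intro t ht
    have hdt := hd t ht
    refine (abs_add_le _ _).trans (add_le_add ?_ ?_)
    · refine norm_sum_le_card_mul (W := ℝ) _ _ fun α => ?_
      rw [norm_mul]
      refine mul_le_mul (abs_coeff_le _ _ _ _) ((hT.abs_taylor_le ht (hdt.trans hρ) α).trans ?_)
        (norm_nonneg _) (norm_nonneg _)
      gcongr
    · refine (abs_dotProduct_le _ _).trans ?_
      have h1 := (norm_fst_le _).trans (hT.norm_velocity_sub_le (hab := hab) (e := e) (e' := e') ht
        (hdt.trans hρ))
      have h2 := (norm_snd_le _).trans hdt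
      have h3 : (k * (‖e‖ * M)) * ‖y t - x t‖ ≤ (k * (‖e‖ * M)) * ρ := by gcongr
      gcongr
      linarith
  -- Integration by parts: this total derivative carries the terms `p δq` at both ends.
  have hgd : ∀ t ∈ Icc a b, HasDerivWithinAt (fun t => (x t).1 ⬝ᵥ ((y t).2 - (x t).2))
      ((S.velocity hab e x t).1 ⬝ᵥ ((y t).2 - (x t).2) +
        (x t).1 ⬝ᵥ ((S.velocity hab e' y t).2 - (S.velocity hab e x t).2)) (Icc a b) t := by
    intro t ht
    have hx' := hx.hasDerivWithinAt ht
    have hy' := hy.hasDerivWithinAt ht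
    have h1 := (hasFDerivAt_fst (𝕜 := ℝ) (p := x t)).comp_hasDerivWithinAt t hx'
    have h2 := (hasFDerivAt_snd (𝕜 := ℝ) (p := x t)).comp_hasDerivWithinAt t hx'
    have h3 := (hasFDerivAt_snd (𝕜 := ℝ) (p := y t)).comp_hasDerivWithinAt t hy'
    exact HasDerivWithinAt.dotProduct h1 (h3.fun_sub h2)
  have hgc : ContinuousOn (fun t => (S.velocity hab e x t).1 ⬝ᵥ ((y t).2 - (x t).2) +
        (x t).1 ⬝ᵥ ((S.velocity hab e' y t).2 - (S.velocity hab e x t).2)) (Icc a b) := by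
    have h1 := hx.continuousOn
    have h2 := hy.continuousOn
    have h3 := hx.continuousOn_velocity
    have h4 := hy.continuousOn_velocity
    simp only [dotProduct]
    fun_prop
  have hint := integral_eq_sub_of_hasDerivWithinAt_Icc hab.le hgd hgc
  have hcy := hy.continuousOn_integrand e'
  have hcx := hx.continuousOn_integrand e
  have hcH : ContinuousOn (fun t => ∑ α, coeff hab (e' - e) t α * S.H α (x t)) (Icc a b) :=
    continuousOn_finsetSum _ fun α _ =>
      (continuousOn_coeff_apply (e' - e) α _).mul (hx.continuousOn_H α)
  have hsum : ∫ t in a..b, R t =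
      (∫ t in a..b, ((y t).1 ⬝ᵥ (S.velocity hab e' y t).2 - ∑ α, coeff hab e' t α * S.H α (y t))) -
      (∫ t in a..b, ((x t).1 ⬝ᵥ (S.velocity hab e x t).2 - ∑ α, coeff hab e t α * S.H α (x t))) -
      (∫ t in a..b, ((S.velocity hab e x t).1 ⬝ᵥ ((y t).2 - (x t).2) +
        (x t).1 ⬝ᵥ ((S.velocity hab e' y t).2 - (S.velocity hab e x t).2))) +
      ∫ t in a..b, ∑ α, coeff hab (e' - e) t α * S.H α (x t) := by
    rw [← intervalIntegral.integral_sub, ← intervalIntegral.integral_sub,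
      ← intervalIntegral.integral_add]
    · refine intervalIntegral.integral_congr fun t ht => ?_
      -- Hamilton's equations for `y`, paired with the displacement.
      have h1 : ∑ α, coeff hab e' t α * fderiv ℝ (S.H α) (y t) (y t - x t) =
          (y t - x t).1 ⬝ᵥ (S.velocity hab e' y t).2 -
            (S.velocity hab e' y t).1 ⬝ᵥ (y t - x t).2 := by
        simp only [apply_eq_dotProduct_symplecticGradient, velocity, Prod.fst_sum, Prod.snd_sum,
          dotProduct_sum, sum_dotProduct, Prod.smul_fst, Prod.smul_snd, dotProduct_smul,
          smul_dotProduct, ← Finset.sum_sub_distrib, smul_eq_mul, mul_sub]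
      simp only [hR, mul_sub, Finset.sum_sub_distrib, h1]
      simp only [coeff_sub, Pi.sub_apply, sub_mul, Finset.sum_sub_distrib, Prod.fst_sub,
        Prod.snd_sub, sub_dotProduct, dotProduct_sub]
      ring
    all_goals apply ContinuousOn.intervalIntegrable_of_Icc hab.le
    exacts [(hcy.sub hcx).sub hgc, hcH, hcy.sub hcx, hgc, hcy, hcx]
  have hfin : S.action hab C e' y - S.action hab C e x -
      (C.P (x b) ⬝ᵥ (C.Q (y b) - C.Q (x b)) - (x a).1 ⬝ᵥ ((y a).2 - (x a).2)
        - multiplierPairing hab (S.constraintCurve x) (e' - e)) -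
      (C.boundary (x b) (y b) - C.boundary (x b) (x b)) = ∫ t in a..b, R t := by
    rw [hsum, hint, hx.action_eq, hy.action_eq, hx.multiplierPairing_constraintCurve]
    simp only [DarbouxChange.boundary, dotProduct_sub]
    ring
  rw [hfin]
  rw [← abs_of_pos (sub_pos.2 hab)]
  refine intervalIntegral.norm_integral_le_of_norm_le_const (E := ℝ) fun t ht => ?_
  rw [uIoc_of_le hab.le] at ht
  exact hRle t (Ioc_subset_Icc_self ht)

end FirstClassSystem

/-! ### Differential of the Hamilton-Jacobi action -/

namespace FirstClassSystem

variable {n k : ℕ} {S : FirstClassSystem n k} {a b : ℝ} {hab : a < b}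

/-- The differential of the Hamilton-Jacobi action. -/
def hjDifferential (hab : a < b) (C : DarbouxChange S.N) (x : HJData n k a b → ℝ → Phase n)
    (z : HJData n k a b) : HJData n k a b →L[ℝ] ℝ :=
  ((dotProductCLM n (C.P (x z b))).comp (ContinuousLinearMap.snd ℝ _ _) -
    (dotProductCLM n (x z a).1).comp (ContinuousLinearMap.fst ℝ _ _)).comp
      (ContinuousLinearMap.fst ℝ _ _) -
  (multiplierPairing hab (S.constraintCurve (x z))).comp (ContinuousLinearMap.snd ℝ _ _)

theorem hjDifferential_apply (C : DarbouxChange S.N) (x : HJData n k a b → ℝ → Phase n)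
    (z w : HJData n k a b) : hjDifferential hab C x z w =
      C.P (x z b) ⬝ᵥ w.1.2 - (x z a).1 ⬝ᵥ w.1.1 -
        multiplierPairing hab (S.constraintCurve (x z)) w.2 := by
  simp [hjDifferential]

variable {C : DarbouxChange S.N} {D : Set (HJData n k a b)} {x : HJData n k a b → ℝ → Phase n}

namespace IsSolutionFamily

variable (hx : S.IsSolutionFamily hab C D x)
include hx

/-- At time `a` the position is part of the data and the momentum is differentiable in them, so the
initial displacement is of first order; the Gronwall estimate in a tube around the solution for `z₀`
propagates this to all times. -/
theorem eventually_norm_sub_le {z₀ : HJData n k a b} (hz₀ : z₀ ∈ D) : ∃ c, 0 ≤ c ∧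
    ∀ᶠ z in 𝓝 z₀, z ∈ D ∧ ∀ t ∈ Icc a b, ‖x z t - x z₀ t‖ ≤ c * ‖z - z₀‖ := by
  have hev₀ := hx.evolution z₀ hz₀
  obtain ⟨r, M, hT⟩ := exists_isTube hev₀.continuousOn fun t ht => hev₀.mem ht
  have hM := hT.nonneg
  obtain ⟨c, hc⟩ := ((hx.differentiable z₀ hz₀).differentiableAt
    (hx.isOpen_domain.mem_nhds hz₀)).hasFDerivAt.isBigO_sub.bound
  set E := Real.exp ((k * (‖z₀.2‖ * M) + 1) * (b - a))
  -- In `max c 1`, the constant `c` bounds the change of the initial momentum and 1 that of the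
  -- initial position.
  set c' := (max c 1 + k * M) * E with hc'
  have hc0 : 0 ≤ c' := by positivity
  have hlim : Tendsto (fun z => c' * ‖z - z₀‖) (𝓝 z₀) (𝓝 0) := by
    have : Continuous fun z : HJData n k a b => c' * ‖z - z₀‖ := by fun_prop
    simpa using this.tendsto z₀
  refine ⟨c', hc0, ?_⟩
  filter_upwards [hc, hx.isOpen_domain.mem_nhds hz₀, hlim.eventually_lt_const hT.pos]
    with z hz hzD hzr
  refine ⟨hzD, ?_⟩
  have h1 : ‖x z a - x z₀ a‖ ≤ max c 1 * ‖z - z₀‖ := by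
    refine norm_prod_le_iff.2 ⟨?_, ?_⟩
    · exact hz.trans (by gcongr; exact le_max_left _ _)
    · rw [Prod.snd_sub, hx.initial z hzD, hx.initial z₀ hz₀]
      have h2 : ‖z.1.1 - z₀.1.1‖ ≤ 1 * ‖z - z₀‖ := by
        rw [one_mul]; exact (norm_fst_le (z - z₀).1).trans (norm_fst_le (z - z₀))
      exact h2.trans (by gcongr; exact le_max_right _ _)
  have h2 : ‖z.2 - z₀.2‖ ≤ ‖z - z₀‖ := norm_snd_le (z - z₀)
  have h3 : (‖x z a - x z₀ a‖ + k * (M * ‖z.2 - z₀.2‖)) * E ≤ c' * ‖z - z₀‖ := by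
    have : (max c 1 * ‖z - z₀‖ + k * (M * ‖z - z₀‖)) * E = c' * ‖z - z₀‖ := by rw [hc']; ring
    rw [← this]
    gcongr
  intro t ht
  exact (hT.norm_sub_le hev₀ (hx.evolution z hzD) (h3.trans_lt hzr) t ht).trans h3

theorem continuousAt_apply {z₀ : HJData n k a b} (hz₀ : z₀ ∈ D) {t : ℝ} (ht : t ∈ Icc a b) :
    ContinuousAt (fun z => x z t) z₀ := by
  obtain ⟨c, -, h⟩ := hx.eventually_norm_sub_le hz₀
  rw [ContinuousAt, tendsto_iff_norm_sub_tendsto_zero]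
  have hlim : Tendsto (fun z => c * ‖z - z₀‖) (𝓝 z₀) (𝓝 0) := by
    have : Continuous fun z : HJData n k a b => c * ‖z - z₀‖ := by fun_prop
    simpa using this.tendsto z₀
  exact squeeze_zero' (Eventually.of_forall fun _ => norm_nonneg _)
    (h.mono fun z hz => hz.2 t ht) hlim

theorem continuousAt_constraintCurve {z₀ : HJData n k a b} (hz₀ : z₀ ∈ D) :
    ContinuousAt (fun z => S.constraintCurve (a := a) (b := b) (x z)) z₀ := by
  have hev₀ := hx.evolution z₀ hz₀
  obtain ⟨r, M, hT⟩ := exists_isTube hev₀.continuousOn fun t ht => hev₀.mem ht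
  obtain ⟨c, hc, h⟩ := hx.eventually_norm_sub_le hz₀
  have hlim (d : ℝ) : Tendsto (fun z => d * ‖z - z₀‖) (𝓝 z₀) (𝓝 0) := by
    have : Continuous fun z : HJData n k a b => d * ‖z - z₀‖ := by fun_prop
    simpa using this.tendsto z₀
  rw [ContinuousAt, tendsto_iff_norm_sub_tendsto_zero]
  refine squeeze_zero' (Eventually.of_forall fun _ => norm_nonneg _) ?_ (hlim (M * c))
  filter_upwards [h, (hlim c).eventually_le_const hT.pos] with z hz hzr
  have hM := hT.nonneg
  refine (ContinuousMap.norm_le _ (by positivity)).2 fun t =>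
    (pi_norm_le_iff_of_nonneg (by positivity)).2 fun α => ?_
  rw [ContinuousMap.sub_apply, Pi.sub_apply, hev₀.constraintCurve_apply,
    (hx.evolution z hz.1).constraintCurve_apply]
  have hb := hz.2 t t.2
  have := (convex_closedBall (x z₀ t) r).norm_image_sub_le_of_norm_fderiv_le (𝕜 := ℝ)
    (f := S.H α) (C := M) (fun w hw => S.differentiableAt_H α (hT.subset t t.2 hw))
    (fun w hw => hT.fderiv_le t t.2 w hw α) (Metric.mem_closedBall_self hT.pos.le)
    (mem_closedBall_iff_norm.2 (hb.trans hzr))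
  refine this.trans ?_
  rw [mul_assoc]
  gcongr

/-- The differential of the Hamilton-Jacobi action is `P dQ - p dq - ∫ δe^α H_α`. -/
theorem hasFDerivAt_hjAction {z₀ : HJData n k a b} (hz₀ : z₀ ∈ D) :
    HasFDerivAt (S.hjAction hab C x) (hjDifferential hab C x z₀) z₀ := by
  have hev₀ := hx.evolution z₀ hz₀
  obtain ⟨r, M, hT⟩ := exists_isTube hev₀.continuousOn fun t ht => hev₀.mem ht
  have hM := hT.nonneg
  obtain ⟨c, hc, h⟩ := hx.eventually_norm_sub_le hz₀
  have hlim : Tendsto (fun z => c * ‖z - z₀‖) (𝓝 z₀) (𝓝 0) := by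
    have : Continuous fun z : HJData n k a b => c * ‖z - z₀‖ := by fun_prop
    simpa using this.tendsto z₀
  have hnorm : ∀ᶠ z in 𝓝 z₀, ‖z.2‖ < ‖z₀.2‖ + 1 :=
    (Continuous.tendsto (by fun_prop : Continuous fun z : HJData n k a b => ‖z.2‖) z₀).eventually_lt_const
      (lt_add_one _)
  -- Little-o in the displacement of the final point becomes little-o in `z - z₀` by the Lipschitz
  -- estimate.
  have hbdry : (fun z => C.boundary (x z₀ b) (x z b) - C.boundary (x z₀ b) (x z₀ b)) =o[𝓝 z₀]
      fun z => z - z₀ := by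
    have h1 := (C.hasFDerivAt_boundary S.isOpen_N (hev₀.mem ⟨hab.le, le_rfl⟩)).isLittleO
    have h2 := h1.comp_tendsto (hx.continuousAt_apply hz₀ (t := b) ⟨hab.le, le_rfl⟩)
    refine (h2.congr_left fun z => by simp).trans_isBigO ?_
    exact Asymptotics.IsBigO.of_bound c (h.mono fun z hz => hz.2 b ⟨hab.le, le_rfl⟩)
  -- The boundary conditions turn the endpoint terms of the first variation into the variations of
  -- `Q_b` and `q_a`; what remains is quadratic, with displacement bound `c * ‖z - z₀‖`.
  have hsecond : (fun z => S.hjAction hab C x z - S.hjAction hab C x z₀ -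
      hjDifferential hab C x z₀ (z - z₀) -
      (C.boundary (x z₀ b) (x z b) - C.boundary (x z₀ b) (x z₀ b))) =o[𝓝 z₀] fun z => z - z₀ := by
    refine Asymptotics.IsBigO.trans_isLittleO ?_
      (Asymptotics.isLittleO_pow_sub_sub z₀ (m := 2) (by norm_num))
    refine Asymptotics.IsBigO.of_bound ((k * ((‖z₀.2‖ + 1) * (M * c ^ 2)) +
      n * ((k * (‖z₀.2‖ * M) * c + k * M) * c)) * (b - a)) ?_
    filter_upwards [h, hlim.eventually_le_const hT.pos, hnorm] with z hz hzr hzn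
    have hev := hx.evolution z hz.1
    have := hT.abs_action_sub_le C hev₀ hev hzr hz.2
    rw [hjDifferential_apply, Real.norm_eq_abs]
    rw [hx.final z hz.1, hx.final z₀ hz₀, hx.initial z hz.1, hx.initial z₀ hz₀] at this
    refine this.trans ?_
    have h2 : ‖z.2 - z₀.2‖ ≤ ‖z - z₀‖ := norm_snd_le (z - z₀)
    rw [norm_pow, norm_norm]
    have hba : 0 ≤ b - a := by linarith
    calc _ ≤ (k * ((‖z₀.2‖ + 1) * (M * (c * ‖z - z₀‖) ^ 2)) +
          n * ((k * (‖z₀.2‖ * M) * (c * ‖z - z₀‖) + k * (M * ‖z - z₀‖)) * (c * ‖z - z₀‖)))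
            * (b - a) := by gcongr
      _ = _ := by ring
  rw [hasFDerivAt_iff_isLittleO]
  exact (hsecond.add hbdry).congr_left fun z => by simp

theorem continuousAt_hjDifferential {z₀ : HJData n k a b} (hz₀ : z₀ ∈ D) :
    ContinuousAt (hjDifferential hab C x) z₀ := by
  have hP : ContinuousAt (fun z => C.P (x z b)) z₀ :=
    ContinuousAt.comp (g := C.P) (C.smooth_P.continuousOn.continuousAt (S.isOpen_N.mem_nhds
      ((hx.evolution z₀ hz₀).mem ⟨hab.le, le_rfl⟩)))
      (hx.continuousAt_apply hz₀ (t := b) ⟨hab.le, le_rfl⟩)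
  have hp : ContinuousAt (fun z => (x z a).1) z₀ :=
    (hx.continuousAt_apply hz₀ (t := a) ⟨le_rfl, hab.le⟩).fst
  have hH := hx.continuousAt_constraintCurve hz₀
  unfold hjDifferential
  fun_prop

theorem contDiffOn_hjAction : ContDiffOn ℝ 1 (S.hjAction hab C x) D := by
  rw [← zero_add (1 : WithTop ℕ∞), contDiffOn_succ_iff_fderiv_of_isOpen hx.isOpen_domain]
  refine ⟨fun z hz => (hx.hasFDerivAt_hjAction hz).differentiableAt.differentiableWithinAt,
    by simp, contDiffOn_zero.2 fun z hz => ContinuousAt.continuousWithinAt ?_⟩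
  refine (hx.continuousAt_hjDifferential hz).congr ?_
  filter_upwards [hx.isOpen_domain.mem_nhds hz] with w hw
  exact (hx.hasFDerivAt_hjAction hw).fderiv.symm

theorem contDiffAt_hjAction {z : HJData n k a b} (hz : z ∈ D) :
    ContDiffAt ℝ 1 (S.hjAction hab C x) z :=
  hx.contDiffOn_hjAction.contDiffAt (hx.isOpen_domain.mem_nhds hz)

theorem hasFDerivAt_hjAction_multiplier {z : HJData n k a b} (hz : z ∈ D) :
    HasFDerivAt (fun e => S.hjAction hab C x (z.1, e))
      (-multiplierPairing hab (S.constraintCurve (x z))) z.2 := by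
  have h := (hx.hasFDerivAt_hjAction (z₀ := (z.1, z.2)) hz).comp z.2
    ((hasFDerivAt_const z.1 z.2).prodMk (hasFDerivAt_id z.2))
  refine h.congr_fderiv (ContinuousLinearMap.ext fun w => ?_)
  simp [hjDifferential_apply]

theorem hasFDerivAt_hjAction_final {z : HJData n k a b} (hz : z ∈ D) :
    HasFDerivAt (fun Q => S.hjAction hab C x ((z.1.1, Q), z.2))
      (dotProductCLM n (C.P (x z b))) z.1.2 := by
  have h := HasFDerivAt.comp (f := fun Q => (((z.1.1, Q), z.2) : HJData n k a b)) z.1.2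
    (hx.hasFDerivAt_hjAction hz)
    (((hasFDerivAt_const z.1.1 z.1.2).prodMk (hasFDerivAt_id z.1.2)).prodMk
      (hasFDerivAt_const z.2 z.1.2))
  refine h.congr_fderiv (ContinuousLinearMap.ext fun w => ?_)
  simp [hjDifferential_apply]

theorem hasFDerivAt_hjAction_initial {z : HJData n k a b} (hz : z ∈ D) :
    HasFDerivAt (fun q => S.hjAction hab C x ((q, z.1.2), z.2))
      (-dotProductCLM n (x z a).1) z.1.1 := by
  have h := HasFDerivAt.comp (f := fun q => (((q, z.1.2), z.2) : HJData n k a b)) z.1.1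
    (hx.hasFDerivAt_hjAction hz)
    (((hasFDerivAt_id z.1.1).prodMk (hasFDerivAt_const z.1.2 z.1.1)).prodMk
      (hasFDerivAt_const z.2 z.1.1))
  refine h.congr_fderiv (ContinuousLinearMap.ext fun w => ?_)
  simp [hjDifferential_apply]

/-! ### Reduction of the parameter space -/

section Reduction

variable {E : Type*} [NormedAddCommGroup E] [NormedSpace ℝ E] {B : Type*} [TopologicalSpace B]
  [ChartedSpace E B] {rel : Multiplier k a b → B → Prop}

/-- A function that agrees with the Hamilton-Jacobi action along a relation between multipliers and
parameters in a manifold is a generalized generating function for the evolution relation, if the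
relation has enough local sections. -/
theorem isGeneralizedGeneratingFunction_of_sections
    {ψ : ((Fin n → ℝ) × (Fin n → ℝ)) × B → ℝ}
    (hrel : ∀ z ∈ D, ∃ T, rel z.2 T)
    (hψ : ∀ z ∈ D, ∀ T, rel z.2 T → ψ (z.1, T) = S.hjAction hab C x z)
    (hsec : ∀ z ∈ D, ∀ T, rel z.2 T → ∃ σ : B → Multiplier k a b, σ T = z.2 ∧
      ContMDiffAt 𝓘(ℝ, E) 𝓘(ℝ, Multiplier k a b) 1 σ T ∧ (∀ᶠ T' in 𝓝 T, rel (σ T') T') ∧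
      ((∀ v : TangentSpace 𝓘(ℝ, E) T, multiplierPairing hab (S.constraintCurve (x z))
        (mfderiv 𝓘(ℝ, E) 𝓘(ℝ, Multiplier k a b) σ T v) = 0) → S.SatisfiesConstraints a b (x z))) :
    IsGeneralizedGeneratingFunction (E := E) {w | ∃ e, (w.1, e) ∈ D ∧ rel e w.2} ψ
        (inCoordinates C (S.evolutionRelation hab C D)) ∧
      ∀ z ∈ D, ∀ T, rel z.2 T →
        (mfderiv 𝓘(ℝ, E) 𝓘(ℝ) (fun T' : B => ψ (z.1, T')) T = 0 ↔
          S.SatisfiesConstraints a b (x z)) := by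
  have hcrit : ∀ z ∈ D, ∀ T, rel z.2 T →
        (mfderiv 𝓘(ℝ, E) 𝓘(ℝ) (fun T' : B => ψ (z.1, T')) T = 0 ↔
          S.SatisfiesConstraints a b (x z)) := by
    intro z hz T hT
    obtain ⟨σ, hσT, hσ, hσrel, hσc⟩ := hsec z hz T hT
    have hmem : ∀ᶠ T' in 𝓝 T, (z.1, σ T') ∈ D := by
      have : ContinuousAt (fun T' => (z.1, σ T')) T := continuousAt_const.prodMk hσ.continuousAt
      exact this.eventually_mem (hx.isOpen_domain.mem_nhds (by rw [hσT]; exact hz))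
    -- Near `T` the reduced function is the action composed with the section, so its derivative
    -- follows from the chain rule.
    have heq : (fun T' : B => ψ (z.1, T')) =ᶠ[𝓝 T]
        (fun e => S.hjAction hab C x (z.1, e)) ∘ σ := by
      filter_upwards [hmem, hσrel] with T' h1 h2 using hψ _ h1 _ h2
    have hd := (hσT ▸ hx.hasFDerivAt_hjAction_multiplier hz :
      HasFDerivAt (fun e => S.hjAction hab C x (z.1, e))
      (-multiplierPairing hab (S.constraintCurve (x z))) (σ T))
    have hcomp := (hd.hasMFDerivAt.comp T (hσ.mdifferentiableAt (by simp)).hasMFDerivAt).congr_of_eventuallyEq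
      heq
    rw [hcomp.mfderiv]
    constructor
    · intro h0
      refine hσc fun v => ?_
      have := DFunLike.congr_fun h0 v
      exact neg_eq_zero.1 this
    · intro h0
      rw [((hx.evolution z hz).constraintCurve_eq_zero_iff).2 h0]
      refine ContinuousLinearMap.ext fun v => ?_
      change -(multiplierPairing hab 0) _ = 0
      rw [map_zero]
      exact neg_zero
  refine ⟨⟨?_, ?_, ?_⟩, hcrit⟩
  · rw [isOpen_iff_mem_nhds]
    rintro ⟨w, T⟩ ⟨e, he, hT⟩
    obtain ⟨σ, hσT, hσ, hσrel, -⟩ := hsec _ he T hT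
    have hc : ContinuousAt (fun y : ((Fin n → ℝ) × (Fin n → ℝ)) × B => (y.1, σ y.2)) (w, T) :=
      continuousAt_fst.prodMk (hσ.continuousAt.comp (f := Prod.snd) (x := (w, T)) continuousAt_snd)
    filter_upwards [hc.eventually_mem (hx.isOpen_domain.mem_nhds
      (show (w, σ T) ∈ D by rw [hσT]; exact he)), continuousAt_snd.eventually hσrel] with y h1 h2
    exact ⟨_, h1, h2⟩
  · rintro ⟨w, T⟩ ⟨e, he, hT⟩
    obtain ⟨σ, hσT, hσ, hσrel, -⟩ := hsec _ he T hT
    have hc : ContinuousAt (fun y : ((Fin n → ℝ) × (Fin n → ℝ)) × B => (y.1, σ y.2)) (w, T) :=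
      continuousAt_fst.prodMk (hσ.continuousAt.comp (f := Prod.snd) (x := (w, T)) continuousAt_snd)
    have heq : ψ =ᶠ[𝓝 (w, T)] fun y => S.hjAction hab C x (y.1, σ y.2) := by
      filter_upwards [hc.eventually_mem (hx.isOpen_domain.mem_nhds
        (show (w, σ T) ∈ D by rw [hσT]; exact he)), continuousAt_snd.eventually hσrel] with y h1 h2
      exact hψ _ h1 _ h2
    refine ContMDiffAt.contMDiffWithinAt (ContMDiffAt.congr_of_eventuallyEq ?_ heq)
    have h1 : ContMDiffAt 𝓘(ℝ, HJData n k a b) 𝓘(ℝ) 1 (S.hjAction hab C x) (w, σ T) :=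
      (hx.contDiffAt_hjAction (by rw [hσT]; exact he)).contMDiffAt
    refine h1.comp (w, T) (f := fun y : ((Fin n → ℝ) × (Fin n → ℝ)) × B => (y.1, σ y.2)) ?_
    rw [contMDiffAt_prod_module_iff]
    exact ⟨contMDiffAt_fst, ContMDiffAt.comp (I' := 𝓘(ℝ, E)) (g := σ) (f := Prod.snd) (w, T) hσ
      contMDiffAt_snd⟩
  -- Derivatives in `Q` and `q` need no section: the multiplier is kept fixed, and openness of `D`
  -- keeps nearby data admissible.
  · have hQ : ∀ z ∈ D, ∀ T, rel z.2 T → ∀ i,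
        fderiv ℝ (fun Q => ψ ((z.1.1, Q), T)) z.1.2 (Pi.single i 1) = C.P (x z b) i := by
      intro z hz T hT i
      have heq : (fun Q => ψ ((z.1.1, Q), T)) =ᶠ[𝓝 z.1.2]
          fun Q => S.hjAction hab C x ((z.1.1, Q), z.2) := by
        have : ContinuousAt (fun Q => (((z.1.1, Q), z.2) : HJData n k a b)) z.1.2 := by fun_prop
        filter_upwards [this.eventually_mem (hx.isOpen_domain.mem_nhds hz)] with Q hQ
        exact hψ _ hQ _ hT
      rw [heq.fderiv_eq, (hx.hasFDerivAt_hjAction_final hz).fderiv]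
      simp
    have hq : ∀ z ∈ D, ∀ T, rel z.2 T → ∀ i,
        -fderiv ℝ (fun q => ψ ((q, z.1.2), T)) z.1.1 (Pi.single i 1) = (x z a).1 i := by
      intro z hz T hT i
      have heq : (fun q => ψ ((q, z.1.2), T)) =ᶠ[𝓝 z.1.1]
          fun q => S.hjAction hab C x ((q, z.1.2), z.2) := by
        have : ContinuousAt (fun q => (((q, z.1.2), z.2) : HJData n k a b)) z.1.1 := by fun_prop
        filter_upwards [this.eventually_mem (hx.isOpen_domain.mem_nhds hz)] with Q hQ
        exact hψ _ hQ _ hT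
      rw [heq.fderiv_eq, (hx.hasFDerivAt_hjAction_initial hz).fderiv]
      simp
    have ha : a ∈ Icc a b := ⟨le_rfl, hab.le⟩
    have hb : b ∈ Icc a b := ⟨hab.le, le_rfl⟩
    ext w
    constructor
    -- The solution witnessing membership in the relation coincides with the one of the family, by
    -- uniqueness for its own boundary data.
    · rintro ⟨⟨y₁, y₂⟩, ⟨e, y, hy, hyc, rfl, rfl, hD⟩, rfl⟩
      obtain ⟨T, hT⟩ := hrel _ hD
      have hyx := hx.unique _ hD y hy rfl rfl
      refine ⟨T, ⟨e, hD, hT⟩, fun i => ?_, fun i => ?_, ?_⟩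
      · rw [hQ _ hD T hT i]
        exact congrArg (fun w => C.P w i) (hyx hb)
      · rw [hq _ hD T hT i]
        exact congrArg (fun w => w.1 i) (hyx ha)
      · refine (hcrit _ hD T hT).2 fun t ht α => ?_
        rw [← hyx ht]
        exact hyc t ht α
    · rintro ⟨T, ⟨e, hD, hT⟩, h1, h2, h3⟩
      have hev := hx.evolution _ hD
      refine ⟨(x ((w.1.2, w.2.2), e) a, x ((w.1.2, w.2.2), e) b),
        ⟨e, _, hev, (hcrit _ hD T hT).1 h3, rfl, rfl, ?_⟩, ?_⟩
      · simp only
        rw [hx.initial _ hD, hx.final _ hD]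
        exact hD
      · refine Prod.ext (Prod.ext (funext fun i => ?_) (hx.initial _ hD))
          (Prod.ext (funext fun i => ?_) (hx.final _ hD))
        · exact (hq _ hD T hT i).symm.trans (h2 i).symm
        · exact (hQ _ hD T hT i).symm.trans (h1 i).symm

/-- The Hamilton-Jacobi action descends along a relation between multipliers and parameters in a
manifold, if it is invariant and the relation has enough local sections. -/
theorem exists_reducedAction
    (hrel : ∀ z ∈ D, ∃ T, rel z.2 T)
    (hinv : ∀ z ∈ D, ∀ z' ∈ D, ∀ T, z.1 = z'.1 → rel z.2 T → rel z'.2 T →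
      S.hjAction hab C x z = S.hjAction hab C x z')
    (hsec : ∀ z ∈ D, ∀ T, rel z.2 T → ∃ σ : B → Multiplier k a b, σ T = z.2 ∧
      ContMDiffAt 𝓘(ℝ, E) 𝓘(ℝ, Multiplier k a b) 1 σ T ∧ (∀ᶠ T' in 𝓝 T, rel (σ T') T') ∧
      ((∀ v : TangentSpace 𝓘(ℝ, E) T, multiplierPairing hab (S.constraintCurve (x z))
        (mfderiv 𝓘(ℝ, E) 𝓘(ℝ, Multiplier k a b) σ T v) = 0) → S.SatisfiesConstraints a b (x z))) :
    ∃ Shat : ((Fin n → ℝ) × (Fin n → ℝ)) × B → ℝ,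
      (∀ z ∈ D, ∀ T, rel z.2 T → Shat (z.1, T) = S.hjAction hab C x z) ∧
      IsGeneralizedGeneratingFunction (E := E) {w | ∃ e, (w.1, e) ∈ D ∧ rel e w.2} Shat
        (inCoordinates C (S.evolutionRelation hab C D)) ∧
      ∀ z ∈ D, ∀ T, rel z.2 T →
        (mfderiv 𝓘(ℝ, E) 𝓘(ℝ) (fun T' : B => Shat (z.1, T')) T = 0 ↔
          S.SatisfiesConstraints a b (x z)) := by
  classical
  -- By invariance the value does not depend on the chosen multiplier. Off the image of `D` the
  -- value 0 is arbitrary.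
  let Shat : ((Fin n → ℝ) × (Fin n → ℝ)) × B → ℝ := fun w =>
    if h : ∃ e, (w.1, e) ∈ D ∧ rel e w.2 then S.hjAction hab C x (w.1, h.choose) else 0
  have hS : ∀ z ∈ D, ∀ T, rel z.2 T → Shat (z.1, T) = S.hjAction hab C x z := by
    intro z hz T hT
    have h : ∃ e, (z.1, e) ∈ D ∧ rel e T := ⟨z.2, hz, hT⟩
    simp only [Shat, dif_pos h]
    exact hinv _ h.choose_spec.1 _ hz T rfl h.choose_spec.2 hT
  exact ⟨Shat, hS, hx.isGeneralizedGeneratingFunction_of_sections hrel hS hsec⟩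

end Reduction

end IsSolutionFamily
end FirstClassSystem

/-! ### The multiplier as parameter, and gauge invariance -/

namespace FirstClassSystem

variable {n k : ℕ} {S : FirstClassSystem n k} {a b : ℝ} {hab : a < b}
  {C : DarbouxChange S.N} {D : Set (HJData n k a b)} {x : HJData n k a b → ℝ → Phase n}

namespace IsSolutionFamily

variable (hx : S.IsSolutionFamily hab C D x)
include hx

/-- The reduction criterion for the relation of equality with the identity as section. Agreement is
asked on `D` only, which is all that a function of gauge classes determines. -/
theorem isGeneralizedGeneratingFunction_of_eqOn {ψ : HJData n k a b → ℝ}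
    (hψ : ∀ z ∈ D, ψ z = S.hjAction hab C x z) :
    IsGeneralizedGeneratingFunction (E := Multiplier k a b) D ψ
        (inCoordinates C (S.evolutionRelation hab C D)) := by
  have h := (hx.isGeneralizedGeneratingFunction_of_sections (E := Multiplier k a b)
    (rel := fun e T => e = T) (ψ := ψ) (fun z _ => ⟨_, rfl⟩)
    (by rintro z hz _ rfl; exact hψ z hz) (by
      rintro z hz _ rfl
      refine ⟨id, rfl, contMDiff_id.contMDiffAt, Eventually.of_forall fun _ => rfl, fun h => ?_⟩
      rw [← (hx.evolution z hz).constraintCurve_eq_zero_iff, ← multiplierPairing_eq_zero_iff hab]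
      refine ContinuousLinearMap.ext fun v => ?_
      have := h v
      rw [mfderiv_id] at this
      exact this)).1
  simpa using h

theorem fderiv_hjAction_eq_zero_iff {z : HJData n k a b} (hz : z ∈ D) :
    fderiv ℝ (fun e => S.hjAction hab C x (z.1, e)) z.2 = 0 ↔
      S.SatisfiesConstraints a b (x z) := by
  rw [(hx.hasFDerivAt_hjAction_multiplier hz).fderiv, neg_eq_zero, multiplierPairing_eq_zero_iff,
    (hx.evolution z hz).constraintCurve_eq_zero_iff]

/-- The action is constant along paths of multipliers, if their velocities do not pair with the
constraints. -/
theorem hjAction_eq_of_path {w : (Fin n → ℝ) × (Fin n → ℝ)} {ε ε' : ℝ → Multiplier k a b}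
    (h : ∀ s ∈ Icc (0 : ℝ) 1, (w, ε s) ∈ D ∧ HasDerivWithinAt ε (ε' s) (Icc 0 1) s ∧
      multiplierPairing hab (S.constraintCurve (x (w, ε s))) (ε' s) = 0) :
    S.hjAction hab C x (w, ε 0) = S.hjAction hab C x (w, ε 1) := by
  have hd : ∀ s ∈ Icc (0 : ℝ) 1,
      HasDerivWithinAt (fun s => S.hjAction hab C x (w, ε s)) 0 (Icc 0 1) s := by
    intro s hs
    obtain ⟨hD, hε, h0⟩ := h s hs
    refine ((hx.hasFDerivAt_hjAction_multiplier hD).comp_hasDerivWithinAt s hε).congr_deriv ?_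
    rw [neg_apply, h0, neg_zero]
  have := integral_eq_sub_of_hasDerivWithinAt_Icc zero_le_one hd continuousOn_const
  simp only [intervalIntegral.integral_zero] at this
  linarith

end IsSolutionFamily

/-- Variations that are the derivative of a function along a solution pair with the constraints
through boundary terms. -/
theorem IsEvolution.multiplierPairing_eq_sub {y : ℝ → Phase n} {e ε : Multiplier k a b}
    (hy : S.IsEvolution hab e y) {γ γ' : ℝ → Fin k → ℝ}
    (h : ∀ t ∈ Icc a b, HasDerivWithinAt γ (γ' t) (Icc a b) t ∧
      ∑ δ, coeff hab ε t δ * S.H δ (y t) = ∑ δ, γ' t δ * S.H δ (y t) +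
        ∑ α, ∑ β, coeff hab e t α * γ t β * poissonBracket (S.H α) (S.H β) (y t)) :
    multiplierPairing hab (S.constraintCurve y) ε =
      ∑ δ, γ b δ * S.H δ (y b) - ∑ δ, γ a δ * S.H δ (y a) := by
  rw [hy.multiplierPairing_constraintCurve]
  -- The integrand is the derivative of `∑ γ^δ H_δ`: along the solution the derivative of `H_δ`
  -- produces the brackets.
  refine integral_eq_sub_of_hasDerivWithinAt_Icc hab.le
    (g := fun t => ∑ δ, γ t δ * S.H δ (y t)) (fun t ht => ?_)
    (continuousOn_finsetSum _ fun α _ =>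
      (continuousOn_coeff_apply ε α _).mul (hy.continuousOn_H α))
  obtain ⟨hγ, hε⟩ := h t ht
  rw [hasDerivWithinAt_pi] at hγ
  refine (HasDerivWithinAt.fun_sum fun δ _ => (hγ δ).fun_mul (hy.hasDerivWithinAt_H δ ht)).congr_deriv ?_
  rw [hε, Finset.sum_add_distrib, Finset.sum_comm (γ := Fin k) (s := Finset.univ)
    (f := fun α β => coeff hab e t α * γ t β * poissonBracket (S.H α) (S.H β) (y t))]
  congr 1
  refine Finset.sum_congr rfl fun β _ => ?_
  rw [Finset.mul_sum]
  refine Finset.sum_congr rfl fun α _ => ?_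
  ring

/-- Involutivity turns the structure function term of the velocity into brackets, so the velocity
pairs with the constraints through boundary terms, which vanish together with the gauge parameter.
-/
theorem IsSolutionFamily.hjAction_eq_of_gaugeStep (hx : S.IsSolutionFamily hab C D x) {z z' : D}
    (h : S.GaugeStep hab x z z') : S.hjAction hab C x z.1 = S.hjAction hab C x z'.1 := by
  obtain ⟨h1, ε, ε', γ, γ', h0, h1', h⟩ := h
  have := hx.hjAction_eq_of_path (w := z.1.1) (ε := ε) (ε' := ε') fun s hs => by
    obtain ⟨hD, hε, ha, hb, ht⟩ := h s hs
    refine ⟨hD, hε, ?_⟩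
    have hev := hx.evolution _ hD
    rw [hev.multiplierPairing_eq_sub (γ := γ s) (γ' := γ' s), ha, hb]
    · simp
    · intro t htab
      refine ⟨(ht t htab).1, ?_⟩
      simp only [(ht t htab).2, S.involutive _ _ _ (hev.mem htab), add_mul, Finset.sum_add_distrib]
      congr 1
      simp only [Finset.mul_sum, Finset.sum_mul]
      rw [Finset.sum_comm]
      refine Finset.sum_congr rfl fun α _ => ?_
      rw [Finset.sum_comm]
      refine Finset.sum_congr rfl fun β _ => Finset.sum_congr rfl fun δ _ => ?_
      ring
  rw [h0, h1'] at this
  rw [h1] at this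
  rw [← this, ← h1]

/-! ### Strictly involutive constraints -/

theorem IsEvolution.H_eq_of_poissonBracket_eq_zero {y : ℝ → Phase n} {e : Multiplier k a b}
    (hy : S.IsEvolution hab e y)
    (h : ∀ α β, ∀ y ∈ S.N, poissonBracket (S.H α) (S.H β) y = 0) {t : ℝ} (ht : t ∈ Icc a b)
    (δ : Fin k) : S.H δ (y t) = S.H δ (y a) := by
  have hd : ∀ s ∈ Icc a t, HasDerivWithinAt (fun τ => S.H δ (y τ)) 0 (Icc a t) s := by
    intro s hs
    have hs' : s ∈ Icc a b := ⟨hs.1, hs.2.trans ht.2⟩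
    refine ((hy.hasDerivWithinAt_H δ hs').mono (Icc_subset_Icc_right ht.2)).congr_deriv ?_
    simp [h _ _ _ (hy.mem hs')]
  have := integral_eq_sub_of_hasDerivWithinAt_Icc ht.1 hd continuousOn_const
  simp only [intervalIntegral.integral_zero] at this
  linarith

/-- The constraints are conserved and come out of the integral. -/
theorem IsEvolution.multiplierPairing_of_poissonBracket_eq_zero {y : ℝ → Phase n}
    {e : Multiplier k a b} (hy : S.IsEvolution hab e y)
    (h : ∀ α β, ∀ y ∈ S.N, poissonBracket (S.H α) (S.H β) y = 0) (ε : Multiplier k a b) :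
    multiplierPairing hab (S.constraintCurve y) ε =
      totalIntegral hab ε ⬝ᵥ fun δ => S.H δ (y a) := by
  rw [hy.multiplierPairing_constraintCurve]
  have h1 : ∫ t in a..b, ∑ α, coeff hab ε t α * S.H α (y t) =
      ∫ t in a..b, dotProductCLM k (fun δ => S.H δ (y a)) (coeff hab ε t) := by
    refine intervalIntegral.integral_congr fun t ht => ?_
    rw [uIcc_of_le hab.le] at ht
    simp only [dotProductCLM_apply, dotProduct, hy.H_eq_of_poissonBracket_eq_zero h ht, mul_comm]
  rw [h1, ContinuousLinearMap.intervalIntegral_comp_comm _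
    ((continuous_coeff hab ε).intervalIntegrable a b), dotProductCLM_apply, dotProduct_comm]
  rfl

/-- Constant multipliers. -/
def constMultiplier (k : ℕ) (a b : ℝ) : (Fin k → ℝ) →L[ℝ] Multiplier k a b :=
  LinearMap.mkContinuous
    { toFun := fun c => ContinuousMap.const _ c
      map_add' := fun _ _ => rfl
      map_smul' := fun _ _ => rfl } 1
    fun c => by
      rw [one_mul]
      exact (ContinuousMap.norm_le _ (norm_nonneg _)).2 fun _ => le_rfl

theorem coeff_constMultiplier (hab : a < b) (c : Fin k → ℝ) (t : ℝ) :
    coeff hab (constMultiplier k a b c) t = c := rfl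

theorem totalIntegral_add (e e' : Multiplier k a b) :
    totalIntegral hab (e + e') = totalIntegral hab e + totalIntegral hab e' := by
  simp only [totalIntegral, coeff_add]
  exact intervalIntegral.integral_add ((continuous_coeff hab e).intervalIntegrable _ _)
    ((continuous_coeff hab e').intervalIntegrable _ _)

theorem totalIntegral_smul (c : ℝ) (e : Multiplier k a b) :
    totalIntegral hab (c • e) = c • totalIntegral hab e := by
  simp only [totalIntegral, coeff_smul]
  exact intervalIntegral.integral_smul c _

theorem totalIntegral_constMultiplier (c : Fin k → ℝ) :
    totalIntegral hab (constMultiplier k a b c) = (b - a) • c := by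
  simp only [totalIntegral, coeff_constMultiplier]
  exact intervalIntegral.integral_const c

/-- Multipliers with equal integral are joined by a segment with velocity of zero integral, which
pairs to zero with the conserved constraints. Adding constant multipliers gives local sections. -/
theorem IsSolutionFamily.exists_reducedAction_of_poissonBracket_eq_zero
    (hx : S.IsSolutionFamily hab C D x)
    (h : ∀ α β, ∀ y ∈ S.N, poissonBracket (S.H α) (S.H β) y = 0)
    (hD : ∀ z ∈ D, ∀ e, totalIntegral hab e = totalIntegral hab z.2 → (z.1, e) ∈ D) :
    ∃ Shat : ((Fin n → ℝ) × (Fin n → ℝ)) × (Fin k → ℝ) → ℝ,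
        (∀ z ∈ D, Shat (z.1, totalIntegral hab z.2) = S.hjAction hab C x z) ∧
        IsGeneralizedGeneratingFunction (E := Fin k → ℝ)
          {w | ∃ e, (w.1, e) ∈ D ∧ totalIntegral hab e = w.2} Shat
          (inCoordinates C (S.evolutionRelation hab C D)) ∧
        ∀ z ∈ D, fderiv ℝ (fun T => Shat (z.1, T)) (totalIntegral hab z.2) = 0 ↔
          S.SatisfiesConstraints a b (x z) := by
  have hba : b - a ≠ 0 := (sub_pos.2 hab).ne'
  obtain ⟨Shat, h1, h2, h3⟩ := hx.exists_reducedAction (E := Fin k → ℝ)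
    (rel := fun e T => totalIntegral hab e = T) (fun z _ => ⟨_, rfl⟩) (by
      rintro ⟨w, e⟩ hz ⟨w', e'⟩ hz' _ rfl rfl hT
      simp only at hT
      have hint (s : ℝ) : totalIntegral hab (e + s • (e' + (-1 : ℝ) • e)) = totalIntegral hab e := by
        simp only [totalIntegral_add, totalIntegral_smul, hT]; module
      have := hx.hjAction_eq_of_path (w := w) (ε := fun s => e + s • (e' + (-1 : ℝ) • e))
        (ε' := fun _ => e' + (-1 : ℝ) • e) fun s _ => ?_
      · simpa using this
      · have hm := hD _ hz _ (hint s)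
        refine ⟨hm, ?_, ?_⟩
        · simpa using (((hasDerivAt_id s).smul_const (e' + (-1 : ℝ) • e)).const_add
            e).hasDerivWithinAt
        · rw [(hx.evolution _ hm).multiplierPairing_of_poissonBracket_eq_zero h,
            totalIntegral_add, totalIntegral_smul, hT]
          simp) (by
      rintro z hz _ rfl
      set T := totalIntegral hab z.2
      -- The factor `(b - a)⁻¹` makes the added constant multiplier have integral `T' - T`.
      have hσ : HasFDerivAt (fun T' => z.2 + constMultiplier k a b ((b - a)⁻¹ • (T' - T)))
          ((constMultiplier k a b).comp ((b - a)⁻¹ • ContinuousLinearMap.id ℝ _)) T :=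
        ((constMultiplier k a b).hasFDerivAt.comp T
          (((hasFDerivAt_id T).sub_const T).const_smul ((b - a)⁻¹))).const_add z.2
      refine ⟨fun T' => z.2 + constMultiplier k a b ((b - a)⁻¹ • (T' - T)), by simp,
        ContDiffAt.contMDiffAt (by fun_prop), Eventually.of_forall fun T' => ?_, fun hv => ?_⟩
      · rw [totalIntegral_add, totalIntegral_constMultiplier, smul_inv_smul₀ hba]
        exact add_sub_cancel _ _
      · have hev := hx.evolution z hz
        rw [mfderiv_eq_fderiv, hσ.fderiv] at hv
        have h0 : (fun δ => S.H δ (x z a)) = 0 := by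
          -- Testing criticality in the direction of the constraint vector itself gives a vanishing
          -- sum of squares.
          have : multiplierPairing hab (S.constraintCurve (x z))
              (constMultiplier k a b ((b - a)⁻¹ • fun δ => S.H δ (x z a))) = 0 := hv _
          rw [hev.multiplierPairing_of_poissonBracket_eq_zero h, totalIntegral_constMultiplier, smul_inv_smul₀ hba] at this
          exact dotProduct_self_eq_zero.1 this
        intro t ht δ
        rw [hev.H_eq_of_poissonBracket_eq_zero h ht]
        exact congrFun h0 δ)
  refine ⟨Shat, fun z hz => h1 z hz _ rfl, h2, fun z hz => ?_⟩
  rw [← h3 z hz _ rfl, mfderiv_eq_fderiv]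
  rfl

end FirstClassSystem

/-! ### A group in a chart at the identity, and its invariant vector fields -/

/-- A chart of a group around the identity, centred at zero, in which the group operations are
smooth. -/
structure GroupChart (G V : Type*) [TopologicalSpace G] [Group G] [NormedAddCommGroup V]
    [NormedSpace ℝ V] where
  φ : OpenPartialHomeomorph G V
  one_mem : 1 ∈ φ.source
  map_one : φ 1 = 0
  contDiffOn_mul : ContDiffOn ℝ ∞ (fun p : V × V => φ (φ.symm p.1 * φ.symm p.2))
    {p | p.1 ∈ φ.target ∧ p.2 ∈ φ.target ∧ φ.symm p.1 * φ.symm p.2 ∈ φ.source}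
  contDiffOn_inv : ContDiffOn ℝ ∞ (fun x : V => φ (φ.symm x)⁻¹)
    {x | x ∈ φ.target ∧ (φ.symm x)⁻¹ ∈ φ.source}

namespace GroupChart

variable {G V : Type*} [TopologicalSpace G] [Group G]
  [NormedAddCommGroup V] [NormedSpace ℝ V] (c : GroupChart G V)

/-- The multiplication in the chart. -/
def mul (p : V × V) : V := c.φ (c.φ.symm p.1 * c.φ.symm p.2)

/-- The domain of the multiplication in the chart. -/
def dom : Set (V × V) :=
  {p | p.1 ∈ c.φ.target ∧ p.2 ∈ c.φ.target ∧ c.φ.symm p.1 * c.φ.symm p.2 ∈ c.φ.source}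

theorem zero_mem : (0 : V) ∈ c.φ.target := c.map_one ▸ c.φ.map_source c.one_mem

@[simp] theorem symm_zero : c.φ.symm 0 = 1 := by rw [← c.map_one, c.φ.left_inv c.one_mem]

theorem mem_dom_zero_right {x : V} (hx : x ∈ c.φ.target) : (x, (0 : V)) ∈ c.dom :=
  ⟨hx, c.zero_mem, by simpa using c.φ.map_target hx⟩

theorem mem_dom_zero_left {x : V} (hx : x ∈ c.φ.target) : ((0 : V), x) ∈ c.dom :=
  ⟨c.zero_mem, hx, by simpa using c.φ.map_target hx⟩

theorem mul_zero_right {x : V} (hx : x ∈ c.φ.target) : c.mul (x, 0) = x := by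
  simp [mul, c.φ.right_inv hx]

theorem mul_zero_left {x : V} (hx : x ∈ c.φ.target) : c.mul (0, x) = x := by
  simp [mul, c.φ.right_inv hx]

theorem symm_mul {p : V × V} (hp : p ∈ c.dom) :
    c.φ.symm (c.mul p) = c.φ.symm p.1 * c.φ.symm p.2 := c.φ.left_inv hp.2.2

theorem mul_mem {p : V × V} (hp : p ∈ c.dom) : c.mul p ∈ c.φ.target := c.φ.map_source hp.2.2

/-- Both sides are values of `φ` at the same group element, so the threefold product need not lie in
the chart. -/
theorem mul_assoc_of_mem {x y z : V} (h1 : (x, y) ∈ c.dom) (h2 : (y, z) ∈ c.dom) :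
    c.mul (c.mul (x, y), z) = c.mul (x, c.mul (y, z)) := by
  have e1 := c.symm_mul h1
  have e2 := c.symm_mul h2
  simp only at e1 e2
  change c.φ (c.φ.symm (c.mul (x, y)) * c.φ.symm z) = c.φ (c.φ.symm x * c.φ.symm (c.mul (y, z)))
  rw [e1, e2, _root_.mul_assoc]

variable [IsTopologicalGroup G]

theorem isOpen_dom : IsOpen c.dom := by
  have h : ContinuousOn (fun p : V × V => c.φ.symm p.1 * c.φ.symm p.2)
      (c.φ.target ×ˢ c.φ.target) :=
    (c.φ.continuousOn_symm.comp continuousOn_fst fun p hp => hp.1).mul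
      (c.φ.continuousOn_symm.comp continuousOn_snd fun p hp => hp.2)
  have := h.isOpen_inter_preimage (c.φ.open_target.prod c.φ.open_target) c.φ.open_source
  convert this using 1
  ext p
  simp [dom, and_assoc]

theorem contDiffAt_mul {p : V × V} (hp : p ∈ c.dom) : ContDiffAt ℝ ∞ c.mul p :=
  (c.contDiffOn_mul).contDiffAt (c.isOpen_dom.mem_nhds hp)

theorem hasFDerivAt_mul {p : V × V} (hp : p ∈ c.dom) : HasFDerivAt c.mul (fderiv ℝ c.mul p) p :=
  ((c.contDiffAt_mul hp).differentiableAt (by simp)).hasFDerivAt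

theorem hasFDerivAt_mul_right {p : V × V} (hp : p ∈ c.dom) : HasFDerivAt (fun y => c.mul (p.1, y))
    ((fderiv ℝ c.mul p).comp (ContinuousLinearMap.inr ℝ V V)) p.2 :=
  HasFDerivAt.comp (f := fun y => (p.1, y)) p.2 (c.hasFDerivAt_mul hp) (hasFDerivAt_prodMk_right p.1 p.2)

theorem hasFDerivAt_mul_left {p : V × V} (hp : p ∈ c.dom) : HasFDerivAt (fun x => c.mul (x, p.2))
    ((fderiv ℝ c.mul p).comp (ContinuousLinearMap.inl ℝ V V)) p.1 :=
  HasFDerivAt.comp (f := fun x => (x, p.2)) p.1 (c.hasFDerivAt_mul hp) (hasFDerivAt_prodMk_left p.1 p.2)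

/-- The left-invariant vector fields in the chart. -/
def X (x : V) : V →L[ℝ] V := (fderiv ℝ c.mul (x, 0)).comp (ContinuousLinearMap.inr ℝ V V)

/-- The right-invariant vector fields in the chart. -/
def R (y : V) : V →L[ℝ] V := (fderiv ℝ c.mul (0, y)).comp (ContinuousLinearMap.inl ℝ V V)

theorem hasFDerivAt_X {x : V} (hx : x ∈ c.φ.target) :
    HasFDerivAt (fun y => c.mul (x, y)) (c.X x) 0 :=
  c.hasFDerivAt_mul_right (c.mem_dom_zero_right hx)

theorem hasFDerivAt_R {y : V} (hy : y ∈ c.φ.target) :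
    HasFDerivAt (fun x => c.mul (x, y)) (c.R y) 0 :=
  c.hasFDerivAt_mul_left (c.mem_dom_zero_left hy)

theorem fderiv_mul_zero_left {y : V} (hy : y ∈ c.φ.target) :
    (fderiv ℝ c.mul (0, y)).comp (ContinuousLinearMap.inr ℝ V V) = ContinuousLinearMap.id ℝ V := by
  refine (c.hasFDerivAt_mul_right (c.mem_dom_zero_left hy)).unique
    ((hasFDerivAt_id y).congr_of_eventuallyEq ?_)
  filter_upwards [c.φ.open_target.mem_nhds hy] with z hz using c.mul_zero_left hz

theorem fderiv_mul_zero_right {x : V} (hx : x ∈ c.φ.target) :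
    (fderiv ℝ c.mul (x, 0)).comp (ContinuousLinearMap.inl ℝ V V) = ContinuousLinearMap.id ℝ V := by
  refine (c.hasFDerivAt_mul_left (c.mem_dom_zero_right hx)).unique
    ((hasFDerivAt_id x).congr_of_eventuallyEq ?_)
  filter_upwards [c.φ.open_target.mem_nhds hx] with z hz using c.mul_zero_right hz

theorem X_zero : c.X 0 = ContinuousLinearMap.id ℝ V := c.fderiv_mul_zero_left c.zero_mem

theorem R_zero : c.R 0 = ContinuousLinearMap.id ℝ V := c.fderiv_mul_zero_right c.zero_mem

theorem eventually_mem_dom_right {x : V} (hx : x ∈ c.φ.target) : ∀ᶠ z in 𝓝 (0 : V), (x, z) ∈ c.dom :=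
  ContinuousAt.eventually_mem (f := fun z => (x, z)) (x := 0) (by fun_prop)
    (c.isOpen_dom.mem_nhds (c.mem_dom_zero_right hx))

theorem eventually_mem_dom_left {x : V} (hx : x ∈ c.φ.target) : ∀ᶠ z in 𝓝 (0 : V), (z, x) ∈ c.dom :=
  ContinuousAt.eventually_mem (f := fun z => (z, x)) (x := 0) (by fun_prop)
    (c.isOpen_dom.mem_nhds (c.mem_dom_zero_left hx))

/-- Associativity differentiated in the last factor at the identity: left translations preserve
left-invariant fields. -/
theorem X_mul {x y : V} (h : (x, y) ∈ c.dom) :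
    c.X (c.mul (x, y)) = ((fderiv ℝ c.mul (x, y)).comp (ContinuousLinearMap.inr ℝ V V)).comp (c.X y) := by
  have h1 : HasFDerivAt (fun z => c.mul (x, z))
      ((fderiv ℝ c.mul (x, y)).comp (ContinuousLinearMap.inr ℝ V V)) (c.mul (y, 0)) := by
    rw [c.mul_zero_right h.2.1]; exact c.hasFDerivAt_mul_right h
  refine (c.hasFDerivAt_X (c.mul_mem h)).unique
    ((h1.comp 0 (c.hasFDerivAt_X h.2.1)).congr_of_eventuallyEq ?_)
  filter_upwards [c.eventually_mem_dom_right h.2.1] with z hz using c.mul_assoc_of_mem h hz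

theorem R_mul {x y : V} (h : (x, y) ∈ c.dom) :
    c.R (c.mul (x, y)) = ((fderiv ℝ c.mul (x, y)).comp (ContinuousLinearMap.inl ℝ V V)).comp (c.R x) := by
  have h1 : HasFDerivAt (fun z => c.mul (z, y))
      ((fderiv ℝ c.mul (x, y)).comp (ContinuousLinearMap.inl ℝ V V)) (c.mul (0, x)) := by
    rw [c.mul_zero_left h.1]; exact c.hasFDerivAt_mul_left h
  refine (c.hasFDerivAt_R (c.mul_mem h)).unique
    ((h1.comp 0 (c.hasFDerivAt_R h.1)).congr_of_eventuallyEq ?_)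
  filter_upwards [c.eventually_mem_dom_left h.1] with z hz using (c.mul_assoc_of_mem hz h).symm

/-- Associativity differentiated in the middle factor: an infinitesimal factor between `x` and `y`
may be attached to either of them. -/
theorem fderiv_mul_comp_X {x y : V} (h : (x, y) ∈ c.dom) :
    ((fderiv ℝ c.mul (x, y)).comp (ContinuousLinearMap.inl ℝ V V)).comp (c.X x) =
      ((fderiv ℝ c.mul (x, y)).comp (ContinuousLinearMap.inr ℝ V V)).comp (c.R y) := by
  have h1 : HasFDerivAt (fun z => c.mul (z, y))
      ((fderiv ℝ c.mul (x, y)).comp (ContinuousLinearMap.inl ℝ V V)) (c.mul (x, 0)) := by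
    rw [c.mul_zero_right h.1]; exact c.hasFDerivAt_mul_left h
  have h2 : HasFDerivAt (fun z => c.mul (x, z))
      ((fderiv ℝ c.mul (x, y)).comp (ContinuousLinearMap.inr ℝ V V)) (c.mul (0, y)) := by
    rw [c.mul_zero_left h.2.1]; exact c.hasFDerivAt_mul_right h
  refine (h1.comp 0 (c.hasFDerivAt_X h.1)).unique
    ((h2.comp 0 (c.hasFDerivAt_R h.2.1)).congr_of_eventuallyEq ?_)
  filter_upwards [c.eventually_mem_dom_right h.1, c.eventually_mem_dom_left h.2.1] with z hz hz'
    using c.mul_assoc_of_mem hz hz'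

theorem contDiffAt_fderiv_mul {p : V × V} (hp : p ∈ c.dom) : ContDiffAt ℝ ∞ (fderiv ℝ c.mul) p :=
  (c.contDiffAt_mul hp).fderiv_right (by simp)

theorem contDiffAt_X {x : V} (hx : x ∈ c.φ.target) : ContDiffAt ℝ ∞ c.X x := by
  have h : ContDiffAt ℝ ∞ (fun x : V => fderiv ℝ c.mul (x, 0)) x :=
    ContDiffAt.comp (f := fun x : V => (x, (0 : V))) x
      (c.contDiffAt_fderiv_mul (c.mem_dom_zero_right hx)) (by fun_prop)
  exact h.clm_comp contDiffAt_const

theorem contDiffAt_R {x : V} (hx : x ∈ c.φ.target) : ContDiffAt ℝ ∞ c.R x := by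
  have h : ContDiffAt ℝ ∞ (fun x : V => fderiv ℝ c.mul (0, x)) x :=
    ContDiffAt.comp (f := fun x : V => ((0 : V), x)) x
      (c.contDiffAt_fderiv_mul (c.mem_dom_zero_left hx)) (by fun_prop)
  exact h.clm_comp contDiffAt_const

theorem hasFDerivAt_fderiv_mul {p : V × V} (hp : p ∈ c.dom) :
    HasFDerivAt (fderiv ℝ c.mul) (fderiv ℝ (fderiv ℝ c.mul) p) p :=
  ((c.contDiffAt_fderiv_mul hp).differentiableAt (by simp)).hasFDerivAt

theorem isSymm_fderiv_mul {p : V × V} (hp : p ∈ c.dom) (v w : V × V) :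
    fderiv ℝ (fderiv ℝ c.mul) p v w = fderiv ℝ (fderiv ℝ c.mul) p w v :=
  ((c.contDiffAt_mul hp).isSymmSndFDerivAt (by
    rw [minSmoothness_of_isRCLikeNormedField]
    exact WithTop.coe_le_coe.2 le_top)).eq v w

theorem fderiv_X_apply {x : V} (hx : x ∈ c.φ.target) (ξ η : V) :
    fderiv ℝ c.X x ξ η = fderiv ℝ (fderiv ℝ c.mul) (x, 0) (ξ, 0) (0, η) := by
  have h : HasFDerivAt (fun x : V => fderiv ℝ c.mul (x, 0)) _ x :=
    (c.hasFDerivAt_fderiv_mul (c.mem_dom_zero_right hx)).comp (f := fun x : V => (x, (0 : V))) x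
      (hasFDerivAt_prodMk_left x 0)
  have h2 := h.clm_comp (hasFDerivAt_const (ContinuousLinearMap.inr ℝ V V) x)
  have h3 : fderiv ℝ c.X x = _ := h2.fderiv
  rw [h3]
  simp

theorem fderiv_R_apply {x : V} (hx : x ∈ c.φ.target) (ξ η : V) :
    fderiv ℝ c.R x ξ η = fderiv ℝ (fderiv ℝ c.mul) (0, x) (0, ξ) (η, 0) := by
  have h : HasFDerivAt (fun x : V => fderiv ℝ c.mul (0, x)) _ x :=
    (c.hasFDerivAt_fderiv_mul (c.mem_dom_zero_left hx)).comp (f := fun x : V => ((0 : V), x)) x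
      (hasFDerivAt_prodMk_right 0 x)
  have h2 := h.clm_comp (hasFDerivAt_const (ContinuousLinearMap.inl ℝ V V) x)
  have h3 : fderiv ℝ c.R x = _ := h2.fderiv
  rw [h3]
  simp

/-- Both sides are the mixed second derivative of the multiplication at the identity. -/
theorem fderiv_R_zero (ξ η : V) : fderiv ℝ c.R 0 ξ η = fderiv ℝ c.X 0 η ξ := by
  rw [c.fderiv_R_apply c.zero_mem, c.fderiv_X_apply c.zero_mem,
    c.isSymm_fderiv_mul (c.mem_dom_zero_left c.zero_mem)]

/-- The commutator of left-invariant vector fields at the identity. -/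
def bracket (ξ η : V) : V := fderiv ℝ c.X 0 ξ η - fderiv ℝ c.X 0 η ξ

/-- The commutator of left-invariant vector fields is left-invariant. -/
theorem X_bracket {x : V} (hx : x ∈ c.φ.target) (ξ η : V) :
    fderiv ℝ c.X x (c.X x ξ) η - fderiv ℝ c.X x (c.X x η) ξ = c.X x (c.bracket ξ η) := by
  -- Left-invariance of the field of `η` is differentiated at the identity in the direction `ξ`. The
  -- term with the second derivative of the multiplication is symmetric in `ξ` and `η`, and cancels
  -- in the commutator.
  have key : ∀ ξ η : V, fderiv ℝ c.X x (c.X x ξ) η =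
      fderiv ℝ (fderiv ℝ c.mul) (x, 0) (0, ξ) (0, η) + c.X x (fderiv ℝ c.X 0 ξ η) := by
    intro ξ η
    have hl : HasFDerivAt (fun y => c.X (c.mul (x, y)) η) _ 0 :=
      (HasFDerivAt.comp (g := c.X) (f := fun y => c.mul (x, y)) 0
        (by rw [c.mul_zero_right hx]
            exact ((c.contDiffAt_X hx).differentiableAt (by simp)).hasFDerivAt)
        (c.hasFDerivAt_X hx)).clm_apply (hasFDerivAt_const η 0)
    have hr1 : HasFDerivAt (fun y : V => fderiv ℝ c.mul (x, y)) _ 0 :=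
      (c.hasFDerivAt_fderiv_mul (c.mem_dom_zero_right hx)).comp (f := fun y : V => (x, y)) 0
        (hasFDerivAt_prodMk_right x 0)
    have hX : HasFDerivAt c.X (fderiv ℝ c.X 0) 0 :=
      ((c.contDiffAt_X c.zero_mem).differentiableAt (by simp)).hasFDerivAt
    have hr : HasFDerivAt (fun y => fderiv ℝ c.mul (x, y) (0, c.X y η)) _ 0 :=
      hr1.clm_apply ((hasFDerivAt_const (0 : V) (0 : V)).prodMk
        (hX.clm_apply (hasFDerivAt_const η 0)))
    have heq : (fun y => c.X (c.mul (x, y)) η) =ᶠ[𝓝 0]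
        fun y => fderiv ℝ c.mul (x, y) (0, c.X y η) := by
      filter_upwards [c.eventually_mem_dom_right hx] with y hy
      rw [c.X_mul hy]; rfl
    have := DFunLike.congr_fun (hl.unique (hr.congr_of_eventuallyEq heq)) ξ
    simp [c.X_zero] at this
    rw [this, add_comm]
    rfl
  rw [key, key, c.isSymm_fderiv_mul (c.mem_dom_zero_right hx), bracket, map_sub]
  abel

end GroupChart

/-! ### The adjoint action and the zero curvature equation -/

namespace GroupChart

variable {G V : Type*} [TopologicalSpace G] [Group G]
  [NormedAddCommGroup V] [NormedSpace ℝ V] (c : GroupChart G V)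

/-- The inverse of the matrix of left-invariant vector fields. -/
def Xinv (x : V) : V →L[ℝ] V := Ring.inverse (c.X x)

/-- The adjoint action of the inverse of the group element with coordinates `x`. -/
def B (x : V) : V →L[ℝ] V := (c.Xinv x).comp (c.R x)

/-- The points of the chart where the left-invariant vector fields are a frame. -/
def reg : Set V := {x | x ∈ c.φ.target ∧ IsUnit (c.X x)}

variable {c}

theorem X_comp_Xinv {x : V} (hx : x ∈ c.reg) : (c.X x).comp (c.Xinv x) = ContinuousLinearMap.id ℝ V :=
  Ring.mul_inverse_cancel _ hx.2

theorem Xinv_comp_X {x : V} (hx : x ∈ c.reg) : (c.Xinv x).comp (c.X x) = ContinuousLinearMap.id ℝ V :=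
  Ring.inverse_mul_cancel _ hx.2

theorem X_Xinv_apply {x : V} (hx : x ∈ c.reg) (v : V) : c.X x (c.Xinv x v) = v :=
  DFunLike.congr_fun (X_comp_Xinv hx) v

theorem Xinv_X_apply {x : V} (hx : x ∈ c.reg) (v : V) : c.Xinv x (c.X x v) = v :=
  DFunLike.congr_fun (Xinv_comp_X hx) v

theorem X_B_apply {x : V} (hx : x ∈ c.reg) (v : V) : c.X x (c.B x v) = c.R x v :=
  X_Xinv_apply hx _

variable [IsTopologicalGroup G]

theorem zero_mem_reg : (0 : V) ∈ c.reg := ⟨c.zero_mem, by rw [c.X_zero]; exact isUnit_one⟩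

theorem Xinv_zero : c.Xinv 0 = ContinuousLinearMap.id ℝ V := by
  rw [Xinv, c.X_zero]; exact Ring.inverse_one _

/-- Right translation by `y` carries the left-invariant field of `v` to that of `Ad(y⁻¹) v`. -/
theorem fderiv_mul_inl_X {x y : V} (h : (x, y) ∈ c.dom) (hy : y ∈ c.reg) (v : V) :
    fderiv ℝ c.mul (x, y) (c.X x v, 0) = c.X (c.mul (x, y)) (c.B y v) := by
  have h1 := DFunLike.congr_fun (c.fderiv_mul_comp_X h) v
  have h2 := DFunLike.congr_fun (c.X_mul h) (c.B y v)
  simp only [ContinuousLinearMap.comp_apply, ContinuousLinearMap.inl_apply,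
    ContinuousLinearMap.inr_apply] at h1 h2
  rw [h1, h2, X_B_apply hy]

/-- The rule `Ad((xy)⁻¹) = Ad(y⁻¹) Ad(x⁻¹)`, from the behaviour of right-invariant fields under
right translation. -/
theorem B_mul {x y : V} (h : (x, y) ∈ c.dom) (hx : x ∈ c.reg) (hy : y ∈ c.reg)
    (hxy : c.mul (x, y) ∈ c.reg) (v : V) : c.B (c.mul (x, y)) v = c.B y (c.B x v) := by
  have h1 := DFunLike.congr_fun (c.R_mul h) v
  simp only [ContinuousLinearMap.comp_apply, ContinuousLinearMap.inl_apply] at h1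
  rw [← X_B_apply hx, fderiv_mul_inl_X h hy, ← X_B_apply hxy] at h1
  have := congrArg (c.Xinv (c.mul (x, y))) h1
  rwa [Xinv_X_apply hxy, Xinv_X_apply hxy] at this

variable [CompleteSpace V]

theorem isOpen_reg : IsOpen c.reg := by
  rw [isOpen_iff_mem_nhds]
  rintro x ⟨hx, hu⟩
  filter_upwards [c.φ.open_target.mem_nhds hx,
    (c.contDiffAt_X hx).continuousAt.eventually_mem (Units.isOpen.mem_nhds hu)] with y h1 h2
  exact ⟨h1, h2⟩

theorem contDiffAt_Xinv {x : V} (hx : x ∈ c.reg) : ContDiffAt ℝ ∞ c.Xinv x := by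
  obtain ⟨u, hu⟩ := hx.2
  have := contDiffAt_ringInverse ℝ u (n := ∞)
  rw [hu] at this
  exact this.comp x (c.contDiffAt_X hx.1)

theorem contDiffAt_B {x : V} (hx : x ∈ c.reg) : ContDiffAt ℝ ∞ c.B x :=
  (contDiffAt_Xinv hx).clm_comp (c.contDiffAt_R hx.1)

theorem hasFDerivAt_B {x : V} (hx : x ∈ c.reg) : HasFDerivAt c.B (fderiv ℝ c.B x) x :=
  ((contDiffAt_B hx).differentiableAt (by simp)).hasFDerivAt

theorem hasFDerivAt_Xinv {x : V} (hx : x ∈ c.reg) : HasFDerivAt c.Xinv (fderiv ℝ c.Xinv x) x :=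
  ((contDiffAt_Xinv hx).differentiableAt (by simp)).hasFDerivAt

theorem fderiv_Xinv_apply {x : V} (hx : x ∈ c.reg) (ξ η : V) :
    fderiv ℝ c.Xinv x ξ η = -c.Xinv x (fderiv ℝ c.X x ξ (c.Xinv x η)) := by
  have hX : HasFDerivAt c.X (fderiv ℝ c.X x) x :=
    ((c.contDiffAt_X hx.1).differentiableAt (by simp)).hasFDerivAt
  have h1 := hX.clm_apply ((hasFDerivAt_Xinv hx).clm_apply (hasFDerivAt_const η x))
  have h2 : HasFDerivAt (fun y => c.X y (c.Xinv y η)) (0 : V →L[ℝ] V) x := by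
    refine (hasFDerivAt_const η x).congr_of_eventuallyEq ?_
    filter_upwards [isOpen_reg.mem_nhds hx] with y hy using X_Xinv_apply hy η
  have := DFunLike.congr_fun (h1.unique h2) ξ
  simp at this
  have h3 := congrArg (c.Xinv x) this
  rw [map_add, Xinv_X_apply hx, map_zero] at h3
  exact eq_neg_of_add_eq_zero_left h3

theorem fderiv_B_zero (ξ η : V) : fderiv ℝ c.B 0 ξ η = c.bracket η ξ := by
  have hR : HasFDerivAt c.R (fderiv ℝ c.R 0) 0 :=
    ((c.contDiffAt_R c.zero_mem).differentiableAt (by simp)).hasFDerivAt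
  have h1 : HasFDerivAt c.B _ 0 := (hasFDerivAt_Xinv zero_mem_reg).clm_comp hR
  rw [h1.fderiv]
  simp [c.R_zero, Xinv_zero, fderiv_Xinv_apply zero_mem_reg, bracket, c.fderiv_R_zero]
  abel

/-- The multiplicativity of the adjoint action reduces the derivative at `x` along a left-invariant
field to the derivative at the identity. -/
theorem fderiv_B_apply {x : V} (hx : x ∈ c.reg) (ξ η : V) :
    fderiv ℝ c.B x (c.X x ξ) η = c.bracket (c.B x η) ξ := by
  rw [← fderiv_B_zero]
  have hl : HasFDerivAt (fun y => c.B (c.mul (x, y)) η) _ 0 :=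
    (HasFDerivAt.comp (g := c.B) (f := fun y => c.mul (x, y)) 0
      (by rw [c.mul_zero_right hx.1]; exact hasFDerivAt_B hx)
      (c.hasFDerivAt_X hx.1)).clm_apply (hasFDerivAt_const η 0)
  have hr : HasFDerivAt (fun y => c.B y (c.B x η)) _ 0 :=
    (hasFDerivAt_B zero_mem_reg).clm_apply (hasFDerivAt_const (c.B x η) 0)
  have heq : (fun y => c.B (c.mul (x, y)) η) =ᶠ[𝓝 0] fun y => c.B y (c.B x η) := by
    have hc : ContinuousAt (fun y => c.mul (x, y)) 0 := (c.hasFDerivAt_X hx.1).continuousAt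
    filter_upwards [c.eventually_mem_dom_right hx.1, (isOpen_reg (c := c)).mem_nhds zero_mem_reg,
      hc.eventually_mem (isOpen_reg.mem_nhds (by rw [c.mul_zero_right hx.1]; exact hx))]
      with y h1 h2 h3 using B_mul h1 hx h2 h3 η
  have := DFunLike.congr_fun (hl.unique (hr.congr_of_eventuallyEq heq)) ξ
  simpa using this

/-- The equation of zero curvature: variations of logarithmic derivatives are infinitesimal gauge
transformations. -/
theorem variation_eq {z : V} (hz : z ∈ c.reg) (e v v' w' : V) :
    fderiv ℝ c.B z v e + fderiv ℝ c.Xinv z v v' + c.Xinv z w' =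
      (fderiv ℝ c.Xinv z v' v + c.Xinv z w') + c.bracket (c.B z e + c.Xinv z v') (c.Xinv z v) := by
  -- The first identity accounts for the adjoint term; the second, the commutator of left-invariant
  -- fields, accounts for the antisymmetric part of the derivative of `Xinv`.
  have h1 := fderiv_B_apply hz (c.Xinv z v) e
  rw [X_Xinv_apply hz] at h1
  have h2 := c.X_bracket hz.1 (c.Xinv z v') (c.Xinv z v)
  rw [X_Xinv_apply hz, X_Xinv_apply hz] at h2
  have h3 := congrArg (c.Xinv z) h2
  rw [map_sub, Xinv_X_apply hz] at h3
  have h4 : c.bracket (c.B z e + c.Xinv z v') (c.Xinv z v) =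
      c.bracket (c.B z e) (c.Xinv z v) + c.bracket (c.Xinv z v') (c.Xinv z v) := by
    simp only [bracket, map_add, add_apply]; abel
  rw [h4, ← h1, ← h3, fderiv_Xinv_apply hz, fderiv_Xinv_apply hz]
  abel

end GroupChart

/-! ### Logarithmic derivatives of paths -/

namespace GroupChart

variable {G V : Type*} [TopologicalSpace G] [Group G]
  [NormedAddCommGroup V] [NormedSpace ℝ V] (c : GroupChart G V)

/-- The path `h` has logarithmic derivative `ξ = h⁻¹ dh` at `t`, within `s`. -/
def HasLogDerivWithinAt (h : ℝ → G) (ξ : V) (s : Set ℝ) (t : ℝ) : Prop :=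
  ContinuousWithinAt h s t ∧ HasDerivWithinAt (fun τ => c.φ ((h t)⁻¹ * h τ)) ξ s t

variable {c} {h ℓ : ℝ → G} {ξ η : V} {s s' : Set ℝ} {t : ℝ}

theorem HasLogDerivWithinAt.const_mul [IsTopologicalGroup G] (H : c.HasLogDerivWithinAt h ξ s t)
    (g : G) : c.HasLogDerivWithinAt (fun τ => g * h τ) ξ s t := by
  refine ⟨continuousWithinAt_const.mul H.1, ?_⟩
  simpa [_root_.mul_assoc] using H.2

theorem HasLogDerivWithinAt.mono (H : c.HasLogDerivWithinAt h ξ s t) (hs : s' ⊆ s) :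
    c.HasLogDerivWithinAt h ξ s' t := ⟨H.1.mono hs, H.2.mono hs⟩

theorem HasLogDerivWithinAt.union (H : c.HasLogDerivWithinAt h ξ s t)
    (H' : c.HasLogDerivWithinAt h ξ s' t) : c.HasLogDerivWithinAt h ξ (s ∪ s') t :=
  ⟨H.1.union H'.1, H.2.union H'.2⟩

theorem HasLogDerivWithinAt.congr (H : c.HasLogDerivWithinAt h ξ s t) (hs : EqOn ℓ h s)
    (ht : ℓ t = h t) : c.HasLogDerivWithinAt ℓ ξ s t :=
  ⟨H.1.congr hs ht, H.2.congr (fun τ hτ => by rw [ht, hs hτ]) (by rw [ht])⟩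

/-- The vacuous case, which allows concatenated paths to be treated through unions of intervals. -/
theorem hasLogDerivWithinAt_of_notMem_closure (ht : t ∉ closure s) :
    c.HasLogDerivWithinAt h ξ s t := by
  refine ⟨?_, (HasFDerivWithinAt.of_notMem_closure ht).congr_fderiv rfl⟩
  rw [ContinuousWithinAt, notMem_closure_iff_nhdsWithin_eq_bot.1 ht]
  exact tendsto_bot

theorem hasDerivWithinAt_mul {x y : ℝ → V} {x' y' : V} (hd : (x t, y t) ∈ c.dom)
    [IsTopologicalGroup G]
    (hx : HasDerivWithinAt x x' s t) (hy : HasDerivWithinAt y y' s t) :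
    HasDerivWithinAt (fun τ => c.mul (x τ, y τ)) (fderiv ℝ c.mul (x t, y t) (x', y')) s t :=
  (c.hasFDerivAt_mul hd).comp_hasDerivWithinAt (f := fun τ => (x τ, y τ)) t (hx.prodMk hy)

variable [IsTopologicalGroup G]

theorem eventually_symm_φ {g : G} (H : ContinuousWithinAt h s t) (hg : g⁻¹ * h t ∈ c.φ.source) :
    ∀ᶠ τ in 𝓝[s] t, g⁻¹ * h τ ∈ c.φ.source :=
  (continuousWithinAt_const.mul H).eventually_mem (c.φ.open_source.mem_nhds hg)

/-- In any translated chart, logarithmic derivatives are given by left-invariant vector fields. -/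
theorem HasLogDerivWithinAt.hasDerivWithinAt (H : c.HasLogDerivWithinAt h ξ s t) {g : G}
    (hg : g⁻¹ * h t ∈ c.φ.source) :
    HasDerivWithinAt (fun τ => c.φ (g⁻¹ * h τ)) (c.X (c.φ (g⁻¹ * h t)) ξ) s t := by
  have h1 := (c.hasFDerivAt_X (c.φ.map_source hg)).congr_fderiv rfl
  have h2 : HasFDerivAt (fun y => c.mul (c.φ (g⁻¹ * h t), y)) (c.X (c.φ (g⁻¹ * h t)))
      (c.φ ((h t)⁻¹ * h t)) := by rw [inv_mul_cancel, c.map_one]; exact h1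
  have h3 := h2.comp_hasDerivWithinAt t H.2
  refine h3.congr_of_eventuallyEq ?_ ?_
  · filter_upwards [eventually_symm_φ H.1 (show (h t)⁻¹ * h t ∈ c.φ.source by
      rw [inv_mul_cancel]; exact c.one_mem)] with τ hτ
    simp only [Function.comp_apply, mul, c.φ.left_inv hg, c.φ.left_inv hτ]
    group
  · simp [mul, c.map_one, c.φ.left_inv hg]

/-- Left division by the point with coordinates `x` is a local inverse of left multiplication by it,
whose derivative `X x` is invertible at regular points. Continuity of the path is a separate
hypothesis, since `φ` carries no information outside its source. -/
theorem hasLogDerivWithinAt_of_hasDerivWithinAt {g : G} {v : V}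
    (hc : ContinuousWithinAt h s t) (hg : g⁻¹ * h t ∈ c.φ.source)
    (hreg : c.φ (g⁻¹ * h t) ∈ c.reg)
    (H : HasDerivWithinAt (fun τ => c.φ (g⁻¹ * h τ)) v s t) :
    c.HasLogDerivWithinAt h (c.Xinv (c.φ (g⁻¹ * h t)) v) s t := by
  refine ⟨hc, ?_⟩
  set x := c.φ (g⁻¹ * h t) with hx
  have hxs : c.φ.symm x = g⁻¹ * h t := c.φ.left_inv hg
  let X' : V ≃L[ℝ] V := ContinuousLinearEquiv.equivOfInverse (c.X x) (c.Xinv x)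
    (Xinv_X_apply hreg) (X_Xinv_apply hreg)
  let n : V → V := fun y => c.φ ((c.φ.symm x)⁻¹ * c.φ.symm y)
  have hnx : n x = 0 := by simp [n, c.map_one]
  have hsx : ContinuousAt c.φ.symm x := c.φ.continuousAt_symm hreg.1
  have hnc' : ContinuousAt (fun y => (c.φ.symm x)⁻¹ * c.φ.symm y) x := continuousAt_const.mul hsx
  have hmem : ∀ᶠ y in 𝓝 x, (c.φ.symm x)⁻¹ * c.φ.symm y ∈ c.φ.source :=
    hnc'.eventually_mem (c.φ.open_source.mem_nhds (by simpa using c.one_mem))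
  have hnc : ContinuousAt n x := by
    refine ContinuousAt.comp (g := c.φ) (c.φ.continuousAt ?_) hnc'
    simpa using c.one_mem
  have hn : HasFDerivAt n (X'.symm : V →L[ℝ] V) x := by
    refine HasFDerivAt.of_local_left_inverse (f := fun y => c.mul (x, y)) hnc ?_ ?_
    · rw [hnx]; exact c.hasFDerivAt_X hreg.1
    · filter_upwards [hmem, c.φ.open_target.mem_nhds hreg.1] with y h1 h2
      simp [n, mul, c.φ.left_inv h1, c.φ.right_inv h2]
  refine (hn.comp_hasDerivWithinAt t H).congr_of_eventuallyEq ?_ ?_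
  · filter_upwards [eventually_symm_φ hc hg] with τ hτ
    simp only [Function.comp_apply, n, hxs, c.φ.left_inv hτ]
    congr 1; group
  · simp only [Function.comp_apply, n, hxs, c.φ.left_inv hg]
    congr 1; group

/-- The product rule for logarithmic derivatives. -/
theorem HasLogDerivWithinAt.mul (H : c.HasLogDerivWithinAt h ξ s t)
    (H' : c.HasLogDerivWithinAt ℓ η s t) (hs : ℓ t ∈ c.φ.source) (hr : c.φ (ℓ t) ∈ c.reg) :
    c.HasLogDerivWithinAt (fun τ => h τ * ℓ τ) (c.B (c.φ (ℓ t)) ξ + η) s t := by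
  have h1 := H'.hasDerivWithinAt (g := 1) (by simpa using hs)
  simp only [inv_one, one_mul] at h1
  have hg : (h t)⁻¹ * (h t * ℓ t) ∈ c.φ.source := by simpa using hs
  have h0 : c.φ ((h t)⁻¹ * h t) = 0 := by simp [c.map_one]
  have h2 := hasDerivWithinAt_mul (c := c) (by rw [h0]; exact c.mem_dom_zero_left hr.1) H.2 h1
  have hsrc := eventually_symm_φ H.1 (show (h t)⁻¹ * h t ∈ c.φ.source by
      rw [inv_mul_cancel]; exact c.one_mem)
  have h3 : HasDerivWithinAt (fun τ => c.φ ((h t)⁻¹ * (h τ * ℓ τ)))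
      (c.X (c.φ (ℓ t)) (c.B (c.φ (ℓ t)) ξ + η)) s t := by
    have h4 := h2.congr_of_eventuallyEq (f₁ := fun τ => c.φ ((h t)⁻¹ * (h τ * ℓ τ))) ?_ ?_
    · refine h4.congr_deriv ?_
      rw [h0, map_add, X_B_apply hr]
      have e1 := DFunLike.congr_fun (c.fderiv_mul_zero_left hr.1) (c.X (c.φ (ℓ t)) η)
      simp only [ContinuousLinearMap.comp_apply, ContinuousLinearMap.inr_apply,
        ContinuousLinearMap.id_apply] at e1
      rw [show ((ξ, c.X (c.φ (ℓ t)) η) : V × V) = (ξ, 0) + (0, c.X (c.φ (ℓ t)) η) by simp, map_add,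
        e1]
      rfl
    · have hℓ : ∀ᶠ τ in 𝓝[s] t, ℓ τ ∈ c.φ.source :=
        H'.1.eventually_mem (c.φ.open_source.mem_nhds hs)
      filter_upwards [hsrc, hℓ] with τ h5 h6
      simp only [GroupChart.mul, c.φ.left_inv h5, c.φ.left_inv h6, _root_.mul_assoc]
    · simp [GroupChart.mul, c.map_one, c.φ.left_inv hs]
  have h5 := hasLogDerivWithinAt_of_hasDerivWithinAt (h := fun τ => h τ * ℓ τ) (H.1.mul H'.1) hg
    (by simpa using hr) h3
  simp only [inv_mul_cancel_left, Xinv_X_apply hr] at h5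
  exact h5

end GroupChart

/-! ### Developments: uniqueness and existence -/

namespace GroupChart

variable {G V : Type*} [TopologicalSpace G] [Group G]
  [NormedAddCommGroup V] [NormedSpace ℝ V] {c : GroupChart G V}
  {h ℓ : ℝ → G} {ξ η : V} {s s' : Set ℝ} {t : ℝ}

variable (c) in
/-- The inversion in the chart. -/
def inv (x : V) : V := c.φ (c.φ.symm x)⁻¹

theorem inv_zero : c.inv 0 = 0 := by simp [inv, c.map_one]

variable (c) in
/-- The path `h`, starting at the identity, has logarithmic derivative `ε` on `[a, b]`. -/
def IsDevelopment (a b : ℝ) (ε : ℝ → V) (h : ℝ → G) : Prop :=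
  h a = 1 ∧ ∀ t ∈ Icc a b, c.HasLogDerivWithinAt h (ε t) (Icc a b) t

variable {a b : ℝ} {ε : ℝ → V}

theorem IsDevelopment.continuousOn (H : c.IsDevelopment a b ε h) : ContinuousOn h (Icc a b) :=
  fun t ht => (H.2 t ht).1

variable [IsTopologicalGroup G]

theorem isOpen_dom_inv : IsOpen {x | x ∈ c.φ.target ∧ (c.φ.symm x)⁻¹ ∈ c.φ.source} :=
  (c.φ.continuousOn_symm.inv).isOpen_inter_preimage c.φ.open_target c.φ.open_source

theorem contDiffAt_inv {x : V} (hx : x ∈ c.φ.target) (hx' : (c.φ.symm x)⁻¹ ∈ c.φ.source) :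
    ContDiffAt ℝ ∞ c.inv x :=
  c.contDiffOn_inv.contDiffAt (isOpen_dom_inv.mem_nhds ⟨hx, hx'⟩)

theorem contDiffAt_inv_zero : ContDiffAt ℝ ∞ c.inv 0 :=
  contDiffAt_inv c.zero_mem (by simpa using c.one_mem)

/-- The identity `x x⁻¹ = 1` is differentiated at the identity. -/
theorem hasFDerivAt_inv_zero : HasFDerivAt c.inv (-ContinuousLinearMap.id ℝ V) 0 := by
  have h : HasFDerivAt c.inv (fderiv ℝ c.inv 0) 0 :=
    (contDiffAt_inv_zero.differentiableAt (by simp)).hasFDerivAt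
  have h1 : HasFDerivAt (fun x => c.mul (x, c.inv x)) _ 0 :=
    HasFDerivAt.comp (g := c.mul) (f := fun x => (x, c.inv x)) 0
      (c.hasFDerivAt_mul (by rw [inv_zero]; exact c.mem_dom_zero_right c.zero_mem))
      ((hasFDerivAt_id (𝕜 := ℝ) (0 : V)).prodMk h)
  have h2 : HasFDerivAt (fun x => c.mul (x, c.inv x)) (0 : V →L[ℝ] V) 0 := by
    refine (hasFDerivAt_const (0 : V) (0 : V)).congr_of_eventuallyEq ?_
    filter_upwards [isOpen_dom_inv.mem_nhds
      (show (0 : V) ∈ {x | x ∈ c.φ.target ∧ (c.φ.symm x)⁻¹ ∈ c.φ.source} from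
        ⟨c.zero_mem, by simpa using c.one_mem⟩)] with x hx
    simp [mul, inv, c.φ.left_inv hx.2, c.map_one]
  refine (h.congr_fderiv ?_)
  ext v
  have := DFunLike.congr_fun (h1.unique h2) v
  simp only [ContinuousLinearMap.comp_apply, ContinuousLinearMap.prod_apply,
    ContinuousLinearMap.id_apply, zero_apply, inv_zero] at this
  have e1 := DFunLike.congr_fun (c.fderiv_mul_zero_left c.zero_mem) (fderiv ℝ c.inv 0 v)
  have e2 := DFunLike.congr_fun (c.fderiv_mul_zero_right c.zero_mem) v
  simp only [ContinuousLinearMap.comp_apply, ContinuousLinearMap.inr_apply,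
    ContinuousLinearMap.inl_apply, ContinuousLinearMap.id_apply] at e1 e2
  rw [show ((v, fderiv ℝ c.inv 0 v) : V × V) = (v, 0) + (0, fderiv ℝ c.inv 0 v) by simp, map_add,
    e1, e2] at this
  simpa using eq_neg_of_add_eq_zero_right this

/-- With `w = h(t)⁻¹ ℓ(t)`, the quotient at `τ` is `(h(t)⁻¹ h(τ))⁻¹ · w · (ℓ(t)⁻¹ ℓ(τ))`. The outer
factors are near the identity, so inversion is differentiated only there. -/
theorem HasLogDerivWithinAt.inv_mul [CompleteSpace V] (H : c.HasLogDerivWithinAt h ξ s t)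
    (H' : c.HasLogDerivWithinAt ℓ η s t) (hs : (h t)⁻¹ * ℓ t ∈ c.φ.source)
    (hr : c.φ ((h t)⁻¹ * ℓ t) ∈ c.reg) :
    HasDerivWithinAt (fun τ => c.φ ((h τ)⁻¹ * ℓ τ))
      (c.X (c.φ ((h t)⁻¹ * ℓ t)) (η - c.B (c.φ ((h t)⁻¹ * ℓ t)) ξ)) s t := by
  set w := c.φ ((h t)⁻¹ * ℓ t) with hw
  have h0 : c.φ ((h t)⁻¹ * h t) = 0 := by simp [c.map_one]
  have h0' : c.φ ((ℓ t)⁻¹ * ℓ t) = 0 := by simp [c.map_one]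
  have hi : HasDerivWithinAt (fun τ => c.inv (c.φ ((h t)⁻¹ * h τ))) (-ξ) s t := by
    have := (h0.symm ▸ hasFDerivAt_inv_zero : HasFDerivAt c.inv (-ContinuousLinearMap.id ℝ V)
      (c.φ ((h t)⁻¹ * h t))).comp_hasDerivWithinAt t H.2
    simpa [Function.comp_def] using this
  have hi0 : c.inv (c.φ ((h t)⁻¹ * h t)) = 0 := by rw [h0, inv_zero]
  have h1 : HasDerivWithinAt (fun τ => c.mul (c.inv (c.φ ((h t)⁻¹ * h τ)), w)) (-c.R w ξ) s t := by
    refine (hasDerivWithinAt_mul (c := c) (by rw [hi0]; exact c.mem_dom_zero_left hr.1) hi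
      (hasDerivWithinAt_const t s w)).congr_deriv ?_
    rw [hi0, ← map_neg]
    rfl
  have h2 := hasDerivWithinAt_mul (c := c)
    (by rw [hi0, h0', c.mul_zero_left hr.1]; exact c.mem_dom_zero_right hr.1) h1 H'.2
  rw [hi0, h0', c.mul_zero_left hr.1] at h2
  have hval : fderiv ℝ c.mul (w, 0) (-c.R w ξ, η) = c.X w (η - c.B w ξ) := by
    have e2 := DFunLike.congr_fun (c.fderiv_mul_zero_right hr.1) (-c.R w ξ)
    simp only [ContinuousLinearMap.comp_apply, ContinuousLinearMap.inl_apply,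
      ContinuousLinearMap.id_apply] at e2
    rw [show ((-c.R w ξ, η) : V × V) = (-c.R w ξ, 0) + (0, η) by simp, map_add, e2, map_sub,
      X_B_apply hr]
    change -c.R w ξ + c.X w η = _
    abel
  rw [hval] at h2
  refine h2.congr_of_eventuallyEq ?_ ?_
  · have e1 := eventually_symm_φ (c := c) H.1 (show (h t)⁻¹ * h t ∈ c.φ.source by
      rw [inv_mul_cancel]; exact c.one_mem)
    have e2 := eventually_symm_φ (c := c) H'.1 (show (ℓ t)⁻¹ * ℓ t ∈ c.φ.source by
      rw [inv_mul_cancel]; exact c.one_mem)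
    have e3 : ∀ᶠ τ in 𝓝[s] t, ((h t)⁻¹ * h τ)⁻¹ ∈ c.φ.source :=
      (continuousWithinAt_const.mul H.1).inv.eventually_mem
        (c.φ.open_source.mem_nhds (by simpa using c.one_mem))
    have e4 : ∀ᶠ τ in 𝓝[s] t, ((h t)⁻¹ * h τ)⁻¹ * ((h t)⁻¹ * ℓ t) ∈ c.φ.source :=
      ((continuousWithinAt_const.mul H.1).inv.mul continuousWithinAt_const).eventually_mem
        (c.φ.open_source.mem_nhds (by simpa using hs))
    filter_upwards [e1, e2, e3, e4] with τ h1 h2 h3 h4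
    have e5 : c.φ.symm (c.inv (c.φ ((h t)⁻¹ * h τ))) = ((h t)⁻¹ * h τ)⁻¹ := by
      rw [inv, c.φ.left_inv h1, c.φ.left_inv h3]
    have e6 : c.φ.symm (c.mul (c.inv (c.φ ((h t)⁻¹ * h τ)), w)) =
        ((h t)⁻¹ * h τ)⁻¹ * ((h t)⁻¹ * ℓ t) := by
      simp only [GroupChart.mul]
      rw [e5, hw, c.φ.left_inv hs, c.φ.left_inv h4]
    rw [GroupChart.mul]
    simp only
    rw [e6, c.φ.left_inv h2]
    congr 1; group
  · rw [hi0, h0', c.mul_zero_left hr.1, c.mul_zero_right hr.1]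

/-- The second path is translated on the left by the endpoint of the first, which does not change
its logarithmic derivative. -/
theorem IsDevelopment.exists_trans {d : ℝ} (hab : a ≤ b) (hbd : b ≤ d)
    (H : c.IsDevelopment a b ε h) (H' : c.IsDevelopment b d ε ℓ) :
    ∃ h', c.IsDevelopment a d ε h' := by
  classical
  let f : ℝ → G := fun t => if t ≤ b then h t else h b * ℓ t
  have h1 : EqOn f h (Icc a b) := fun t ht => if_pos ht.2
  have h2 : EqOn f (fun t => h b * ℓ t) (Icc b d) := by
    intro t ht
    by_cases htb : t ≤ b
    · obtain rfl : t = b := le_antisymm htb ht.1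
      simp [f, H'.1]
    · exact if_neg htb
  refine ⟨f, (h1 ⟨le_rfl, hab⟩).trans H.1, fun t ht => ?_⟩
  rw [← Icc_union_Icc_eq_Icc hab hbd]
  refine HasLogDerivWithinAt.union ?_ ?_
  · by_cases htb : t ∈ Icc a b
    · exact (H.2 t htb).congr h1 (h1 htb)
    · exact hasLogDerivWithinAt_of_notMem_closure (by rwa [isClosed_Icc.closure_eq])
  · by_cases htb : t ∈ Icc b d
    · exact ((H'.2 t htb).const_mul (h b)).congr h2 (h2 htb)
    · exact hasLogDerivWithinAt_of_notMem_closure (by rwa [isClosed_Icc.closure_eq])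

variable [CompleteSpace V]

variable (c) in
theorem exists_lipschitz_ball : ∃ r > 0, ∃ K M : ℝ≥0, Metric.closedBall (0 : V) r ⊆ c.reg ∧
    LipschitzOnWith K c.X (Metric.closedBall 0 r) ∧ ∀ y ∈ Metric.closedBall (0 : V) r, ‖c.X y‖ ≤ M := by
  obtain ⟨K, t, ht, hK⟩ := ((c.contDiffAt_X c.zero_mem).of_le
    (WithTop.coe_le_coe.2 le_top : ((1 : ℕ∞) : WithTop ℕ∞) ≤ ∞)).exists_lipschitzOnWith
  have hM : ∀ᶠ y in 𝓝 (0 : V), ‖c.X y‖ < ‖c.X 0‖ + 1 :=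
    ((c.contDiffAt_X c.zero_mem).continuousAt.norm).eventually_lt_const (lt_add_one _)
  obtain ⟨r, hr, hsub⟩ := Metric.nhds_basis_closedBall.mem_iff.1
    (inter_mem (inter_mem ht ((isOpen_reg (c := c)).mem_nhds zero_mem_reg)) hM)
  exact ⟨r, hr, K, ⟨‖c.X 0‖ + 1, by positivity⟩, fun y hy => (hsub hy).1.2,
    hK.mono fun y hy => (hsub hy).1.1, fun y hy => (hsub hy).2.le⟩

/-- Uniqueness of developments. -/
theorem IsDevelopment.eqOn [T2Space G] (H : c.IsDevelopment a b ε h) (H' : c.IsDevelopment a b ε ℓ)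
    (hε : ∃ A : ℝ≥0, ∀ t, ‖ε t‖ ≤ A) : EqOn h ℓ (Icc a b) := by
  obtain ⟨A, hA⟩ := hε
  obtain ⟨r, hr, K, M, hreg, hK, -⟩ := c.exists_lipschitz_ball
  have hcl : IsClosed ({t | h t = ℓ t} ∩ Icc a b) := by
    have := (H.continuousOn.prodMk H'.continuousOn).preimage_isClosed_of_isClosed isClosed_Icc
      isClosed_diagonal
    convert this using 1
    ext t; simp [and_comm]
  -- The set of agreement is closed. It extends to the right of each of its points `t`: translated
  -- by `h(t)⁻¹`, both paths start at 0 in the chart and solve the same Lipschitz differential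
  -- equation for a short time.
  refine hcl.Icc_subset_of_forall_exists_gt (H.1.trans H'.1.symm) fun t ht y hy => ?_
  have htab : t ∈ Icc a b := ⟨ht.2.1, ht.2.2.le⟩
  have hU : ∀ᶠ x in 𝓝 (1 : G), x ∈ c.φ.source ∧ c.φ x ∈ Metric.closedBall (0 : V) r := by
    refine (c.φ.open_source.eventually_mem c.one_mem).and ?_
    refine (c.φ.continuousAt c.one_mem).eventually_mem ?_
    rw [c.map_one]; exact Metric.closedBall_mem_nhds _ hr
  have near : ∀ f : ℝ → G, c.IsDevelopment a b ε f → f t = h t → ∀ᶠ τ in 𝓝[Icc a b] t,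
      (h t)⁻¹ * f τ ∈ c.φ.source ∧ c.φ ((h t)⁻¹ * f τ) ∈ Metric.closedBall (0 : V) r := by
    intro f hf hft
    have : ContinuousWithinAt (fun τ => (h t)⁻¹ * f τ) (Icc a b) t :=
      continuousWithinAt_const.mul (hf.2 t htab).1
    rw [ContinuousWithinAt, hft, inv_mul_cancel] at this
    exact this.eventually hU
  have hnear := (near h H rfl).and (near ℓ H' ht.1.symm)
  rw [eventually_nhdsWithin_iff, Metric.eventually_nhds_iff] at hnear
  obtain ⟨δ, hδ, hnear⟩ := hnear
  obtain ⟨d, hd1, hd2⟩ := exists_between (lt_min hy (lt_min ht.2.2 (lt_add_of_pos_right t hδ)))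
  have hdab : Icc t d ⊆ Icc a b := fun τ hτ => ⟨ht.2.1.trans hτ.1,
    hτ.2.trans (hd2.le.trans ((min_le_right _ _).trans (min_le_left _ _)))⟩
  have hmem : ∀ τ ∈ Icc t d, _ := fun τ hτ => hnear (y := τ) (by
    rw [Real.dist_eq, abs_of_nonneg (by linarith [hτ.1])]
    have := hd2.trans_le ((min_le_right _ _).trans (min_le_right _ _))
    linarith [hτ.2]) (hdab hτ)
  have hder : ∀ f : ℝ → G, c.IsDevelopment a b ε f → (∀ τ ∈ Icc t d, (h t)⁻¹ * f τ ∈ c.φ.source) →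
      ∀ τ ∈ Icc t d, HasDerivWithinAt (fun τ => c.φ ((h t)⁻¹ * f τ))
        (c.X (c.φ ((h t)⁻¹ * f τ)) (ε τ)) (Icc t d) τ := fun f hf hs τ hτ =>
    ((hf.2 τ (hdab hτ)).hasDerivWithinAt (hs τ hτ)).mono hdab
  have h1 := hder h H fun τ hτ => (hmem τ hτ).1.1
  have h2 := hder ℓ H' fun τ hτ => (hmem τ hτ).2.1
  have hmono : ∀ τ ∈ Ico t d, Icc t d ∈ 𝓝[Ici τ] τ := fun τ hτ => Icc_mem_nhdsGE_of_mem hτ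
  have := dist_le_of_trajectories_ODE_of_mem (v := fun τ y => c.X y (ε τ)) (K := K * A) (δ := 0)
    (s := fun _ => Metric.closedBall (0 : V) r)
    (f := fun τ => c.φ ((h t)⁻¹ * h τ)) (g := fun τ => c.φ ((h t)⁻¹ * ℓ τ)) (a := t) (b := d)
    (fun τ _ => ?_) (fun τ hτ => (h1 τ hτ).continuousWithinAt)
    (fun τ hτ => (h1 τ (Ico_subset_Icc_self hτ)).mono_of_mem_nhdsWithin (hmono τ hτ))
    (fun τ hτ => (hmem τ (Ico_subset_Icc_self hτ)).1.2)
    (fun τ hτ => (h2 τ hτ).continuousWithinAt)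
    (fun τ hτ => (h2 τ (Ico_subset_Icc_self hτ)).mono_of_mem_nhdsWithin (hmono τ hτ))
    (fun τ hτ => (hmem τ (Ico_subset_Icc_self hτ)).2.2) (by rw [ht.1, dist_self])
  · refine ⟨d, ?_, hd1, hd2.le.trans (min_le_left _ _)⟩
    have h3 := this d ⟨hd1.le, le_rfl⟩
    rw [zero_mul] at h3
    have h4 := dist_le_zero.1 h3
    have h5 := c.φ.injOn (hmem d ⟨hd1.le, le_rfl⟩).1.1 (hmem d ⟨hd1.le, le_rfl⟩).2.1 h4
    exact mul_left_cancel h5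
  · refine LipschitzOnWith.of_dist_le_mul fun x hx y hy => ?_
    rw [dist_eq_norm, ← sub_apply]
    refine ((c.X x - c.X y).le_opNorm _).trans ?_
    rw [← dist_eq_norm, NNReal.coe_mul, mul_right_comm]
    exact mul_le_mul (hK.dist_le_mul x hx y hy) (hA τ) (norm_nonneg _) (by positivity)

/-- Solutions given by the Picard-Lindelöf theorem stay in the ball. -/
theorem _root_.IsPicardLindelof.exists_hasDerivWithinAt_mem_closedBall {E : Type*}
    [NormedAddCommGroup E] [NormedSpace ℝ E] [CompleteSpace E] {f : ℝ → E → E} {tmin tmax : ℝ}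
    {t₀ : Icc tmin tmax} {x₀ x : E} {a r L K : ℝ≥0} (hf : IsPicardLindelof f t₀ x₀ a r L K)
    (hx : x ∈ Metric.closedBall x₀ r) :
    ∃ α : ℝ → E, α t₀ = x ∧ (∀ t, α t ∈ Metric.closedBall x₀ a) ∧
      ∀ t ∈ Icc tmin tmax, HasDerivWithinAt α (f t (α t)) (Icc tmin tmax) t := by
  obtain ⟨α, hα⟩ := ODE.FunSpace.exists_isFixedPt_next hf hx
  refine ⟨α.compProj, by rw [ODE.FunSpace.compProj_val, ← hα, ODE.FunSpace.next_apply₀],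
    fun t => α.compProj_mem_closedBall hf.mul_max_le, fun t ht ↦ ?_⟩
  apply ODE.hasDerivWithinAt_picard_Icc t₀.2 hf.continuousOn_uncurry
    α.continuous_compProj.continuousOn (fun _ ht' ↦ α.compProj_mem_closedBall hf.mul_max_le)
    x ht |>.congr_of_mem _ ht
  intro t' ht'
  nth_rw 1 [← hα]
  rw [ODE.FunSpace.compProj_of_mem ht', ODE.FunSpace.next_apply]

/-- The length `d` does not depend on the initial time, because the bounds on `ε` and on the
invariant fields near the identity do not. Hence finitely many steps cover any interval. -/
theorem exists_local_development (hc : Continuous ε) (hε : ∃ A : ℝ≥0, ∀ t, ‖ε t‖ ≤ A) :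
    ∃ d > 0, ∀ t₀, ∃ h : ℝ → G, c.IsDevelopment t₀ (t₀ + d) ε h := by
  obtain ⟨A, hA⟩ := hε
  obtain ⟨r, hr, K, M, hreg, hK, hM⟩ := c.exists_lipschitz_ball
  have hMA : (0 : ℝ) < M * A + 1 := by positivity
  refine ⟨r / (M * A + 1), by positivity, fun t₀ => ?_⟩
  -- The summand 1 keeps the denominator positive; over this length the solution cannot leave the
  -- ball of radius `r`.
  set d := r / (M * A + 1) with hd
  have hd0 : 0 < d := by positivity
  have hPL : IsPicardLindelof (fun τ y => c.X y (ε τ)) (tmin := t₀) (tmax := t₀ + d)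
      ⟨t₀, le_rfl, by linarith⟩ (0 : V) ⟨r, hr.le⟩ 0 (M * A) (K * A) := by
    constructor
    · intro τ _
      refine LipschitzOnWith.of_dist_le_mul fun x hx y hy => ?_
      rw [dist_eq_norm, ← sub_apply]
      refine ((c.X x - c.X y).le_opNorm _).trans ?_
      rw [← dist_eq_norm, NNReal.coe_mul, mul_right_comm]
      exact mul_le_mul (hK.dist_le_mul x hx y hy) (hA τ) (norm_nonneg _) (by positivity)
    · intro x _
      exact ((c.X x).continuous.comp hc).continuousOn
    · intro τ _ x hx
      exact ((c.X x).le_opNorm _).trans (mul_le_mul (hM x hx) (hA τ) (norm_nonneg _) M.2)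
    · have : (M * A : ℝ) * d ≤ r := by
        rw [hd, mul_div_assoc', div_le_iff₀ hMA]; nlinarith
      simpa [hd0.le] using! this
  obtain ⟨y, hy0, hyb, hy⟩ := hPL.exists_hasDerivWithinAt_mem_closedBall
    (x := 0) (Metric.mem_closedBall_self le_rfl)
  have hyr : ∀ t, y t ∈ c.reg := fun t => hreg (hyb t)
  refine ⟨fun t => c.φ.symm (y t), ?_, fun t ht => ?_⟩
  · simp only at hy0 ⊢; rw [hy0, c.symm_zero]
  · have hcont : ContinuousWithinAt (fun t => c.φ.symm (y t)) (Icc t₀ (t₀ + d)) t :=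
      (c.φ.continuousAt_symm (hyr t).1).comp_continuousWithinAt (hy t ht).continuousWithinAt
    have e : ∀ τ, c.φ ((1 : G)⁻¹ * c.φ.symm (y τ)) = y τ := fun τ => by
      rw [inv_one, one_mul, c.φ.right_inv (hyr τ).1]
    have := hasLogDerivWithinAt_of_hasDerivWithinAt (c := c) (h := fun t => c.φ.symm (y t)) (g := 1)
      (v := c.X (y t) (ε t)) hcont
      (by rw [inv_one, one_mul]; exact c.φ.map_target (hyr t).1)
      (by simp only [e]; exact hyr t) (by simp only [e]; exact hy t ht)
    simp only [e] at this
    rwa [Xinv_X_apply (hyr t)] at this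

variable (c) in
/-- Existence of developments. -/
theorem exists_isDevelopment (a b : ℝ) (hc : Continuous ε) (hε : ∃ A : ℝ≥0, ∀ t, ‖ε t‖ ≤ A) :
    ∃ h : ℝ → G, c.IsDevelopment a b ε h := by
  obtain ⟨d, hd, hloc⟩ := exists_local_development (c := c) hc hε
  have key : ∀ m : ℕ, ∃ h : ℝ → G, c.IsDevelopment a (a + (m + 1) * d) ε h := by
    intro m
    induction m with
    | zero => simpa using hloc a
    | succ m ih =>
      obtain ⟨h, hh⟩ := ih
      obtain ⟨ℓ, hℓ⟩ := hloc (a + (m + 1) * d)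
      have e : a + (m + 1) * d + d = a + ((m + 1 : ℕ) + 1) * d := by push_cast; ring
      rw [← e]
      exact hh.exists_trans (by have : 0 ≤ (m + 1) * d := by positivity
                                linarith) (by linarith) hℓ
  obtain ⟨m, hm⟩ := exists_nat_gt ((b - a) / d)
  obtain ⟨h, hh⟩ := key m
  rw [div_lt_iff₀ hd] at hm
  have hsub : Icc a b ⊆ Icc a (a + (m + 1) * d) := Icc_subset_Icc_right (by nlinarith)
  exact ⟨h, hh.1, fun t ht => (hh.2 t (hsub ht)).mono hsub⟩

end GroupChart

/-! ### Differentiable families in spaces of continuous functions -/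

section ContinuousFamily

variable {K F W : Type*} [TopologicalSpace K] [CompactSpace K] [NormedAddCommGroup F]
  [NormedSpace ℝ F] [NormedAddCommGroup W] [NormedSpace ℝ W]

/-- Continuous families of linear maps act on vectors pointwise. -/
def ContinuousMap.applyCLM : C(K, F →L[ℝ] W) →L[ℝ] F →L[ℝ] C(K, W) :=
  LinearMap.mkContinuous₂
    (LinearMap.mk₂ ℝ (fun (f : C(K, F →L[ℝ] W)) (v : F) => (⟨fun t => f t v, by fun_prop⟩ : C(K, W)))
      (fun _ _ _ => rfl) (fun _ _ _ => rfl)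
      (fun f v w => by ext t; exact map_add (f t) v w)
      (fun r f v => by ext t; exact map_smul (f t) r v))
    1 fun f v => by
      refine (ContinuousMap.norm_le _ (by positivity)).2 fun t => ?_
      rw [one_mul]
      exact ((f t).le_opNorm v).trans (by gcongr; exact f.norm_coe_le_norm t)

@[simp] theorem ContinuousMap.applyCLM_apply (f : C(K, F →L[ℝ] W)) (v : F) (t : K) :
    ContinuousMap.applyCLM f v t = f t v := rfl

open Classical in
/-- The function `f` as a continuous map, if it is continuous. -/
def ContinuousMap.ofFun {W : Type*} [TopologicalSpace W] [Zero W] (f : K → W) : C(K, W) :=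
  if h : Continuous f then ⟨f, h⟩ else 0

omit [CompactSpace K] in
theorem ContinuousMap.ofFun_apply {W : Type*} [TopologicalSpace W] [Zero W] {f : K → W}
    (h : Continuous f) (t : K) : ContinuousMap.ofFun f t = f t := by
  rw [ContinuousMap.ofFun, dif_pos h]; rfl

omit [CompactSpace K] in
theorem continuousOn_ofFun {P W : Type*} [TopologicalSpace P] [TopologicalSpace W] [Zero W]
    {O : Set P} {f : P → K → W} (hf : ContinuousOn (Function.uncurry f) (O ×ˢ univ)) :
    (∀ p ∈ O, Continuous (f p)) ∧ ContinuousOn (fun p => ContinuousMap.ofFun (f p)) O := by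
  have h1 : ∀ p ∈ O, Continuous (f p) := fun p hp =>
    hf.comp_continuous (f := fun t => (p, t)) (by fun_prop) fun t => ⟨hp, mem_univ _⟩
  refine ⟨h1, ?_⟩
  have h2 : Continuous fun q : O × K => f q.1 q.2 :=
    hf.comp_continuous (f := fun q : O × K => ((q.1 : P), q.2)) (by fun_prop)
      fun q => ⟨q.1.2, mem_univ _⟩
  rw [continuousOn_iff_continuous_domRestrict]
  convert (ContinuousMap.curry ⟨_, h2⟩).continuous using 1
  ext p t
  exact ContinuousMap.ofFun_apply (h1 p p.2) t

theorem eventually_forall_norm_sub_lt {P E : Type*} [TopologicalSpace P] [NormedAddCommGroup E] {O : Set P}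
    (hO : IsOpen O) {f : P → K → E} (hf : ContinuousOn (Function.uncurry f) (O ×ˢ univ)) {p : P}
    (hp : p ∈ O) {ε : ℝ} (hε : 0 < ε) : ∀ᶠ q in 𝓝 p, q ∈ O ∧ ∀ t, ‖f q t - f p t‖ < ε := by
  obtain ⟨h1, h2⟩ := continuousOn_ofFun hf
  have h3 := (tendsto_iff_norm_sub_tendsto_zero.1
    (h2.continuousAt (hO.mem_nhds hp))).eventually_lt_const hε
  filter_upwards [hO.eventually_mem hp, h3] with q hq h
  refine ⟨hq, fun t => lt_of_le_of_lt ?_ h⟩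
  have := (ContinuousMap.ofFun (f q) - ContinuousMap.ofFun (f p)).norm_coe_le_norm t
  rwa [ContinuousMap.sub_apply, ContinuousMap.ofFun_apply (h1 p hp),
    ContinuousMap.ofFun_apply (h1 q hq)] at this

/-- A family of continuous functions that is pointwise continuously differentiable in the parameter,
locally uniformly, is continuously differentiable. -/
theorem contDiffOn_ofFun {O : Set F} (hO : IsOpen O) {f : F → K → W} {f' : F → K → F →L[ℝ] W}
    (hf : ContinuousOn (Function.uncurry f) (O ×ˢ univ))
    (hf' : ContinuousOn (Function.uncurry f') (O ×ˢ univ))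
    (hd : ∀ p ∈ O, ∀ t, HasFDerivAt (fun p => f p t) (f' p t) p) :
    ContDiffOn ℝ 1 (fun p => ContinuousMap.ofFun (f p)) O ∧
      ∀ p ∈ O, ∀ v t, fderiv ℝ (fun p => ContinuousMap.ofFun (f p)) p v t = f' p t v := by
  obtain ⟨h1, -⟩ := continuousOn_ofFun hf
  obtain ⟨h1', h2'⟩ := continuousOn_ofFun hf'
  have key : ∀ p ∈ O, HasFDerivAt (fun p => ContinuousMap.ofFun (f p))
      (ContinuousMap.applyCLM (ContinuousMap.ofFun (f' p))) p := by
    intro p hp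
    rw [hasFDerivAt_iff_isLittleO, Asymptotics.isLittleO_iff]
    intro ε hε
    -- By compactness the derivatives near `p` are close to those at `p` uniformly in `t`; the mean
    -- value inequality, applied for each `t`, is then a bound in the supremum norm.
    obtain ⟨δ, hδ, hball⟩ := Metric.eventually_nhds_iff_ball.1 (eventually_forall_norm_sub_lt hO hf' hp hε)
    filter_upwards [Metric.ball_mem_nhds p hδ] with q hq
    refine (ContinuousMap.norm_le _ (by positivity)).2 fun t => ?_
    simp only [ContinuousMap.sub_apply, ContinuousMap.applyCLM_apply,
      ContinuousMap.ofFun_apply (h1 p hp), ContinuousMap.ofFun_apply (h1 q (hball q hq).1),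
      ContinuousMap.ofFun_apply (h1' p hp)]
    refine (convex_ball p δ).norm_image_sub_le_of_norm_hasFDerivWithin_le' (f := fun p => f p t)
      (fun w hw => (hd w (hball w hw).1 t).hasFDerivWithinAt) (fun w hw => ?_)
      (Metric.mem_ball_self hδ) hq
    exact ((hball w hw).2 t).le
  refine ⟨?_, fun p hp v t => ?_⟩
  · rw [← zero_add (1 : WithTop ℕ∞), contDiffOn_succ_iff_fderiv_of_isOpen hO]
    refine ⟨fun p hp => (key p hp).differentiableAt.differentiableWithinAt, by simp,
      contDiffOn_zero.2 ?_⟩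
    exact (ContinuousMap.applyCLM.continuous.comp_continuousOn h2').congr
      fun p hp => (key p hp).fderiv
  · rw [(key p hp).fderiv, ContinuousMap.applyCLM_apply, ContinuousMap.ofFun_apply (h1' p hp)]

end ContinuousFamily

/-! ### Variations of developments -/

namespace GroupChart

variable {G V : Type*} [TopologicalSpace G] [Group G] [IsTopologicalGroup G]
  [NormedAddCommGroup V] [NormedSpace ℝ V] {c : GroupChart G V}
  {a b : ℝ} {F : Type*} [NormedAddCommGroup F] [NormedSpace ℝ F]

/-- Logarithmic derivatives of paths given in the chart. -/
theorem hasLogDerivWithinAt_symm {y : ℝ → V} {y' : V} {s : Set ℝ} {t : ℝ} (hr : y t ∈ c.reg)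
    (hs : ∀ᶠ τ in 𝓝[s] t, y τ ∈ c.φ.target)
    (hy : HasDerivWithinAt y y' s t) :
    c.HasLogDerivWithinAt (fun τ => c.φ.symm (y τ)) (c.Xinv (y t) y') s t := by
  have hcont : ContinuousWithinAt (fun t => c.φ.symm (y t)) s t :=
    (c.φ.continuousAt_symm hr.1).comp_continuousWithinAt hy.continuousWithinAt
  have et : c.φ ((1 : G)⁻¹ * c.φ.symm (y t)) = y t := by
    rw [inv_one, one_mul, c.φ.right_inv hr.1]
  have := hasLogDerivWithinAt_of_hasDerivWithinAt (c := c) (h := fun t => c.φ.symm (y t)) (g := 1)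
    (v := y') hcont (by rw [inv_one, one_mul]; exact c.φ.map_target hr.1)
    (by rw [et]; exact hr) (hy.congr_of_eventuallyEq (by
      filter_upwards [hs] with τ hτ
      rw [inv_one, one_mul, c.φ.right_inv hτ]) et)
  simpa only [et] using this

theorem HasLogDerivWithinAt.mul_symm {h : ℝ → G} {ξ : V} {y : ℝ → V} {y' : V} {s : Set ℝ} {t : ℝ}
    (H : c.HasLogDerivWithinAt h ξ s t) (hr : y t ∈ c.reg)
    (hs : ∀ᶠ τ in 𝓝[s] t, y τ ∈ c.φ.target) (hy : HasDerivWithinAt y y' s t) :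
    c.HasLogDerivWithinAt (fun τ => h τ * c.φ.symm (y τ)) (c.B (y t) ξ + c.Xinv (y t) y') s t := by
  have := H.mul (hasLogDerivWithinAt_symm hr hs hy) (c.φ.map_target hr.1)
    (by rw [c.φ.right_inv hr.1]; exact hr)
  rwa [c.φ.right_inv hr.1] at this

variable [CompleteSpace V]

variable (c) in
/-- The logarithmic derivative of `h (φ⁻¹ ∘ y)`, where `h` has logarithmic derivative `ε`. -/
def perturb (ε y y' : V) : V := c.B y ε + c.Xinv y y'

theorem continuousOn_perturb {P : Type*} [TopologicalSpace P] {s : Set P} {ε y y' : P → V}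
    (hr : ∀ q ∈ s, y q ∈ c.reg) (hε : ContinuousOn ε s) (hy : ContinuousOn y s)
    (hy' : ContinuousOn y' s) : ContinuousOn (fun q => c.perturb (ε q) (y q) (y' q)) s := by
  have hB : ContinuousOn (fun q => c.B (y q)) s := fun q hq =>
    (contDiffAt_B (hr q hq)).continuousAt.comp_continuousWithinAt (hy q hq)
  have hX : ContinuousOn (fun q => c.Xinv (y q)) s := fun q hq =>
    (contDiffAt_Xinv (hr q hq)).continuousAt.comp_continuousWithinAt (hy q hq)
  exact (hB.clm_apply hε).add (hX.clm_apply hy')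

/-- Families `h (φ⁻¹ ∘ y)` of paths, with `y = v p` depending linearly on a parameter `p`, have
logarithmic derivatives that depend differentiably on `p`, and their variations are infinitesimal
gauge transformations. -/
theorem exists_variation {ε : C(Icc a b, V)} {v v' : ℝ → F →L[ℝ] V} {O : Set F} (hO : IsOpen O)
    (hv : ∀ t ∈ Icc a b, HasDerivWithinAt v (v' t) (Icc a b) t) (hv' : ContinuousOn v' (Icc a b))
    (hr : ∀ p ∈ O, ∀ t ∈ Icc a b, v t p ∈ c.reg) :
    ∃ σ : F → C(Icc a b, V), ContDiffOn ℝ 1 σ O ∧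
      (∀ p ∈ O, ∀ t : Icc a b, σ p t = c.perturb (ε t) (v t p) (v' t p)) ∧
      ∀ p ∈ O, ∀ δ, ∀ t : Icc a b, HasDerivWithinAt (fun τ => c.Xinv (v τ p) (v τ δ))
        (fderiv ℝ σ p δ t - c.bracket (σ p t) (c.Xinv (v t p) (v t δ))) (Icc a b) t := by
  set f : F → Icc a b → V := fun p t => c.perturb (ε t) (v t p) (v' t p) with hfdef
  -- The parameter enters through the base point of `B` and of `Xinv` as well as through the
  -- velocity, which gives three terms.
  set f' : F → Icc a b → F →L[ℝ] V := fun p t =>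
    ((fderiv ℝ c.B (v t p)).flip (ε t)).comp (v t) +
      (((fderiv ℝ c.Xinv (v t p)).flip (v' t p)).comp (v t) + (c.Xinv (v t p)).comp (v' t)) with hf'def
  have hvc : Continuous fun q : F × Icc a b => v q.2 :=
    (continuousOn_iff_continuous_domRestrict.1
      fun t ht => (hv t ht).continuousWithinAt).comp continuous_snd
  have hvc' : Continuous fun q : F × Icc a b => v' q.2 :=
    (continuousOn_iff_continuous_domRestrict.1 hv').comp continuous_snd
  have hy : Continuous fun q : F × Icc a b => v q.2 q.1 := hvc.clm_apply continuous_fst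
  have hy' : Continuous fun q : F × Icc a b => v' q.2 q.1 := hvc'.clm_apply continuous_fst
  have hεc : Continuous fun q : F × Icc a b => ε q.2 := by fun_prop
  have hreg : ∀ q ∈ O ×ˢ (univ : Set (Icc a b)), v q.2 q.1 ∈ c.reg :=
    fun q hq => hr q.1 hq.1 q.2 q.2.2
  have hfc : ContinuousOn (Function.uncurry f) (O ×ˢ univ) :=
    continuousOn_perturb hreg hεc.continuousOn hy.continuousOn hy'.continuousOn
  have hfc' : ContinuousOn (Function.uncurry f') (O ×ˢ univ) := by
    have hB : ContinuousOn (fun q : F × Icc a b => fderiv ℝ c.B (v q.2 q.1)) (O ×ˢ univ) :=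
      fun q hq => (((contDiffAt_B (hreg q hq)).fderiv_right (m := 0) (by simp)).continuousAt
        |>.comp_continuousWithinAt (f := fun q : F × Icc a b => v q.2 q.1) hy.continuousWithinAt)
    have hX1 : ContinuousOn (fun q : F × Icc a b => fderiv ℝ c.Xinv (v q.2 q.1)) (O ×ˢ univ) :=
      fun q hq => (((contDiffAt_Xinv (hreg q hq)).fderiv_right (m := 0) (by simp)).continuousAt
        |>.comp_continuousWithinAt (f := fun q : F × Icc a b => v q.2 q.1) hy.continuousWithinAt)
    have hX : ContinuousOn (fun q : F × Icc a b => c.Xinv (v q.2 q.1)) (O ×ˢ univ) :=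
      fun q hq => ((contDiffAt_Xinv (hreg q hq)).continuousAt
        |>.comp_continuousWithinAt (f := fun q : F × Icc a b => v q.2 q.1) hy.continuousWithinAt)
    have hflip : Continuous (ContinuousLinearMap.flip : (V →L[ℝ] V →L[ℝ] V) → V →L[ℝ] V →L[ℝ] V) :=
      (ContinuousLinearMap.flipₗᵢ ℝ V V V).continuous
    exact (((hflip.comp_continuousOn hB).clm_apply hεc.continuousOn).clm_comp hvc.continuousOn).add
      ((((hflip.comp_continuousOn hX1).clm_apply hy'.continuousOn).clm_comp hvc.continuousOn).add
        (hX.clm_comp hvc'.continuousOn))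
  have hd : ∀ p ∈ O, ∀ t, HasFDerivAt (fun p => f p t) (f' p t) p := by
    intro p hp t
    have hz := hr p hp t t.2
    have h1 : HasFDerivAt (fun p => c.B (v t p)) ((fderiv ℝ c.B (v t p)).comp (v t)) p :=
      (hasFDerivAt_B hz).comp p (v t).hasFDerivAt
    have h2 : HasFDerivAt (fun p => c.Xinv (v t p)) ((fderiv ℝ c.Xinv (v t p)).comp (v t)) p :=
      (hasFDerivAt_Xinv hz).comp p (v t).hasFDerivAt
    refine ((h1.clm_apply (hasFDerivAt_const (ε t) p)).add
      (h2.clm_apply (v' t).hasFDerivAt)).congr_fderiv ?_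
    ext δ
    simp [f', add_comm]
  obtain ⟨h1, h2⟩ := contDiffOn_ofFun hO hfc hfc' hd
  obtain ⟨h3, -⟩ := continuousOn_ofFun hfc
  refine ⟨fun p => ContinuousMap.ofFun (f p), h1,
    fun p hp t => ContinuousMap.ofFun_apply (h3 p hp) t, fun p hp δ t => ?_⟩
  have hz := hr p hp t t.2
  have hvp (w : F) : HasDerivWithinAt (fun τ => v τ w) (v' t w) (Icc a b) t :=
    ((ContinuousLinearMap.apply ℝ V w).hasFDerivAt (x := v t)).comp_hasDerivWithinAt (t : ℝ)
      (hv t t.2)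
  have hX : HasDerivWithinAt (fun τ => c.Xinv (v τ p)) (fderiv ℝ c.Xinv (v t p) (v' t p)) (Icc a b) t :=
    HasFDerivAt.comp_hasDerivWithinAt (l := c.Xinv) (f := fun τ => v τ p) (t : ℝ)
      (hasFDerivAt_Xinv hz) (hvp p)
  refine (hX.clm_apply (hvp δ)).congr_deriv ?_
  rw [h2 p hp, ContinuousMap.ofFun_apply (h3 p hp)]
  -- Zero curvature with the two directions `δ` in the parameter and time; the function being
  -- differentiated is the gauge parameter of the variation.
  have := variation_eq hz (ε t) (v t δ) (v' t p) (v' t δ)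
  simp only [f, f', perturb, add_apply, ContinuousLinearMap.comp_apply,
    ContinuousLinearMap.flip_apply]
  rw [← add_assoc, this]
  abel

end GroupChart

/-! ### Multipliers as paths in the Lie algebra -/

namespace GroupChart

variable {G V : Type*} [TopologicalSpace G] [Group G]
  [NormedAddCommGroup V] [NormedSpace ℝ V] {c : GroupChart G V}
  {a b : ℝ} {h h' : ℝ → G} {ε ε' : ℝ → V}

theorem IsDevelopment.congr (H : c.IsDevelopment a b ε h) (hab : a ≤ b)
    (hh : EqOn h' h (Icc a b)) : c.IsDevelopment a b ε h' :=
  ⟨(hh ⟨le_rfl, hab⟩).trans H.1, fun t ht => (H.2 t ht).congr hh (hh ht)⟩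

theorem IsDevelopment.eqOn_left (hab : a < b) (H : c.IsDevelopment a b ε h)
    (H' : c.IsDevelopment a b ε' h) : EqOn ε ε' (Icc a b) := fun t ht =>
  (uniqueDiffOn_Icc hab t ht).eq_deriv _ (H.2 t ht).2 (H'.2 t ht).2

variable {k : ℕ} (hab : a < b) (U : (Fin k → ℝ) ≃L[ℝ] V)

/-- The multiplier as a path in the Lie algebra. -/
def frameCurve (e : Multiplier k a b) (t : ℝ) : V := U (coeff hab e t)

theorem continuous_frameCurve (e : Multiplier k a b) : Continuous (frameCurve hab U e) :=
  U.continuous.comp (continuous_coeff hab e)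

theorem exists_norm_frameCurve_le (e : Multiplier k a b) :
    ∃ A : ℝ≥0, ∀ t, ‖frameCurve hab U e t‖ ≤ A := by
  refine ⟨⟨‖(U : (Fin k → ℝ) →L[ℝ] V)‖ * ‖e‖, by positivity⟩, fun t => ?_⟩
  exact ((U : (Fin k → ℝ) →L[ℝ] V).le_opNorm _).trans
    (mul_le_mul_of_nonneg_left (norm_coeff_le hab e t) (norm_nonneg _))

/-- Paths in the Lie algebra as multipliers. -/
def toMultiplier : C(Icc a b, V) →L[ℝ] Multiplier k a b :=
  (U.symm : V →L[ℝ] (Fin k → ℝ)).compLeftContinuous ℝ (Icc a b)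

theorem coeff_toMultiplier (ε : C(Icc a b, V)) {t : ℝ} (ht : t ∈ Icc a b) :
    coeff hab (toMultiplier U ε) t = U.symm (ε ⟨t, ht⟩) := coeff_of_mem hab _ ht

theorem frameCurve_toMultiplier (ε : C(Icc a b, V)) {t : ℝ} (ht : t ∈ Icc a b) :
    frameCurve hab U (toMultiplier U ε) t = ε ⟨t, ht⟩ := by
  rw [frameCurve, coeff_toMultiplier hab U ε ht, ContinuousLinearEquiv.apply_symm_apply]

theorem frameCurve_injective {e e' : Multiplier k a b}
    (H : EqOn (frameCurve hab U e) (frameCurve hab U e') (Icc a b)) : e = e' := by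
  ext1 t
  have := U.injective (H t.2)
  rwa [coeff_of_mem hab e t.2, coeff_of_mem hab e' t.2] at this

variable [IsTopologicalGroup G] [CompleteSpace V]

/-- Multiplication by a continuously differentiable path in the chart changes a development to a
development. -/
theorem exists_isDevelopment_mul_symm {e : Multiplier k a b} {h : ℝ → G}
    (H : c.IsDevelopment a b (frameCurve hab U e) h) {y y' : ℝ → V}
    (hy : ∀ t ∈ Icc a b, HasDerivWithinAt y (y' t) (Icc a b) t) (hy' : ContinuousOn y' (Icc a b))
    (hr : ∀ t ∈ Icc a b, y t ∈ c.reg) (hya : y a = 0) :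
    ∃ e' : Multiplier k a b, c.IsDevelopment a b (frameCurve hab U e')
      (fun t => h t * c.φ.symm (y t)) := by
  have hcont := continuousOn_perturb hr (continuous_frameCurve hab U e).continuousOn
    (fun t ht => (hy t ht).continuousWithinAt) hy'
  refine ⟨toMultiplier U ⟨_, continuousOn_iff_continuous_domRestrict.1 hcont⟩,
    by beta_reduce; rw [H.1, hya, c.symm_zero, one_mul], fun t ht => ?_⟩
  rw [frameCurve_toMultiplier hab U _ ht]
  exact (H.2 t ht).mul_symm (hr t ht)
    (eventually_nhdsWithin_of_forall fun τ hτ => (hr τ hτ).1) (hy t ht)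

/-- This serves twice: with `F = ℝ` for contracting a small loop, and with `F = V` for local
sections of the path ordered exponential. The last clause is the gauge equation solved for the
derivative of the parameter. -/
theorem exists_multiplier_variation {F : Type*} [NormedAddCommGroup F] [NormedSpace ℝ F]
    {e : Multiplier k a b} {h : ℝ → G}
    (H : c.IsDevelopment a b (frameCurve hab U e) h) {v v' : ℝ → F →L[ℝ] V} {O : Set F}
    (hO : IsOpen O) (hv : ∀ t ∈ Icc a b, HasDerivWithinAt v (v' t) (Icc a b) t)
    (hv' : ContinuousOn v' (Icc a b)) (hr : ∀ p ∈ O, ∀ t ∈ Icc a b, v t p ∈ c.reg) (hva : v a = 0) :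
    ∃ σ : F → Multiplier k a b, ContDiffOn ℝ 1 σ O ∧
      (∀ p ∈ O, c.IsDevelopment a b (frameCurve hab U (σ p)) (fun t => h t * c.φ.symm (v t p))) ∧
      ∀ p ∈ O, ∀ δ, ∀ t ∈ Icc a b, HasDerivWithinAt (fun τ => U.symm (c.Xinv (v τ p) (v τ δ)))
        (coeff hab (fderiv ℝ σ p δ) t -
          U.symm (c.bracket (frameCurve hab U (σ p) t) (c.Xinv (v t p) (v t δ)))) (Icc a b) t := by
  obtain ⟨σ, h1, h2, h3⟩ := exists_variation (c := c)
    (ε := ⟨fun t : Icc a b => frameCurve hab U e t,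
      (continuous_frameCurve hab U e).comp continuous_subtype_val⟩) hO hv hv' hr
  have hd : ∀ p ∈ O, HasFDerivAt (fun p => toMultiplier U (σ p))
      ((toMultiplier U).comp (fderiv ℝ σ p)) p := fun p hp =>
    (toMultiplier U).hasFDerivAt.comp p
      (((h1.contDiffAt (hO.mem_nhds hp)).differentiableAt (by simp)).hasFDerivAt)
  refine ⟨fun p => toMultiplier U (σ p), (toMultiplier U).contDiff.comp_contDiffOn h1,
    fun p hp => ⟨by simp [H.1, hva, c.symm_zero], fun t ht => ?_⟩,
    fun p hp δ t ht => ?_⟩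
  · rw [frameCurve_toMultiplier hab U _ ht, h2 p hp]
    refine (H.2 t ht).mul_symm (hr p hp t ht)
      (eventually_nhdsWithin_of_forall fun τ hτ => (hr p hp τ hτ).1) ?_
    exact ((ContinuousLinearMap.apply ℝ V p).hasFDerivAt (x := v t)).comp_hasDerivWithinAt t
      (hv t ht)
  · rw [(hd p hp).fderiv, frameCurve_toMultiplier hab U _ ht, ContinuousLinearMap.comp_apply,
      coeff_toMultiplier hab U _ ht, ← map_sub]
    exact (U.symm : V →L[ℝ] (Fin k → ℝ)).hasFDerivAt.comp_hasDerivWithinAt t (h3 p hp δ ⟨t, ht⟩)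

end GroupChart

/-! ### The Lie algebra case: constraints and small loops -/

namespace FirstClassSystem

variable {n k : ℕ} {S : FirstClassSystem n k} {a b : ℝ} {hab : a < b}
  {C : DarbouxChange S.N} {D : Set (HJData n k a b)} {x : HJData n k a b → ℝ → Phase n}

/-- The gauge parameter is not assumed to vanish at the ends: for contracted loops both boundary
terms are zero, while for the local sections the term at `b` reads off the constraints. -/
theorem IsEvolution.multiplierPairing_of_lie {cst : Fin k → Fin k → Fin k → ℝ}
    (hcst : ∀ α β, ∀ y ∈ S.N, poissonBracket (S.H α) (S.H β) y = ∑ γ, cst α β γ * S.H γ y)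
    {y : ℝ → Phase n} {e ε : Multiplier k a b} (hy : S.IsEvolution hab e y) {γ : ℝ → Fin k → ℝ}
    (h : ∀ t ∈ Icc a b, HasDerivWithinAt γ (coeff hab ε t -
      fun δ => ∑ α, ∑ β, cst α β δ * coeff hab e t α * γ t β) (Icc a b) t) :
    multiplierPairing hab (S.constraintCurve y) ε =
      ∑ δ, γ b δ * S.H δ (y b) - ∑ δ, γ a δ * S.H δ (y a) := by
  refine hy.multiplierPairing_eq_sub fun t ht => ⟨h t ht, ?_⟩
  simp only [hcst _ _ _ (hy.mem ht), Pi.sub_apply, sub_mul, Finset.sum_sub_distrib,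
    Finset.mul_sum, Finset.sum_mul]
  have : ∑ δ, ∑ α, ∑ β, cst α β δ * coeff hab e t α * γ t β * S.H δ (y t) =
      ∑ α, ∑ β, ∑ δ, coeff hab e t α * γ t β * (cst α β δ * S.H δ (y t)) := by
    rw [Finset.sum_comm]
    refine Finset.sum_congr rfl fun α _ => ?_
    rw [Finset.sum_comm]
    refine Finset.sum_congr rfl fun β _ => Finset.sum_congr rfl fun δ _ => ?_
    ring
  rw [this]
  ring

/-- Constraints that vanish at the final time vanish at all times. -/
theorem IsEvolution.satisfiesConstraints_of_final {y : ℝ → Phase n} {e : Multiplier k a b}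
    (hy : S.IsEvolution hab e y) (hb : ∀ δ, S.H δ (y b) = 0) : S.SatisfiesConstraints a b y := by
  set A : ℝ → Fin k → Fin k → ℝ := fun t δ γ => ∑ α, coeff hab e t α * S.f α δ γ (y t) with hA
  have hAc : ContinuousOn A (Icc a b) := by
    refine continuousOn_pi.2 fun δ => continuousOn_pi.2 fun γ =>
      continuousOn_finsetSum _ fun α _ => ContinuousOn.mul ?_ ?_
    · exact ((continuous_apply α).comp (continuous_coeff hab e)).continuousOn
    · exact (S.smooth_f α δ γ).continuousOn.comp hy.continuousOn fun t ht => hy.mem ht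
  obtain ⟨K, hK⟩ := isCompact_Icc.exists_bound_of_continuousOn hAc
  have hK0 : 0 ≤ K := (norm_nonneg _).trans (hK a ⟨le_rfl, hab.le⟩)
  lift K to ℝ≥0 using hK0
  -- By involutivity the constraints along the solution obey a linear homogeneous equation with
  -- continuous matrix `A`; they are compared with the zero solution backwards from time `b`.
  have key := ODE_solution_unique_of_mem_Icc_left (a := a) (b := b)
    (v := fun t w δ => ∑ γ, A t δ γ * w γ) (s := fun _ => univ)
    (f := fun t δ => S.H δ (y t)) (g := fun _ => 0) (K := k * K) ?_ ?_ ?_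
    (fun _ _ => mem_univ _) continuousOn_const ?_ (fun _ _ => mem_univ _) (funext hb)
  · exact fun t ht δ => congrFun (key ht) δ
  · refine fun t ht => LipschitzOnWith.of_dist_le_mul fun w _ w' _ => ?_
    rw [dist_eq_norm, dist_eq_norm, pi_norm_le_iff_of_nonneg (by positivity)]
    intro δ
    simp only [Pi.sub_apply, ← Finset.sum_sub_distrib, ← mul_sub]
    refine (norm_sum_le_of_le _ (f := fun γ => A t δ γ * (w γ - w' γ))
      (n := fun _ => K * ‖w - w'‖) fun γ _ => ?_).trans
      (le_of_eq ?_)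
    swap
    · rw [Finset.sum_const, Finset.card_univ, Fintype.card_fin, nsmul_eq_mul, ← mul_assoc]
      rfl
    rw [norm_mul]
    refine mul_le_mul ?_ (norm_le_pi_norm (w - w') γ) (norm_nonneg _) K.2
    exact (norm_le_pi_norm (A t δ) γ).trans
      ((norm_le_pi_norm (A t) δ).trans (hK t (Ioc_subset_Icc_self ht)))
  · exact continuousOn_pi.2 fun δ => hy.continuousOn_H δ
  · intro t ht
    have : HasDerivWithinAt (fun t δ => S.H δ (y t)) (fun δ => ∑ γ, A t δ γ * S.H γ (y t))
        (Icc a b) t := hasDerivWithinAt_pi.2 fun δ => by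
      refine (hy.hasDerivWithinAt_H δ (Ioc_subset_Icc_self ht)).congr_deriv ?_
      simp only [hA, S.involutive _ _ _ (hy.mem (Ioc_subset_Icc_self ht)), Finset.mul_sum,
        Finset.sum_mul]
      rw [Finset.sum_comm]
      simp only [mul_assoc]
    exact this.mono_of_mem_nhdsWithin (mem_of_superset (Icc_mem_nhdsLE_of_mem ht) subset_rfl)
  · intro t _
    simpa using! hasDerivWithinAt_const t (Iic t) (0 : Fin k → ℝ)

variable {G V : Type*} [TopologicalSpace G] [Group G] [IsTopologicalGroup G]
  [NormedAddCommGroup V] [NormedSpace ℝ V] [CompleteSpace V] {c : GroupChart G V}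
  (U : (Fin k → ℝ) ≃L[ℝ] V)

open GroupChart in
/-- Small loops in the group do not change the Hamilton-Jacobi action. -/
theorem IsSolutionFamily.hjAction_eq_of_small_loop (hx : S.IsSolutionFamily hab C D x)
    {cst : Fin k → Fin k → Fin k → ℝ}
    (hcst : ∀ α β, ∀ y ∈ S.N, poissonBracket (S.H α) (S.H β) y = ∑ γ, cst α β γ * S.H γ y)
    (hbr : ∀ v w, U.symm (c.bracket (U v) (U w)) = fun δ => ∑ α, ∑ β, cst α β δ * v α * w β)
    {r : ℝ} (hreg : Metric.ball (0 : V) r ⊆ c.reg) {w : (Fin n → ℝ) × (Fin n → ℝ)}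
    {e e' : Multiplier k a b} {h ℓ : ℝ → G}
    (hD : ∀ e₁ h₁, c.IsDevelopment a b (frameCurve hab U e₁) h₁ → h₁ b = h b → (w, e₁) ∈ D)
    (H : c.IsDevelopment a b (frameCurve hab U e) h)
    (H' : c.IsDevelopment a b (frameCurve hab U e') (fun t => h t * ℓ t)) (hb : ℓ b = 1)
    (hℓ : ∀ t ∈ Icc a b, ℓ t ∈ c.φ.source ∧ c.φ (ℓ t) ∈ Metric.ball (0 : V) r) :
    S.hjAction hab C x (w, e) = S.hjAction hab C x (w, e') := by
  have ha' : a ∈ Icc a b := ⟨le_rfl, hab.le⟩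
  have ha : ℓ a = 1 := by simpa [H.1] using H'.1
  set y : ℝ → V := fun t => c.φ (ℓ t) with hydef
  set y' : ℝ → V := fun t =>
    c.X (y t) (frameCurve hab U e' t - c.B (y t) (frameCurve hab U e t)) with hy'def
  have hyreg : ∀ t ∈ Icc a b, y t ∈ c.reg := fun t ht => hreg (hℓ t ht).2
  have hy : ∀ t ∈ Icc a b, HasDerivWithinAt y (y' t) (Icc a b) t := by
    intro t ht
    have := (H.2 t ht).inv_mul (H'.2 t ht) (by simpa using (hℓ t ht).1)
      (by simpa using hyreg t ht)
    simpa only [inv_mul_cancel_left] using this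
  have hyc : ContinuousOn y (Icc a b) := fun t ht => (hy t ht).continuousWithinAt
  have hy'c : ContinuousOn y' (Icc a b) := by
    have hB : ContinuousOn (fun q => c.B (y q)) (Icc a b) := fun q hq =>
      (contDiffAt_B (hyreg q hq)).continuousAt.comp_continuousWithinAt (hyc q hq)
    have hX : ContinuousOn (fun q => c.X (y q)) (Icc a b) := fun q hq =>
      (c.contDiffAt_X (hyreg q hq).1).continuousAt.comp_continuousWithinAt (hyc q hq)
    exact hX.clm_apply ((continuous_frameCurve hab U e').continuousOn.sub
      (hB.clm_apply (continuous_frameCurve hab U e).continuousOn))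
  -- The maximum of `‖y‖` controls all times at once, so `O` is an open set of scalars containing
  -- `[0, 1]` for which the scaled path stays in the ball.
  obtain ⟨m, hm, hmax⟩ := isCompact_Icc.exists_isMaxOn (nonempty_Icc.2 hab.le) hyc.norm
  have hmr : ‖y m‖ < r := by simpa using (hℓ m hm).2
  let Λ : V →L[ℝ] ℝ →L[ℝ] V := ContinuousLinearMap.smulRightL ℝ ℝ V 1
  have hΛ : ∀ (u : V) (s : ℝ), Λ u s = s • u := fun u s => by simp [Λ]
  let O : Set ℝ := {s | |s| * ‖y m‖ < r}
  have hO : IsOpen O := isOpen_lt (by fun_prop) continuous_const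
  have h01 : Icc (0 : ℝ) 1 ⊆ O := fun s hs => by
    refine lt_of_le_of_lt ?_ hmr
    rw [abs_of_nonneg hs.1]
    exact mul_le_of_le_one_left (norm_nonneg _) hs.2
  -- The family of multipliers developing to `h · φ⁻¹(s y)`, which leads from `e` at `s = 0` to `e'`
  -- at `s = 1`.
  obtain ⟨σ, h1, h2, h3⟩ := exists_multiplier_variation hab U H (v := fun t => Λ (y t))
    (v' := fun t => Λ (y' t)) hO (fun t ht => Λ.hasFDerivAt.comp_hasDerivWithinAt t (hy t ht))
    (Λ.continuous.comp_continuousOn hy'c) (fun s hs t ht => hreg (by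
      rw [hΛ, mem_ball_zero_iff, norm_smul, Real.norm_eq_abs]
      exact (mul_le_mul_of_nonneg_left (hmax ht) (abs_nonneg s)).trans_lt hs))
    (by simp [hydef, ha, c.map_one])
  have hσ0 : σ 0 = e := frameCurve_injective hab U
    (((h2 0 (h01 (by simp))).congr hab.le fun t _ => by simp).eqOn_left hab H)
  have hσ1 : σ 1 = e' := frameCurve_injective hab U
    (((h2 1 (h01 (by simp))).congr hab.le fun t ht => by
      simp [hΛ, hydef, c.φ.left_inv (hℓ t ht).1]).eqOn_left hab H')
  have := hx.hjAction_eq_of_path (w := w) (ε := σ) (ε' := fun s => fderiv ℝ σ s 1) fun s hs => ?_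
  · rwa [hσ0, hσ1] at this
  -- Scaling fixes `y b = 0`, so the endpoint of the development is unchanged and the family stays
  -- in `D`.
  · have hsD : (w, σ s) ∈ D := hD _ _ (h2 s (h01 hs)) (by
      simp [hydef, hb, c.map_one])
    refine ⟨hsD, ?_, ?_⟩
    · exact ((h1.contDiffAt (hO.mem_nhds (h01 hs))).differentiableAt
        (by simp)).hasFDerivAt.hasDerivAt.hasDerivWithinAt
    -- The gauge parameter is linear in `y` in its second slot, hence zero at both ends.
    · rw [(hx.evolution _ hsD).multiplierPairing_of_lie hcst
        (γ := fun τ => U.symm (c.Xinv (Λ (y τ) s) (Λ (y τ) 1)))]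
      · simp [hydef, ha, hb, c.map_one]
      · intro t ht
        have := h3 s (h01 hs) 1 t ht
        rwa [frameCurve, ← U.apply_symm_apply (c.Xinv (Λ (y t) s) (Λ (y t) 1)), hbr] at this

end FirstClassSystem

/-! ### Smooth approximation of loops -/

section Approx

variable {V : Type*} [NormedAddCommGroup V] [NormedSpace ℝ V] [CompleteSpace V] {a b : ℝ}

/-- A continuous loop at `0` in a Banach space is a uniform limit of smooth ones. -/
theorem exists_contDiff_loop_dist_le (hab : a < b) (y : C(Icc a b, V))
    (ha : y ⟨a, left_mem_Icc.2 hab.le⟩ = 0) (hb : y ⟨b, right_mem_Icc.2 hab.le⟩ = 0)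
    {ε : ℝ} (hε : 0 < ε) : ∃ z : ℝ → V, ContDiff ℝ ∞ z ∧ z a = 0 ∧ z b = 0 ∧
      ∀ t : Icc a b, ‖z t - y t‖ ≤ ε := by
  have hu : UniformContinuous (IccExtend hab.le y) :=
    (CompactSpace.uniformContinuous_of_continuous y.continuous).comp
      (LipschitzWith.projIcc hab.le).uniformContinuous
  obtain ⟨z, hz, hzy⟩ := hu.exists_contDiff_dist_le (ε := ε / 3) (by positivity)
  have hz' : ∀ t : Icc a b, ‖z t - y t‖ < ε / 3 := fun t => by
    have := hzy t
    rwa [IccExtend_val, dist_eq_norm] at this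
  have hza : ‖z a‖ < ε / 3 := by simpa [ha] using hz' ⟨a, left_mem_Icc.2 hab.le⟩
  have hzb : ‖z b‖ < ε / 3 := by simpa [hb] using hz' ⟨b, right_mem_Icc.2 hab.le⟩
  have hba : 0 < b - a := sub_pos.2 hab
  -- The affine interpolation of the end values is subtracted. One third of `ε` is spent on the
  -- approximation and one on each end.
  refine ⟨fun t => z t - ((b - t) / (b - a)) • z a - ((t - a) / (b - a)) • z b,
    by fun_prop, ?_, ?_, fun t => ?_⟩
  · simp [div_self hba.ne']
  · simp [div_self hba.ne']
  · have h1 : ‖((b - t) / (b - a)) • z a‖ ≤ ‖z a‖ := by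
      rw [norm_smul, Real.norm_of_nonneg (div_nonneg (sub_nonneg.2 t.2.2) hba.le)]
      exact mul_le_of_le_one_left (norm_nonneg _)
        ((div_le_one hba).2 (sub_le_sub_left t.2.1 _))
    have h2 : ‖((t - a) / (b - a)) • z b‖ ≤ ‖z b‖ := by
      rw [norm_smul, Real.norm_of_nonneg (div_nonneg (sub_nonneg.2 t.2.1) hba.le)]
      exact mul_le_of_le_one_left (norm_nonneg _)
        ((div_le_one hba).2 (sub_le_sub_right t.2.2 _))
    have h3 := hz' t
    calc _ = ‖z t - y t - ((b - t) / (b - a)) • z a - ((t - a) / (b - a)) • z b‖ := by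
          beta_reduce; rw [sub_right_comm _ _ (y t), sub_right_comm (z t)]
      _ ≤ ‖z t - y t‖ + ‖((b - t) / (b - a)) • z a‖ + ‖((t - a) / (b - a)) • z b‖ :=
          (norm_sub_le _ _).trans (add_le_add_left (norm_sub_le _ _) _)
      _ ≤ ε := by linarith

end Approx

/-! ### Loops in simply connected groups -/

section Group

variable {K G : Type*} [TopologicalSpace K] [LocallyCompactSpace K] [TopologicalSpace G] [Group G]
  [IsTopologicalGroup G]

theorem isTopologicalGroup_continuousMap : IsTopologicalGroup C(K, G) where
  continuous_mul := continuous_mul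
  continuous_inv := ContinuousMap.continuous_postcomp ⟨fun g : G => g⁻¹, continuous_inv⟩

/-- In a simply connected group a closed subgroup of the group of paths that contains the small
loops contains all loops. -/
theorem mem_of_small_loops [SimplyConnectedSpace G] {a b : ℝ} (hab : a < b)
    {Γ : Subgroup C(Icc a b, G)} (hΓ : IsClosed (Γ : Set C(Icc a b, G))) {O : Set G}
    (hO : IsOpen O) (h1 : (1 : G) ∈ O)
    (hmem : ∀ γ : C(Icc a b, G), γ ⟨a, left_mem_Icc.2 hab.le⟩ = 1 →
      γ ⟨b, right_mem_Icc.2 hab.le⟩ = 1 → (∀ t, γ t ∈ O) → γ ∈ Γ)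
    {γ : C(Icc a b, G)} (ha : γ ⟨a, left_mem_Icc.2 hab.le⟩ = 1)
    (hb : γ ⟨b, right_mem_Icc.2 hab.le⟩ = 1) : γ ∈ Γ := by
  have := isTopologicalGroup_continuousMap (K := Icc a b) (G := G)
  let i := iccHomeoI a b hab
  have hi0 : i ⟨a, left_mem_Icc.2 hab.le⟩ = 0 := by ext; simp [i]
  have hi1 : i ⟨b, right_mem_Icc.2 hab.le⟩ = 1 := by
    ext; simp [i, div_self (sub_pos.2 hab).ne']
  let p : Path (1 : G) 1 :=
    { toFun := fun s => γ (i.symm s)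
      continuous_toFun := γ.continuous.comp i.symm.continuous
      source' := by rw [← hi0, i.symm_apply_apply, ha]
      target' := by rw [← hi1, i.symm_apply_apply, hb] }
  obtain ⟨F⟩ := SimplyConnectedSpace.paths_homotopic (Path.refl (1 : G)) p
  -- A homotopy from the constant loop is a path in the group of continuous paths.
  let H : C(unitInterval, C(Icc a b, G)) :=
    ContinuousMap.curry ⟨fun q => F (q.1, i q.2), by fun_prop⟩
  have hH : ∀ s t, H s t = F (s, i t) := fun s t => rfl
  -- Closedness is that of `Γ`. Openness holds because for nearby `s'` the quotient of `H s` and `H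
  -- s'` is a loop inside `O`.
  have hA : IsClopen (H ⁻¹' (Γ : Set C(Icc a b, G))) := by
    refine ⟨hΓ.preimage H.continuous, isOpen_iff_mem_nhds.2 fun s hs => ?_⟩
    have hU : IsOpen {η : C(Icc a b, G) | MapsTo η univ O} :=
      ContinuousMap.isOpen_setOfPred_mapsTo isCompact_univ hO
    have hc : Continuous fun s' => (H s)⁻¹ * H s' := by fun_prop
    filter_upwards [(hU.preimage hc).mem_nhds (show MapsTo _ _ _ by
      intro t _; simpa using h1)] with s' hs'
    have hm : (H s)⁻¹ * H s' ∈ Γ := hmem _ (by simp [hH, hi0]) (by simp [hH, hi1])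
      fun t => hs' (mem_univ t)
    have := Γ.mul_mem hs hm
    rwa [mul_inv_cancel_left] at this
  have h0 : H 0 = 1 := by ext t; simp [hH]
  have hAu := hA.eq_univ ⟨0, by
    show H 0 ∈ Γ
    rw [h0]; exact Γ.one_mem⟩
  have hm : H 1 ∈ Γ := by
    have := mem_univ (1 : unitInterval)
    rwa [← hAu] at this
  have : H 1 = γ := by
    ext t
    rw [hH, F.apply_one]
    show γ (i.symm (i t)) = γ t
    rw [i.symm_apply_apply]
  rwa [← this]

end Group

/-! ### From small loops to all loops -/

namespace GroupChart

variable {G V : Type*} [TopologicalSpace G] [Group G] [IsTopologicalGroup G]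
  [NormedAddCommGroup V] [NormedSpace ℝ V] (c : GroupChart G V) {a b r : ℝ}

/-- Coordinates in the smaller ball have inverses within radius `r`, so that multiplication by a
small loop can be undone by another admissible one. -/
theorem exists_inv_ball (hr : 0 < r) : ∃ r₁, 0 < r₁ ∧ r₁ ≤ r ∧ ∀ x : V, ‖x‖ < r₁ →
    x ∈ c.φ.target ∧ (c.φ.symm x)⁻¹ ∈ c.φ.source ∧ ‖c.inv x‖ < r := by
  have h1 : ∀ᶠ x in 𝓝 (0 : V), x ∈ c.φ.target ∧ (c.φ.symm x)⁻¹ ∈ c.φ.source :=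
    isOpen_dom_inv.mem_nhds ⟨c.zero_mem, by simpa using c.one_mem⟩
  have h2 : ∀ᶠ x in 𝓝 (0 : V), ‖c.inv x‖ < r :=
    contDiffAt_inv_zero.continuousAt.norm.eventually_lt continuousAt_const (by simpa [inv_zero])
  obtain ⟨r₁, h0, h⟩ := Metric.eventually_nhds_iff.1 (h1.and h2)
  refine ⟨min r₁ r, lt_min h0 hr, min_le_right _ _, fun x hx => ?_⟩
  have := h (y := x) (by simpa using hx.trans_le (min_le_left _ _))
  exact ⟨this.1.1, this.1.2, this.2⟩

omit [IsTopologicalGroup G] in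
variable {c} in
theorem symm_inv {x : V} (hx : (c.φ.symm x)⁻¹ ∈ c.φ.source) :
    c.φ.symm (c.inv x) = (c.φ.symm x)⁻¹ := c.φ.left_inv hx

/-- A relation between paths and values that is compatible with small loops only depends on the
endpoint of the path if the group is simply connected. -/
theorem eq_of_forall_small_loop [CompleteSpace V] [SimplyConnectedSpace G] (hab : a < b)
    (hr : 0 < r) {A : Type*} {R : C(Icc a b, G) → A → Prop} {g : G}
    (ha : ∀ η v, R η v → η ⟨a, left_mem_Icc.2 hab.le⟩ = 1)
    (hmul : ∀ η v, R η v → ∀ y : ℝ → V, ContDiffOn ℝ 1 y (Icc a b) → y a = 0 →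
      (∀ t ∈ Icc a b, ‖y t‖ < r) → ∀ γ : C(Icc a b, G), (∀ t, γ t = c.φ.symm (y t)) →
      ∃ v', R (η * γ) v')
    (hloop : ∀ η γ v v', R η v → R (η * γ) v' → η ⟨b, right_mem_Icc.2 hab.le⟩ = g →
      γ ⟨b, right_mem_Icc.2 hab.le⟩ = 1 → (∀ t, γ t ∈ c.φ.source ∧ ‖c.φ (γ t)‖ < r) → v = v')
    {η η' : C(Icc a b, G)} {v v' : A} (H : R η v) (H' : R η' v')
    (hη : η ⟨b, right_mem_Icc.2 hab.le⟩ = g) (hη' : η' ⟨b, right_mem_Icc.2 hab.le⟩ = g) :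
    v = v' := by
  have := isTopologicalGroup_continuousMap (K := Icc a b) (G := G)
  obtain ⟨r₁, hr₁, hr₁r, hball⟩ := c.exists_inv_ball hr
  set ta : Icc a b := ⟨a, left_mem_Icc.2 hab.le⟩ with hta
  set tb : Icc a b := ⟨b, right_mem_Icc.2 hab.le⟩ with htb
  -- Loops whose multiplication preserves the relation `R`, value included, in both directions; the
  -- equivalence is what makes this closed under inverses.
  let Γ : Subgroup C(Icc a b, G) :=
    { carrier := {γ | γ ta = 1 ∧ γ tb = 1 ∧ ∀ η, η tb = g → ∀ v, R η v ↔ R (η * γ) v}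
      one_mem' := ⟨rfl, rfl, fun η _ v => by rw [mul_one]⟩
      mul_mem' := by
        rintro γ γ' ⟨h1, h2, h3⟩ ⟨h1', h2', h3'⟩
        refine ⟨by simp [h1, h1'], by simp [h2, h2'], fun η hη v => ?_⟩
        rw [h3 η hη v, h3' (η * γ) (by simp [hη, h2]) v, mul_assoc]
      inv_mem' := by
        rintro γ ⟨h1, h2, h3⟩
        refine ⟨by simp [h1], by simp [h2], fun η hη v => ?_⟩
        rw [h3 (η * γ⁻¹) (by simp [hη, h2]) v, inv_mul_cancel_right] }
  -- `hmul` supplies some value for the product and `hloop` identifies it with the old one; the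
  -- converse uses the inverse loop.
  have hsmooth : ∀ (y : ℝ → V) (γ : C(Icc a b, G)), ContDiffOn ℝ 1 y (Icc a b) → y a = 0 →
      y b = 0 → (∀ t ∈ Icc a b, ‖y t‖ < r₁) → (∀ t, γ t = c.φ.symm (y t)) → γ ∈ Γ := by
    intro y γ hy hya hyb hyr hγ
    have hγb : γ tb = 1 := by rw [hγ, htb, hyb, c.symm_zero]
    have hsm : ∀ t, γ t ∈ c.φ.source ∧ ‖c.φ (γ t)‖ < r := fun t => by
      rw [hγ, c.φ.right_inv (hball _ (hyr t t.2)).1]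
      exact ⟨c.φ.map_target (hball _ (hyr t t.2)).1, (hyr t t.2).trans_le hr₁r⟩
    refine ⟨by rw [hγ, hta, hya, c.symm_zero], hγb, fun η hη v => ⟨fun h => ?_, fun h => ?_⟩⟩
    · obtain ⟨v', h'⟩ := hmul η v h y hy hya (fun t ht => (hyr t ht).trans_le hr₁r) γ hγ
      rwa [hloop η γ v v' h h' hη hγb hsm]
    · obtain ⟨v', h'⟩ := hmul (η * γ) v h (fun t => c.inv (y t))
        (fun t ht => ((contDiffAt_inv (hball _ (hyr t ht)).1 (hball _ (hyr t ht)).2.1).of_le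
          (by simp)).comp_contDiffWithinAt t (hy t ht))
        (by simp [hya, inv_zero]) (fun t ht => (hball _ (hyr t ht)).2.2) γ⁻¹
        (fun t => by rw [symm_inv (hball _ (hyr t t.2)).2.1, ← hγ]; rfl)
      rw [mul_inv_cancel_right] at h'
      rwa [← hloop η γ v' v h' h hη hγb hsm]
  have hclosure : ∀ γ : C(Icc a b, G), γ ta = 1 → γ tb = 1 →
      (∀ t, γ t ∈ c.φ.source ∩ c.φ ⁻¹' Metric.ball 0 (r₁ / 2)) → γ ∈ Γ.topologicalClosure := by
    intro γ hγa hγb hγ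
    -- The radial retraction makes the inverse chart a globally defined continuous map `T`, so that
    -- composition with `T` is continuous on paths and carries approximations in `V` to
    -- approximations in `G`.
    let ρ : V → V := fun x => ((r₁ / 2) / max (r₁ / 2) ‖x‖) • x
    have hρ0 : ∀ x : V, 0 < max (r₁ / 2) ‖x‖ := fun x => lt_max_of_lt_left (by positivity)
    have hρc : Continuous ρ := by
      refine (continuous_const.div (by fun_prop) fun x => (hρ0 x).ne').smul continuous_id
    have hρ : ∀ x, ‖ρ x‖ < r₁ := fun x => by
      have : ‖ρ x‖ ≤ r₁ / 2 := by
        rw [norm_smul, Real.norm_of_nonneg (div_nonneg (by positivity) (hρ0 x).le), div_mul_comm]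
        exact mul_le_of_le_one_left (by positivity) ((div_le_one (hρ0 x)).2 (le_max_right _ _))
      linarith
    have hρid : ∀ x, ‖x‖ ≤ r₁ / 2 → ρ x = x := fun x hx => by
      simp only [ρ, max_eq_left hx]
      rw [div_self (by positivity), one_smul]
    let T : C(V, G) := ⟨fun x => c.φ.symm (ρ x),
      c.φ.continuousOn_symm.comp_continuous hρc fun x => (hball _ (hρ x)).1⟩
    let y : C(Icc a b, V) := ⟨fun t => c.φ (γ t),
      c.φ.continuousOn.comp_continuous γ.continuous fun t => (hγ t).1⟩
    have hyr : ∀ t, ‖y t‖ < r₁ / 2 := fun t => mem_ball_zero_iff.1 (hγ t).2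
    have hTy : T.comp y = γ := by
      ext t
      show c.φ.symm (ρ (y t)) = γ t
      rw [hρid _ (hyr t).le]
      exact c.φ.left_inv (hγ t).1
    have hya : y ta = 0 := by simp [y, hγa, c.map_one]
    have hyb : y tb = 0 := by simp [y, hγb, c.map_one]
    let Y : Set C(Icc a b, V) := {y | ‖y‖ < r₁ / 2 ∧ ∃ z : ℝ → V, ContDiff ℝ ∞ z ∧ z a = 0 ∧
      z b = 0 ∧ ∀ t, y t = z t}
    have hyY : y ∈ closure Y := by
      have hy0 : ‖y‖ < r₁ / 2 := (ContinuousMap.norm_lt_iff y (by positivity)).2 hyr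
      refine Metric.mem_closure_iff.2 fun ε hε => ?_
      obtain ⟨z, hz, hza, hzb, hzy⟩ := exists_contDiff_loop_dist_le hab y hya hyb
        (ε := min ε (r₁ / 2 - ‖y‖) / 2) (by have := lt_min hε (sub_pos.2 hy0); positivity)
      have hle : min ε (r₁ / 2 - ‖y‖) / 2 < min ε (r₁ / 2 - ‖y‖) :=
        half_lt_self (lt_min hε (sub_pos.2 hy0))
      let w : C(Icc a b, V) := ⟨fun t => z t, hz.continuous.comp continuous_subtype_val⟩
      have hw : ‖w - y‖ ≤ min ε (r₁ / 2 - ‖y‖) / 2 :=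
        (ContinuousMap.norm_le _ ((norm_nonneg _).trans (hzy ta))).2 hzy
      refine ⟨w, ⟨?_, z, hz, hza, hzb, fun _ => rfl⟩, ?_⟩
      · have := norm_le_norm_add_norm_sub' w y
        have := min_le_right ε (r₁ / 2 - ‖y‖)
        linarith
      · rw [dist_comm, dist_eq_norm]
        exact hw.trans_lt (hle.trans_le (min_le_left _ _))
    have := map_mem_closure (ContinuousMap.continuous_postcomp T) hyY (t := (Γ : Set _)) ?_
    · rwa [hTy] at this
    · rintro w ⟨hw, z, hz, hza, hzb, hwz⟩
      have hwt : ∀ t, ‖w t‖ < r₁ / 2 := fun t => (w.norm_coe_le_norm t).trans_lt hw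
      refine hsmooth z _ ((hz.of_le (by simp)).contDiffOn) hza hzb (fun t ht => ?_) fun t => ?_
      · have := hwt ⟨t, ht⟩
        rw [hwz] at this
        exact this.trans (by linarith)
      · show c.φ.symm (ρ (w t)) = _
        rw [hρid _ (hwt t).le, hwz]
  have hO : IsOpen (c.φ.source ∩ c.φ ⁻¹' Metric.ball 0 (r₁ / 2)) :=
    c.φ.isOpen_inter_preimage Metric.isOpen_ball
  have h1O : (1 : G) ∈ c.φ.source ∩ c.φ ⁻¹' Metric.ball 0 (r₁ / 2) :=
    ⟨c.one_mem, by simp [c.map_one, hr₁]⟩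
  have hmem : η⁻¹ * η' ∈ Γ.topologicalClosure :=
    mem_of_small_loops hab Γ.isClosed_topologicalClosure hO h1O hclosure
      (show (η ta)⁻¹ * η' ta = 1 by rw [ha η v H, ha η' v' H', inv_one, one_mul])
      (show (η tb)⁻¹ * η' tb = 1 by rw [hη, hη', inv_mul_cancel])
  have hU : IsOpen {γ : C(Icc a b, G) | MapsTo γ univ
      (c.φ.source ∩ c.φ ⁻¹' Metric.ball 0 (r₁ / 2))} :=
    ContinuousMap.isOpen_setOfPred_mapsTo isCompact_univ hO
  have hc : Continuous fun γ : C(Icc a b, G) => γ⁻¹ * (η⁻¹ * η') := by fun_prop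
  -- Limits of elements of `Γ` need not preserve `R`. Hence the difference is approximated by some
  -- `γ` in `Γ`; the quotient that remains is a small loop joining two paths that both satisfy `R`,
  -- and `hloop` applies to it.
  obtain ⟨γ, hγU, hγ⟩ := mem_closure_iff.1 hmem _ (hU.preimage hc)
    (show MapsTo _ _ _ by intro t _; simpa using h1O)
  refine hloop (η * γ) (γ⁻¹ * (η⁻¹ * η')) v v' ((hγ.2.2 η hη v).1 H) ?_
    (by simp [hη, hγ.2.1]) (by simp [hη, hη', hγ.2.1]) fun t => ?_
  · rwa [mul_assoc, mul_inv_cancel_left, mul_inv_cancel_left]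
  · have := hγU (mem_univ t)
    exact ⟨this.1, (mem_ball_zero_iff.1 this.2).trans_le (by linarith)⟩

end GroupChart

/-! ### Holonomy and the reduced action -/

namespace GroupChart

variable {G V : Type*} [TopologicalSpace G] [Group G] [IsTopologicalGroup G]
  [NormedAddCommGroup V] [NormedSpace ℝ V] (c : GroupChart G V)

/-- `g` is the endpoint of the development of the multiplier `e`. -/
def IsHolonomy {a b : ℝ} (hab : a < b) {k : ℕ} (U : (Fin k → ℝ) ≃L[ℝ] V)
    (e : Multiplier k a b) (g : G) : Prop :=
  ∃ h : ℝ → G, c.IsDevelopment a b (frameCurve hab U e) h ∧ h b = g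

theorem existsUnique_isHolonomy [CompleteSpace V] [T2Space G] {a b : ℝ} (hab : a < b) {k : ℕ}
    (U : (Fin k → ℝ) ≃L[ℝ] V) (e : Multiplier k a b) : ∃! g, c.IsHolonomy hab U e g := by
  obtain ⟨h, hh⟩ := exists_isDevelopment (c := c) a b (continuous_frameCurve hab U e)
    (exists_norm_frameCurve_le hab U e)
  refine ⟨h b, ⟨h, hh, rfl⟩, ?_⟩
  rintro _ ⟨h', hh', rfl⟩
  exact hh'.eqOn hh (exists_norm_frameCurve_le hab U e) ⟨hab.le, le_rfl⟩

end GroupChart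

namespace FirstClassSystem

open GroupChart

variable {n k : ℕ} {S : FirstClassSystem n k} {a b : ℝ} {hab : a < b}
  {C : DarbouxChange S.N} {D : Set (HJData n k a b)} {x : HJData n k a b → ℝ → Phase n}
  {G V : Type*} [TopologicalSpace G] [Group G] [IsTopologicalGroup G]
  [NormedAddCommGroup V] [NormedSpace ℝ V] [CompleteSpace V] {c : GroupChart G V}
  {U : (Fin k → ℝ) ≃L[ℝ] V}

/-- In the Lie algebra case the Hamilton-Jacobi action only depends on the holonomy of the
multiplier. -/
theorem IsSolutionFamily.hjAction_eq_of_isHolonomy [SimplyConnectedSpace G]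
    (hx : S.IsSolutionFamily hab C D x) {cst : Fin k → Fin k → Fin k → ℝ}
    (hcst : ∀ α β, ∀ y ∈ S.N, poissonBracket (S.H α) (S.H β) y = ∑ γ, cst α β γ * S.H γ y)
    (hbr : ∀ v w, U.symm (c.bracket (U v) (U w)) = fun δ => ∑ α, ∑ β, cst α β δ * v α * w β)
    {r : ℝ} (hr : 0 < r) (hreg : Metric.ball (0 : V) r ⊆ c.reg)
    {w : (Fin n → ℝ) × (Fin n → ℝ)} {g : G}
    (hD : ∀ e, c.IsHolonomy hab U e g → (w, e) ∈ D) {e e' : Multiplier k a b}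
    (H : c.IsHolonomy hab U e g) (H' : c.IsHolonomy hab U e' g) :
    S.hjAction hab C x (w, e) = S.hjAction hab C x (w, e') := by
  have hext : ∀ η : C(Icc a b, G), IccExtend hab.le η b = η ⟨b, right_mem_Icc.2 hab.le⟩ :=
    fun η => IccExtend_right _ _
  have hlift : ∀ (h : ℝ → G) {e₁}, c.IsDevelopment a b (frameCurve hab U e₁) h →
      ∃ η : C(Icc a b, G), EqOn (IccExtend hab.le η) h (Icc a b) := fun h e₁ hh =>
    ⟨⟨_, hh.continuousOn.domRestrict⟩, fun t ht => IccExtend_of_mem _ _ ht⟩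
  obtain ⟨h, hh, hb⟩ := H
  obtain ⟨h', hh', hb'⟩ := H'
  obtain ⟨η, hη⟩ := hlift h hh
  obtain ⟨η', hη'⟩ := hlift h' hh'
  -- The relation says that the path develops some multiplier on which the action has the given
  -- value; the differentiability of the path is hidden in it.
  refine c.eq_of_forall_small_loop hab hr (g := g) (R := fun η v => ∃ e,
      c.IsDevelopment a b (frameCurve hab U e) (IccExtend hab.le η) ∧
        S.hjAction hab C x (w, e) = v) ?_ ?_ ?_
    (η := η) (η' := η') ⟨e, hh.congr hab.le hη, rfl⟩ ⟨e', hh'.congr hab.le hη', rfl⟩ ?_ ?_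
  · rintro η v ⟨e, he, -⟩
    rw [← he.1, IccExtend_left]
  · rintro η v ⟨e, he, -⟩ y hy hya hyr γ hγ
    obtain ⟨e', he'⟩ := exists_isDevelopment_mul_symm hab U he
      (fun t ht => (hy.differentiableOn (by simp) t ht).hasDerivWithinAt)
      (hy.continuousOn_derivWithin (uniqueDiffOn_Icc hab) le_rfl)
      (fun t ht => hreg (mem_ball_zero_iff.2 (hyr t ht))) hya
    refine ⟨_, e', he'.congr hab.le fun t ht => ?_, rfl⟩
    simp only [IccExtend_of_mem _ _ ht, ContinuousMap.mul_apply, hγ]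
  · rintro η γ _ _ ⟨e, he, rfl⟩ ⟨e', he', rfl⟩ hηb hγb hγ
    refine hx.hjAction_eq_of_small_loop U hcst hbr hreg (h := IccExtend hab.le η)
      (ℓ := IccExtend hab.le γ) (fun e₁ h₁ H₁ hb₁ => hD _ ⟨h₁, H₁, ?_⟩) he
      (he'.congr hab.le fun t ht => ?_) ?_ fun t ht => ?_
    · rw [hb₁, hext, hηb]
    · simp only [IccExtend_of_mem _ _ ht, ContinuousMap.mul_apply]
    · rw [hext, hγb]
    · rw [IccExtend_of_mem _ _ ht, mem_ball_zero_iff]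
      exact hγ _
  · rw [← hext, hη ⟨hab.le, le_rfl⟩, hb]
  · rw [← hext, hη' ⟨hab.le, le_rfl⟩, hb']

/-- The reduced Hamilton-Jacobi action in the Lie algebra case. -/
theorem IsSolutionFamily.exists_reducedAction_of_isHolonomy [SimplyConnectedSpace G] [T2Space G]
    {E : Type*} [NormedAddCommGroup E] [NormedSpace ℝ E] [ChartedSpace E G]
    [IsManifold 𝓘(ℝ, E) 1 G]
    (hc : ∀ g : G, ContMDiffAt 𝓘(ℝ, E) 𝓘(ℝ, V) 1 (fun g' => c.φ (g⁻¹ * g')) g)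
    (hc' : ∀ g : G, ∀ δ : V, ∃ ξ, mfderiv 𝓘(ℝ, E) 𝓘(ℝ, V) (fun g' => c.φ (g⁻¹ * g')) g ξ = δ)
    (hx : S.IsSolutionFamily hab C D x) {cst : Fin k → Fin k → Fin k → ℝ}
    (hcst : ∀ α β, ∀ y ∈ S.N, poissonBracket (S.H α) (S.H β) y = ∑ γ, cst α β γ * S.H γ y)
    (hbr : ∀ v w, U.symm (c.bracket (U v) (U w)) = fun δ => ∑ α, ∑ β, cst α β δ * v α * w β)
    (hD : ∀ z ∈ D, ∀ e g, c.IsHolonomy hab U z.2 g → c.IsHolonomy hab U e g → (z.1, e) ∈ D) :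
    ∃ Shat : ((Fin n → ℝ) × (Fin n → ℝ)) × G → ℝ,
      (∀ z ∈ D, ∀ g, c.IsHolonomy hab U z.2 g → Shat (z.1, g) = S.hjAction hab C x z) ∧
      IsGeneralizedGeneratingFunction (E := E)
        {w | ∃ e, (w.1, e) ∈ D ∧ c.IsHolonomy hab U e w.2} Shat
        (inCoordinates C (S.evolutionRelation hab C D)) ∧
      ∀ z ∈ D, ∀ g, c.IsHolonomy hab U z.2 g →
        (mfderiv 𝓘(ℝ, E) 𝓘(ℝ) (fun g' : G => Shat (z.1, g')) g = 0 ↔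
          S.SatisfiesConstraints a b (x z)) := by
  obtain ⟨r, hr, hreg⟩ := Metric.isOpen_iff.1 c.isOpen_reg 0 c.zero_mem_reg
  refine hx.exists_reducedAction (E := E)
    (fun z _ => (c.existsUnique_isHolonomy hab U z.2).exists) ?_ ?_
  · rintro ⟨w, e⟩ hz ⟨w', e'⟩ hz' g rfl H H'
    exact hx.hjAction_eq_of_isHolonomy hcst hbr hr hreg (fun e h => hD _ hz _ _ H h) H H'
  · rintro ⟨w, e⟩ hz g ⟨h, hh, rfl⟩
    have hba : b - a ≠ 0 := (sub_pos.2 hab).ne'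
    -- A linear ramp from zero to the identity: the development multiplied by it ends at `h(b)
    -- φ⁻¹(p)`, so `p = φ(h(b)⁻¹ g')` gives holonomy `g'`.
    let v : ℝ → V →L[ℝ] V := fun t => ((t - a) / (b - a)) • ContinuousLinearMap.id ℝ V
    have hvd : ∀ t ∈ Icc a b, HasDerivWithinAt v ((1 / (b - a)) • ContinuousLinearMap.id ℝ V)
        (Icc a b) t := fun t _ =>
      ((((hasDerivAt_id t).sub_const a).div_const (b - a)).smul_const
        (ContinuousLinearMap.id ℝ V)).hasDerivWithinAt
    have hvb : ∀ p, v b p = p := fun p => by simp [v, div_self hba]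
    have hvt : ∀ p, ‖p‖ < r → ∀ t ∈ Icc a b, v t p ∈ c.reg := fun p hp t ht => hreg (by
      rw [mem_ball_zero_iff, smul_apply, ContinuousLinearMap.id_apply, norm_smul,
        Real.norm_of_nonneg (div_nonneg (sub_nonneg.2 ht.1) (sub_pos.2 hab).le)]
      refine lt_of_le_of_lt (mul_le_of_le_one_left (norm_nonneg _) ?_) hp
      exact (div_le_one (sub_pos.2 hab)).2 (sub_le_sub_right ht.2 _))
    obtain ⟨σ, h1, h2, h3⟩ := exists_multiplier_variation hab U hh (v := v)
      (O := {p | ‖p‖ < r}) (isOpen_lt continuous_norm continuous_const) hvd continuousOn_const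
      (fun p hp t ht => hvt p hp t ht) (by simp [v])
    have h0 : (0 : V) ∈ {p : V | ‖p‖ < r} := by simpa using hr
    have hσ0 : σ 0 = e := frameCurve_injective hab U
      (((h2 0 h0).congr hab.le fun t _ => by simp).eqOn_left hab hh)
    have hφ : c.φ ((h b)⁻¹ * h b) = 0 := by rw [inv_mul_cancel, c.map_one]
    have hσ1 : ContDiffAt ℝ 1 σ (c.φ ((h b)⁻¹ * h b)) := by
      rw [hφ]
      exact h1.contDiffAt ((isOpen_lt continuous_norm continuous_const).mem_nhds h0)
    refine ⟨fun g' => σ (c.φ ((h b)⁻¹ * g')), by simp only [hφ, hσ0],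
      hσ1.contMDiffAt.comp (h b) (hc (h b)), ?_, fun hv => ?_⟩
    · have hev : ∀ᶠ g' in 𝓝 (h b), (h b)⁻¹ * g' ∈ c.φ.source :=
        (continuous_const.mul continuous_id).continuousAt.eventually_mem
          (c.φ.open_source.mem_nhds (by simpa using c.one_mem))
      have hnorm : ∀ᶠ g' in 𝓝 (h b), ‖c.φ ((h b)⁻¹ * g')‖ < r :=
        ((hc (h b)).continuousAt.norm.eventually_lt continuousAt_const (by rwa [hφ, norm_zero]))
      filter_upwards [hev, hnorm] with g' hg' hr'
      refine ⟨_, h2 _ hr', ?_⟩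
      rw [hvb, c.φ.left_inv hg', mul_inv_cancel_left]
    · have hev := hx.evolution _ hz
      refine hev.satisfiesConstraints_of_final fun δ => ?_
      -- The tangent vector is chosen so that the gauge parameter of the section becomes the ramp
      -- times the unit vector `δ`. Its pairing with the constraints is then `H_δ` at the final
      -- time.
      obtain ⟨ξ, hξ⟩ := hc' (h b) (U (Pi.single δ 1))
      have hcomp : mfderiv 𝓘(ℝ, E) 𝓘(ℝ, Multiplier k a b)
          (fun g' => σ (c.φ ((h b)⁻¹ * g'))) (h b) ξ = fderiv ℝ σ 0 (U (Pi.single δ 1)) := by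
        have hd : MDifferentiableAt 𝓘(ℝ, V) 𝓘(ℝ, Multiplier k a b) σ (c.φ ((h b)⁻¹ * h b)) :=
          (hσ1.differentiableAt (by simp)).mdifferentiableAt
        have := mfderiv_comp (h b) hd ((hc (h b)).mdifferentiableAt (by simp))
        rw [mfderiv_eq_fderiv, hφ] at this
        rw [← hξ]
        exact DFunLike.congr_fun this ξ
      have hp : multiplierPairing hab (S.constraintCurve (x (w, e)))
          (fderiv ℝ σ 0 (U (Pi.single δ 1))) = 0 := by
        rw [← hcomp]; exact hv ξ
      rw [hev.multiplierPairing_of_lie hcst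
        (γ := fun τ => U.symm (c.Xinv (v τ 0) (v τ (U (Pi.single δ 1)))))] at hp
      · simpa [v, hvb, c.Xinv_zero, div_self hba, Pi.single_apply] using hp
      · intro t ht
        have := h3 0 h0 (U (Pi.single δ 1)) t ht
        rwa [frameCurve, ← U.apply_symm_apply (c.Xinv (v t 0) (v t (U (Pi.single δ 1)))), hbr,
          hσ0] at this

end FirstClassSystem

/-! ### The chart of a Lie group at the identity -/

section LieGroup

variable {E : Type*} [NormedAddCommGroup E] [NormedSpace ℝ E] (G : Type*) [TopologicalSpace G]
  [ChartedSpace E G]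

/-- The preferred chart at the identity, centred at zero. -/
def centeredChart [One G] : OpenPartialHomeomorph G E :=
  (chartAt E (1 : G)).transHomeomorph (Homeomorph.addRight (-chartAt E (1 : G) 1))

variable {G}

omit [NormedSpace ℝ E] in
theorem centeredChart_apply [One G] (g : G) :
    centeredChart (E := E) G g = chartAt E (1 : G) g - chartAt E (1 : G) 1 :=
  (sub_eq_add_neg _ _).symm

omit [NormedSpace ℝ E] in
theorem addRight_neg_symm_apply (v x : E) : (Homeomorph.addRight (-v)).symm x = x + v := by
  change x + - -v = x + v
  rw [neg_neg]

omit [NormedSpace ℝ E] in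
theorem centeredChart_symm_apply [One G] (x : E) :
    (centeredChart (E := E) G).symm x = (chartAt E (1 : G)).symm (x + chartAt E (1 : G) 1) := by
  simp [centeredChart, addRight_neg_symm_apply]

theorem contMDiffOn_centeredChart [One G] [IsManifold 𝓘(ℝ, E) ∞ G] :
    ContMDiffOn 𝓘(ℝ, E) 𝓘(ℝ, E) ∞ (centeredChart (E := E) G) (centeredChart (E := E) G).source :=
  (contDiff_id.sub contDiff_const).contMDiff.comp_contMDiffOn
    (contMDiffOn_chart (I := 𝓘(ℝ, E)) (x := (1 : G))) |>.congr fun g _ => centeredChart_apply g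

theorem contMDiffOn_centeredChart_symm [One G] [IsManifold 𝓘(ℝ, E) ∞ G] :
    ContMDiffOn 𝓘(ℝ, E) 𝓘(ℝ, E) ∞ (centeredChart (E := E) G).symm
      (centeredChart (E := E) G).target := by
  have h := (contMDiffOn_chart_symm (I := 𝓘(ℝ, E)) (n := ∞) (x := (1 : G))).comp
    (contDiff_id.add (contDiff_const (c := chartAt E (1 : G) 1))).contMDiff.contMDiffOn
    (s := (centeredChart (E := E) G).target) fun x hx => by
      simpa [centeredChart, addRight_neg_symm_apply] using hx
  exact h.congr fun x _ => centeredChart_symm_apply x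

variable (G) [Group G] [LieGroup 𝓘(ℝ, E) ∞ G]

/-- The chart of a Lie group around the identity. -/
def lieGroupChart : GroupChart G E where
  φ := centeredChart G
  one_mem := by simp [centeredChart]
  map_one := by rw [centeredChart_apply, sub_self]
  contDiffOn_mul := by
    have : IsManifold 𝓘(ℝ, E) ∞ G := inferInstance
    rw [← contMDiffOn_iff_contDiffOn]
    refine contMDiffOn_centeredChart.comp ?_ fun p hp => hp.2.2
    exact (contMDiffOn_centeredChart_symm.comp contDiff_fst.contMDiff.contMDiffOn
      fun p hp => hp.1).mul (contMDiffOn_centeredChart_symm.comp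
        contDiff_snd.contMDiff.contMDiffOn fun p hp => hp.2.1)
  contDiffOn_inv := by
    rw [← contMDiffOn_iff_contDiffOn]
    refine contMDiffOn_centeredChart.comp ?_ fun p hp => hp.2
    exact (contMDiffOn_centeredChart_symm.mono fun p hp => hp.1).inv

variable {G}

theorem contMDiffAt_lieGroupChart {g : G} (hg : g ∈ (lieGroupChart (E := E) G).φ.source) :
    ContMDiffAt 𝓘(ℝ, E) 𝓘(ℝ, E) ∞ (lieGroupChart (E := E) G).φ g :=
  contMDiffOn_centeredChart.contMDiffAt ((lieGroupChart G).φ.open_source.mem_nhds hg)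

theorem contMDiffAt_lieGroupChart_symm {x : E} (hx : x ∈ (lieGroupChart (E := E) G).φ.target) :
    ContMDiffAt 𝓘(ℝ, E) 𝓘(ℝ, E) ∞ (lieGroupChart (E := E) G).φ.symm x :=
  contMDiffOn_centeredChart_symm.contMDiffAt ((lieGroupChart G).φ.open_target.mem_nhds hx)

/-- The tangent space at the identity is identified with `E` by this very chart, up to a
translation. -/
theorem hasMFDerivAt_lieGroupChart_one :
    HasMFDerivAt 𝓘(ℝ, E) 𝓘(ℝ, E) (lieGroupChart (E := E) G).φ 1 (ContinuousLinearMap.id ℝ E) := by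
  refine ⟨(contMDiffAt_lieGroupChart (lieGroupChart G).one_mem).continuousAt, ?_⟩
  have hx : chartAt E (1 : G) 1 ∈ (chartAt E (1 : G)).target := mem_chart_target E 1
  have h : HasFDerivAt (fun x : E => x - chartAt E (1 : G) 1) (ContinuousLinearMap.id ℝ E)
      (chartAt E (1 : G) 1) := (hasFDerivAt_id _).sub_const _
  refine HasFDerivAt.hasFDerivWithinAt (h.congr_of_eventuallyEq ?_)
  filter_upwards [(chartAt E (1 : G)).open_target.mem_nhds hx] with x hx
  simp [writtenInExtChartAt, lieGroupChart, centeredChart_apply, chartAt_self_eq, (chartAt E (1 : G)).right_inv hx]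

theorem hasMFDerivAt_lieGroupChart_symm_zero :
    HasMFDerivAt 𝓘(ℝ, E) 𝓘(ℝ, E) (lieGroupChart (E := E) G).φ.symm 0
      (ContinuousLinearMap.id ℝ E) := by
  have h1 := ((contMDiffAt_lieGroupChart_symm (lieGroupChart (E := E) G).zero_mem).mdifferentiableAt
    (by simp)).hasMFDerivAt
  have h2 : HasMFDerivAt 𝓘(ℝ, E) 𝓘(ℝ, E) (lieGroupChart (E := E) G).φ
      ((lieGroupChart (E := E) G).φ.symm 0) (ContinuousLinearMap.id ℝ E) := by
    rw [(lieGroupChart G).symm_zero]; exact hasMFDerivAt_lieGroupChart_one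
  have h3 := (h2.comp 0 h1).congr_of_eventuallyEq (f₁ := id) (by
    filter_upwards [(lieGroupChart (E := E) G).φ.open_target.mem_nhds
      (lieGroupChart (E := E) G).zero_mem] with x hx using
        ((lieGroupChart (E := E) G).φ.right_inv hx).symm)
  have h4 := hasMFDerivAt_unique h3 (hasMFDerivAt_id 0)
  have h5 : mfderiv 𝓘(ℝ, E) 𝓘(ℝ, E) (lieGroupChart (E := E) G).φ.symm 0 =
      ContinuousLinearMap.id ℝ E := h4
  rwa [h5] at h1

theorem hasMFDerivAt_mul_left (g g' : G) : HasMFDerivAt 𝓘(ℝ, E) 𝓘(ℝ, E) (g * ·) g'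
    (mfderiv 𝓘(ℝ, E) 𝓘(ℝ, E) (g * ·) g') :=
  ((contMDiff_mul_left (I := 𝓘(ℝ, E)) (n := ∞) (a := g)).mdifferentiableAt (by simp)).hasMFDerivAt

end LieGroup

/-! ### Comparison with the Lie group structure -/

section LieGroup

variable {E : Type*} [NormedAddCommGroup E] [NormedSpace ℝ E] {G : Type*} [TopologicalSpace G]
  [ChartedSpace E G] [Group G] [LieGroup 𝓘(ℝ, E) ∞ G]

theorem contMDiffAt_lieGroupChart_inv_mul (g : G) :
    ContMDiffAt 𝓘(ℝ, E) 𝓘(ℝ, E) ∞ (fun g' => (lieGroupChart (E := E) G).φ (g⁻¹ * g')) g :=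
  ContMDiffAt.comp g (contMDiffAt_lieGroupChart
    (by rw [inv_mul_cancel]; exact (lieGroupChart G).one_mem)) contMDiff_mul_left.contMDiffAt

/-- The chain rule for `φ = φ(g⁻¹ (g ·))` at the identity. In particular the translated charts have
surjective derivative at their centre. -/
theorem mfderiv_lieGroupChart_inv_mul (g : G) (ξ : GroupLieAlgebra 𝓘(ℝ, E) G) :
    mfderiv 𝓘(ℝ, E) 𝓘(ℝ, E) (fun g' => (lieGroupChart (E := E) G).φ (g⁻¹ * g')) g
      (mulInvariantVectorField (I := 𝓘(ℝ, E)) ξ g) = ξ := by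
  let M : E →L[ℝ] E := mfderiv 𝓘(ℝ, E) 𝓘(ℝ, E) (g * ·) (1 : G)
  let A : E →L[ℝ] E :=
    mfderiv 𝓘(ℝ, E) 𝓘(ℝ, E) (fun g' => (lieGroupChart (E := E) G).φ (g⁻¹ * g')) g
  have hA : HasMFDerivAt 𝓘(ℝ, E) 𝓘(ℝ, E) (fun g' => (lieGroupChart (E := E) G).φ (g⁻¹ * g'))
      (g * 1) A := by
    rw [mul_one]
    exact ((contMDiffAt_lieGroupChart_inv_mul g).mdifferentiableAt (by simp)).hasMFDerivAt
  have h := hA.comp (1 : G) (hasMFDerivAt_mul_left (E := E) g 1)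
  have h1 : HasMFDerivAt 𝓘(ℝ, E) 𝓘(ℝ, E) (lieGroupChart (E := E) G).φ 1 (A.comp M) :=
    h.congr_of_eventuallyEq (Eventually.of_forall fun g' => by simp)
  have h2 := hasMFDerivAt_unique h1 hasMFDerivAt_lieGroupChart_one
  have h3 : A.comp M = ContinuousLinearMap.id ℝ E := h2
  exact DFunLike.congr_fun h3 ξ

/-- The logarithmic derivative of a path in a Lie group, in terms of the derivative of the path. -/
theorem hasMFDerivWithinAt_iff_hasLogDerivWithinAt {h : ℝ → G} {s : Set ℝ} {t : ℝ}
    (ξ : GroupLieAlgebra 𝓘(ℝ, E) G) :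
    HasMFDerivWithinAt 𝓘(ℝ) 𝓘(ℝ, E) h s t ((1 : ℝ →L[ℝ] ℝ).smulRight
      (mulInvariantVectorField (I := 𝓘(ℝ, E)) ξ (h t))) ↔
    (lieGroupChart (E := E) G).HasLogDerivWithinAt h ξ s t := by
  have : IsTopologicalGroup G := topologicalGroup_of_lieGroup 𝓘(ℝ, E) ∞
  set c := lieGroupChart (E := E) G with hc
  constructor
  · intro H
    refine ⟨H.continuousWithinAt, ?_⟩
    have h1 := ((contMDiffAt_lieGroupChart_inv_mul (E := E) (h t)).mdifferentiableAt
      (by simp)).hasMFDerivAt.comp_hasMFDerivWithinAt t H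
    have h2 := hasMFDerivWithinAt_iff_hasFDerivWithinAt.1 h1
    refine hasDerivWithinAt_iff_hasFDerivWithinAt.2 (h2.congr_fderiv ?_)
    let A : E →L[ℝ] E :=
      mfderiv 𝓘(ℝ, E) 𝓘(ℝ, E) (fun g' => c.φ ((h t)⁻¹ * g')) (h t)
    let m : E := mulInvariantVectorField (I := 𝓘(ℝ, E)) ξ (h t)
    have hm : A m = ξ := mfderiv_lieGroupChart_inv_mul (h t) ξ
    apply ContinuousLinearMap.ext_ring
    change A ((1 : ℝ) • m) = (1 : ℝ) • (show E from ξ)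
    rw [one_smul, hm, one_smul]
  · rintro ⟨H1, H2⟩
    set w : ℝ → E := fun τ => c.φ ((h t)⁻¹ * h τ) with hw
    have hw0 : w t = 0 := by simp [hw, c.map_one]
    let M : E →L[ℝ] E := mfderiv 𝓘(ℝ, E) 𝓘(ℝ, E) (h t * ·) (1 : G)
    let ξ' : E := ξ
    let d : ℝ →L[ℝ] E := (1 : ℝ →L[ℝ] ℝ).smulRight ξ'
    have h0 : HasFDerivWithinAt w d s t :=
      (show HasDerivWithinAt w ξ' s t from H2).hasFDerivWithinAt.congr_fderiv (by ext; simp [d])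
    have h1 : HasMFDerivWithinAt 𝓘(ℝ) 𝓘(ℝ, E) w s t d :=
      hasMFDerivWithinAt_iff_hasFDerivWithinAt.2 h0
    have h2 : HasMFDerivAt 𝓘(ℝ, E) 𝓘(ℝ, E) c.φ.symm (w t) (ContinuousLinearMap.id ℝ E) := by
      rw [hw0]; exact hasMFDerivAt_lieGroupChart_symm_zero
    have h3 : HasMFDerivAt 𝓘(ℝ, E) 𝓘(ℝ, E) (h t * ·) (c.φ.symm (w t)) M := by
      rw [hw0, c.symm_zero]; exact hasMFDerivAt_mul_left (h t) 1
    -- Near `t` the path is `h(t) φ⁻¹(w(τ))`, with both factors differentiable at the identity.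
    have h4 := h3.comp_hasMFDerivWithinAt t (h2.comp_hasMFDerivWithinAt t h1)
    have hev : ∀ᶠ τ in 𝓝[s] t, (h t)⁻¹ * h τ ∈ c.φ.source :=
      (continuousWithinAt_const.mul H1).eventually_mem
        (c.φ.open_source.mem_nhds (by change (h t)⁻¹ * h t ∈ _; rw [inv_mul_cancel]; exact c.one_mem))
    have h5 := h4.congr_of_eventuallyEq (f₁ := h) (by
      filter_upwards [hev] with τ hτ
      simp [hw, c.φ.left_inv hτ]) (by simp [hw, c.map_one])
    have e : M.comp ((ContinuousLinearMap.id ℝ E).comp d) =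
        (1 : ℝ →L[ℝ] ℝ).smulRight (M ξ') := by ext; simp [d]
    exact (congrArg (HasMFDerivWithinAt 𝓘(ℝ) 𝓘(ℝ, E) h s t) e).mp h5

/-- The left-invariant vector fields, in the chart. -/
theorem mpullback_mulInvariantVectorField_chart {x : E}
    (hx : x ∈ (lieGroupChart (E := E) G).φ.target) (ξ : GroupLieAlgebra 𝓘(ℝ, E) G) :
    VectorField.mpullback 𝓘(ℝ, E) 𝓘(ℝ, E) (lieGroupChart (E := E) G).φ.symm
      (mulInvariantVectorField (I := 𝓘(ℝ, E)) ξ) x = (lieGroupChart (E := E) G).X x ξ := by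
  have : IsTopologicalGroup G := topologicalGroup_of_lieGroup 𝓘(ℝ, E) ∞
  set c := lieGroupChart (E := E) G with hc
  set g := c.φ.symm x with hg
  let A : E →L[ℝ] E := mfderiv 𝓘(ℝ, E) 𝓘(ℝ, E) c.φ g
  let A' : E →L[ℝ] E := mfderiv 𝓘(ℝ, E) 𝓘(ℝ, E) c.φ.symm x
  let M : E →L[ℝ] E := mfderiv 𝓘(ℝ, E) 𝓘(ℝ, E) (g * ·) (1 : G)
  have hgs : g ∈ c.φ.source := c.φ.map_target hx
  have hA : HasMFDerivAt 𝓘(ℝ, E) 𝓘(ℝ, E) c.φ g A :=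
    ((contMDiffAt_lieGroupChart hgs).mdifferentiableAt (by simp)).hasMFDerivAt
  have hA' : HasMFDerivAt 𝓘(ℝ, E) 𝓘(ℝ, E) c.φ.symm x A' :=
    ((contMDiffAt_lieGroupChart_symm hx).mdifferentiableAt (by simp)).hasMFDerivAt
  have hA'' : HasMFDerivAt 𝓘(ℝ, E) 𝓘(ℝ, E) c.φ.symm (c.φ g) A' := by
    rw [hg, c.φ.right_inv hx]; exact hA'
  have e1 : A.comp A' = ContinuousLinearMap.id ℝ E :=
    hasMFDerivAt_unique ((hA.comp x hA').congr_of_eventuallyEq (f₁ := id) (by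
      filter_upwards [c.φ.open_target.mem_nhds hx] with y hy using (c.φ.right_inv hy).symm))
      (hasMFDerivAt_id x)
  have e2 : A'.comp A = ContinuousLinearMap.id ℝ E :=
    hasMFDerivAt_unique ((hA''.comp g hA).congr_of_eventuallyEq (f₁ := id) (by
      filter_upwards [c.φ.open_source.mem_nhds hgs] with y hy using (c.φ.left_inv hy).symm))
      (hasMFDerivAt_id g)
  have h1 : HasMFDerivAt 𝓘(ℝ, E) 𝓘(ℝ, E) c.φ (g * 1) A := by rw [mul_one]; exact hA
  have h2 := h1.comp (1 : G) (hasMFDerivAt_mul_left (E := E) g 1)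
  have h3 : HasMFDerivAt 𝓘(ℝ, E) 𝓘(ℝ, E) (fun y => c.mul (x, y)) (c.φ 1) (c.X x) := by
    rw [c.map_one]; exact (c.hasFDerivAt_X hx).hasMFDerivAt
  have h4 := h3.comp (1 : G) hasMFDerivAt_lieGroupChart_one
  have e3 : A.comp M = (c.X x).comp (ContinuousLinearMap.id ℝ E) :=
    hasMFDerivAt_unique h2 (h4.congr_of_eventuallyEq (by
      filter_upwards [c.φ.open_source.mem_nhds c.one_mem] with y hy
      simp [GroupChart.mul, c.φ.left_inv hy, hg]))
  have e4 : A'.inverse = A := ContinuousLinearMap.inverse_eq e2 e1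
  exact (DFunLike.congr_fun e4 (M ξ)).trans (DFunLike.congr_fun e3 ξ)

theorem mlieBracket_eq_lieBracket (V W : (x : E) → TangentSpace 𝓘(ℝ, E) x) :
    VectorField.mlieBracket 𝓘(ℝ, E) V W = VectorField.lieBracket ℝ V W := by
  rw [← VectorField.mlieBracketWithin_univ, VectorField.mlieBracketWithin_eq_lieBracketWithin]
  exact VectorField.lieBracketWithin_univ

omit [ChartedSpace E G] [LieGroup 𝓘(ℝ, E) ∞ G] in
theorem GroupChart.mlieBracket_X [IsTopologicalGroup G] (c : GroupChart G E) (ξ η : E) :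
    VectorField.mlieBracket 𝓘(ℝ, E) (fun x : E => c.X x ξ) (fun x => c.X x η) 0 =
      c.bracket ξ η := by
  have hd (ζ v : E) : fderiv ℝ (fun x => c.X x ζ) 0 v = fderiv ℝ c.X 0 v ζ :=
    DFunLike.congr_fun ((ContinuousLinearMap.apply ℝ E ζ).hasFDerivAt.comp (0 : E)
      ((c.contDiffAt_X c.zero_mem).differentiableAt (by simp)).hasFDerivAt).fderiv v
  refine (congrFun (mlieBracket_eq_lieBracket (fun x => c.X x ξ) (fun x => c.X x η)) 0).trans ?_
  change fderiv ℝ (fun x => c.X x η) 0 (c.X 0 ξ) - fderiv ℝ (fun x => c.X x ξ) 0 (c.X 0 η) = _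
  rw [c.X_zero, hd, hd]
  rfl

variable [CompleteSpace E]

/-- The bracket of the Lie algebra, computed in the chart. -/
theorem lie_eq_bracket_lieGroupChart (ξ η : GroupLieAlgebra 𝓘(ℝ, E) G) :
    ⁅ξ, η⁆ = (lieGroupChart (E := E) G).bracket ξ η := by
  have : IsTopologicalGroup G := topologicalGroup_of_lieGroup 𝓘(ℝ, E) ∞
  have : LieGroup 𝓘(ℝ, E) (minSmoothness ℝ 3) G := by
    rw [minSmoothness_of_isRCLikeNormedField]
    exact LieGroup.of_le (n := ∞) ENat.LEInfty.out
  have : IsManifold 𝓘(ℝ, E) (minSmoothness ℝ 2) G := by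
    rw [minSmoothness_of_isRCLikeNormedField]
    exact IsManifold.of_le (n := ∞) ENat.LEInfty.out
  set c := lieGroupChart (E := E) G with hc
  -- The Lie bracket is the commutator of left-invariant fields at the identity; pulled back along
  -- the inverse chart these are the fields `X`.
  have h := VectorField.mpullback_mlieBracket (I := 𝓘(ℝ, E)) (I' := 𝓘(ℝ, E)) (n := ∞)
    (f := c.φ.symm) (x₀ := (0 : E))
    (mdifferentiableAt_mulInvariantVectorField ξ) (mdifferentiableAt_mulInvariantVectorField η)
    (contMDiffAt_lieGroupChart_symm c.zero_mem)
    (by rw [minSmoothness_of_isRCLikeNormedField]; exact ENat.LEInfty.out)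
  rw [← mulInvariantVector_mlieBracket, mpullback_mulInvariantVectorField_chart c.zero_mem,
    c.X_zero] at h
  have hev (ζ : GroupLieAlgebra 𝓘(ℝ, E) G) : VectorField.mpullback 𝓘(ℝ, E) 𝓘(ℝ, E) c.φ.symm
      (mulInvariantVectorField (I := 𝓘(ℝ, E)) ζ) =ᶠ[𝓝 (0 : E)] fun x => c.X x ζ := by
    filter_upwards [c.φ.open_target.mem_nhds c.zero_mem] with x hx using
      mpullback_mulInvariantVectorField_chart hx ζ
  rw [(hev ξ).mlieBracket_vectorField_eq (hev η)] at h
  exact h.trans (c.mlieBracket_X ξ η)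

end LieGroup

theorem GroupChart.bracket_sum {G V : Type*} [TopologicalSpace G] [Group G]
    [NormedAddCommGroup V] [NormedSpace ℝ V] (c : GroupChart G V)
    {ι : Type*} [Fintype ι] (u : ι → V) (v w : ι → ℝ) :
    c.bracket (∑ i, v i • u i) (∑ j, w j • u j) =
      ∑ i, ∑ j, (v i * w j) • c.bracket (u i) (u j) := by
  have e (D : V →L[ℝ] V →L[ℝ] V) : D (∑ i, v i • u i) (∑ j, w j • u j) =
      ∑ i, ∑ j, (v i * w j) • D (u i) (u j) := by
    simp only [map_sum, map_smul, sum_apply, smul_apply, Finset.smul_sum, mul_smul]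
    rw [Finset.sum_comm]
    exact Finset.sum_congr rfl fun i _ => Finset.sum_congr rfl fun j _ => smul_comm _ _ _
  exact e (fderiv ℝ c.X 0 - (fderiv ℝ c.X 0).flip)

section LieGroup

variable {E : Type*} [NormedAddCommGroup E] [NormedSpace ℝ E] {G : Type*} [TopologicalSpace G]
  [ChartedSpace E G] [Group G] [LieGroup 𝓘(ℝ, E) ∞ G] {k : ℕ}

omit [LieGroup 𝓘(ℝ, E) ∞ G] in
theorem exists_continuousLinearEquiv_of_basis
    (u : Module.Basis (Fin k) ℝ (GroupLieAlgebra 𝓘(ℝ, E) G)) :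
    ∃ U : (Fin k → ℝ) ≃L[ℝ] E, ∀ v : Fin k → ℝ, U v = ∑ α, v α • u α := by
  let L : (Fin k → ℝ) ≃ₗ[ℝ] E := u.equivFun.symm
  exact ⟨L.toContinuousLinearEquiv, fun v => u.equivFun_symm_apply v⟩

variable {a b : ℝ} {hab : a < b} {u : Module.Basis (Fin k) ℝ (GroupLieAlgebra 𝓘(ℝ, E) G)}
  {U : (Fin k → ℝ) ≃L[ℝ] E}

theorem isPathOrderedExp_iff_isHolonomy (hU : ∀ v : Fin k → ℝ, U v = ∑ α, v α • u α)
    (e : Multiplier k a b) (g : G) :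
    IsPathOrderedExp hab u e g ↔ (lieGroupChart (E := E) G).IsHolonomy hab U e g := by
  refine exists_congr fun h => ?_
  have key : (∀ t ∈ Icc a b, HasMFDerivWithinAt 𝓘(ℝ) 𝓘(ℝ, E) h (Icc a b) t
      ((1 : ℝ →L[ℝ] ℝ).smulRight
        (mulInvariantVectorField (I := 𝓘(ℝ, E)) (∑ α, coeff hab e t α • u α) (h t)))) ↔
      ∀ t ∈ Icc a b, (lieGroupChart (E := E) G).HasLogDerivWithinAt h
        (GroupChart.frameCurve hab U e t) (Icc a b) t := by
    refine forall₂_congr fun t _ => ?_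
    rw [hasMFDerivWithinAt_iff_hasLogDerivWithinAt, GroupChart.frameCurve, hU]
  rw [key, GroupChart.IsDevelopment]
  tauto

theorem bracket_lieGroupChart [CompleteSpace E] (hU : ∀ v : Fin k → ℝ, U v = ∑ α, v α • u α)
    {cst : Fin k → Fin k → Fin k → ℝ} (hu : ∀ α β, ⁅u α, u β⁆ = ∑ γ, cst α β γ • u γ)
    (v w : Fin k → ℝ) : U.symm ((lieGroupChart (E := E) G).bracket (U v) (U w)) =
      fun δ => ∑ α, ∑ β, cst α β δ * v α * w β := by
  rw [ContinuousLinearEquiv.symm_apply_eq]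
  let u' : Fin k → E := fun α => u α
  have hU' (v : Fin k → ℝ) : U v = ∑ α, v α • u' α := hU v
  have hu' (α β) : (lieGroupChart (E := E) G).bracket (u' α) (u' β) = ∑ γ, cst α β γ • u' γ :=
    (lie_eq_bracket_lieGroupChart (u α) (u β)).symm.trans (hu α β)
  rw [hU', hU', hU', GroupChart.bracket_sum]
  simp only [hu', Finset.smul_sum, Finset.sum_smul, smul_smul]
  calc _ = ∑ α, ∑ γ, ∑ β, (v α * w β * cst α β γ) • u' γ :=
        Finset.sum_congr rfl fun α _ => Finset.sum_comm
    _ = ∑ γ, ∑ α, ∑ β, (v α * w β * cst α β γ) • u' γ := Finset.sum_comm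
    _ = _ := by
        refine Finset.sum_congr rfl fun γ _ => Finset.sum_congr rfl fun α _ =>
          Finset.sum_congr rfl fun β _ => ?_
        congr 1; ring

end LieGroup

end

/-! ### The theorem -/

theorem mainTheorem1 {n k : ℕ} (S : FirstClassSystem n k) (C : DarbouxChange S.N)
    {a b : ℝ} (hab : a < b) (D : Set (HJData n k a b)) (x : HJData n k a b → ℝ → Phase n)
    (hx : S.IsSolutionFamily hab C D x) :
    -- the HJ action, with the multiplier as parameter
    (IsGeneralizedGeneratingFunction (E := Multiplier k a b) D (S.hjAction hab C x)
        (inCoordinates C (S.evolutionRelation hab C D)) ∧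
      ∀ z ∈ D, fderiv ℝ (fun e => S.hjAction hab C x (z.1, e)) z.2 = 0 ↔
        S.SatisfiesConstraints a b (x z)) ∧
    -- the generalized HJ action, with the gauge class of the multiplier as parameter
    (∃ Shat : S.GaugeClass hab D x → ℝ,
      (∀ z : D, Shat (S.gaugeClass hab x z) = S.hjAction hab C x z.1) ∧
      ∀ ψ : HJData n k a b → ℝ, (∀ z : D, ψ z.1 = Shat (S.gaugeClass hab x z)) →
        IsGeneralizedGeneratingFunction (E := Multiplier k a b) D ψ
          (inCoordinates C (S.evolutionRelation hab C D))) ∧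
    -- the strictly involutive case: the parameter is `T = ∫ e`
    ((∀ α β, ∀ y ∈ S.N, poissonBracket (S.H α) (S.H β) y = 0) →
      (∀ z ∈ D, ∀ e, totalIntegral hab e = totalIntegral hab z.2 → (z.1, e) ∈ D) →
      ∃ Shat : ((Fin n → ℝ) × (Fin n → ℝ)) × (Fin k → ℝ) → ℝ,
        (∀ z ∈ D, Shat (z.1, totalIntegral hab z.2) = S.hjAction hab C x z) ∧
        IsGeneralizedGeneratingFunction (E := Fin k → ℝ)
          {w | ∃ e, (w.1, e) ∈ D ∧ totalIntegral hab e = w.2} Shat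
          (inCoordinates C (S.evolutionRelation hab C D)) ∧
        ∀ z ∈ D, fderiv ℝ (fun T => Shat (z.1, T)) (totalIntegral hab z.2) = 0 ↔
          S.SatisfiesConstraints a b (x z)) ∧
    -- the Lie algebra case: the parameter is `g = P exp ∫ e`
    (∀ (c : Fin k → Fin k → Fin k → ℝ) (G : Type*) [TopologicalSpace G] [T2Space G]
        [ChartedSpace (EuclideanSpace ℝ (Fin k)) G] [Group G]
        [LieGroup 𝓘(ℝ, EuclideanSpace ℝ (Fin k)) ∞ G] [SimplyConnectedSpace G]
        (u : Module.Basis (Fin k) ℝ (GroupLieAlgebra 𝓘(ℝ, EuclideanSpace ℝ (Fin k)) G)),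
      (∀ α β, ⁅u α, u β⁆ = ∑ γ, c α β γ • u γ) →
      (∀ α β, ∀ y ∈ S.N, poissonBracket (S.H α) (S.H β) y = ∑ γ, c α β γ * S.H γ y) →
      (∀ z ∈ D, ∀ e g, IsPathOrderedExp hab u z.2 g → IsPathOrderedExp hab u e g →
        (z.1, e) ∈ D) →
      (∀ e : Multiplier k a b, ∃! g : G, IsPathOrderedExp hab u e g) ∧
      ∃ Shat : ((Fin n → ℝ) × (Fin n → ℝ)) × G → ℝ,
        (∀ z ∈ D, ∀ g, IsPathOrderedExp hab u z.2 g → Shat (z.1, g) = S.hjAction hab C x z) ∧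
        IsGeneralizedGeneratingFunction (E := EuclideanSpace ℝ (Fin k))
          {w | ∃ e, (w.1, e) ∈ D ∧ IsPathOrderedExp hab u e w.2} Shat
          (inCoordinates C (S.evolutionRelation hab C D)) ∧
        ∀ z ∈ D, ∀ g, IsPathOrderedExp hab u z.2 g →
          (mfderiv 𝓘(ℝ, EuclideanSpace ℝ (Fin k)) 𝓘(ℝ) (fun g' : G => Shat (z.1, g')) g = 0 ↔
            S.SatisfiesConstraints a b (x z))) := by
  refine ⟨⟨hx.isGeneralizedGeneratingFunction_of_eqOn fun _ _ => rfl,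
      fun z hz => hx.fderiv_hjAction_eq_zero_iff hz⟩, ?_,
    fun h hD => hx.exists_reducedAction_of_poissonBracket_eq_zero h hD, ?_⟩
  · refine ⟨Quot.lift (fun z => S.hjAction hab C x z.1) fun z z' h => hx.hjAction_eq_of_gaugeStep h,
      fun _ => rfl, fun ψ hψ => hx.isGeneralizedGeneratingFunction_of_eqOn fun z hz => ?_⟩
    exact hψ ⟨z, hz⟩
  · intro c G _ _ _ _ _ _ u hu hc hD
    obtain ⟨U, hU⟩ := exists_continuousLinearEquiv_of_basis u
    have : IsTopologicalGroup G := topologicalGroup_of_lieGroup 𝓘(ℝ, EuclideanSpace ℝ (Fin k)) ∞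
    have : IsManifold 𝓘(ℝ, EuclideanSpace ℝ (Fin k)) 1 G := .of_le (n := ∞) ENat.LEInfty.out
    simp only [isPathOrderedExp_iff_isHolonomy hU] at hD ⊢
    refine ⟨fun e => GroupChart.existsUnique_isHolonomy _ hab U e,
      hx.exists_reducedAction_of_isHolonomy (E := EuclideanSpace ℝ (Fin k))
        (fun g => (contMDiffAt_lieGroupChart_inv_mul g).of_le ENat.LEInfty.out)
        (fun g δ => ⟨_, mfderiv_lieGroupChart_inv_mul g δ⟩) hc (bracket_lieGroupChart hU hu) hD⟩
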